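/- Let $P\subset\mathbb{R}^2$ be a polygonal element: a bounded region whose boundary $\partial P$ is a simple closed polygonal line with $N\ge 3$ straight edges $E$ and $N$ distinct vertices $X_V$ (consecutive edges may be collinear), and which is star-shaped with respect to a disk of positive radius. For each edge $E$ let $n_E$ and $t_E$ be a unit normal and a unit tangent vector, with arbitrarily fixed orientations. Let $k\ge 1$ be an integer. $\mathbb{P}_\ell(P)$ and $\mathbb{P}_\ell(E)$ denote the polynomials of degree at most $\ell$ on $P$ and on $E$, with $\mathbb{P}_{-1}=\{0\}$. Boundary values of functions in $H^1(P)$ are meant in the sense of traces. The *regular space* is $$V_k(P)=\Big\{v\in[H^1(P)]^2:\ v|_{\partial P}\in[C^0(\partial P)]^2,\ v|_E\cdot t_E\in\mathbb{P}_k(E)\text{ and } v|_E\cdot n_E\in\mathbb{P}_{k+1}(E)\text{ for every edge }E,\ \Delta v\in[\mathbb{P}_{k-2}(P)]^2\Big\}.$$ For $w\in H^1(P)$ with continuous trace on $\partial P$, the elliptic projection $\Pi^\nabla_k w\in\mathbb{P}_k(P)$ is defined by $\int_P\nabla(w-\Pi^\nabla_k w)\cdot\nabla q\,dx=0$ for all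 $q\in\mathbb{P}_k(P)$ and $\int_{\partial P}(w-\Pi^\nabla_k w)\,ds=0$; it acts componentwise on vector fields. Let $Q$ be any linear space with $\mathbb{P}_k(P)=\mathbb{P}_{k-2}(P)\oplus Q$, so that the nonzero elements of $Q$ are polynomials of degree exactly $k-1$ or $k$ (for example, the span of the monomials of degrees $k-1$ and $k$ in $(x-x_P)/h_P$, where $x_P$ is the barycenter and $h_P$ the diameter of $P$). The *enhanced space* is $$V_k^{Q}(P)=\Big\{v\in[H^1(P)]^2:\ v|_{\partial P}\in[C^0(\partial P)]^2,\ v|_E\cdot t_E\in\mathbb{P}_k(E)\text{ and } v|_E\cdot n_E\in\mathbb{P}_{k+1}(E)\text{ for every edge }E,\ \Delta v\in[\mathbb{P}_{k}(P)]^2,\ \int_P (v-\Pi^\nabla_k v)\cdot q\,dx=0\ \ \forall q\in[Q]^2\Big\}.$$ Consider the following degrees of freedom of a field $v$: (a) the vertex values $v(X_V)$ at all vertices of $P$; (b) the moments $\frac1{|E|}\int_E v\cdot n_E\,q\,ds$ for all $q\in\mathbb{P}_{k-1}(E)$ and all edges $E$; (c) the moments $\frac1{|E|}\int_E v\cdot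 t_E\,q\,ds$ for all $q\in\mathbb{P}_{k-2}(E)$ and all edges $E$; (d) the moments $\frac1{|P|}\int_P v\cdot q\,dx$ for all $q\in[\mathbb{P}_{k-2}(P)]^2$ (for $k=1$ the sets (c) and (d) are empty). Then these degrees of freedom are unisolvent in $V_k(P)$, and, for every such $Q$, also in $V_k^{Q}(P)$. That is, on each of these spaces the degrees of freedom are well defined, and the map that sends $v$ to the table of its degrees of freedom is a linear bijection from the space onto $$(\mathbb{R}^2)^N\times\prod_E\mathbb{P}_{k-1}(E)^*\times\prod_E\mathbb{P}_{k-2}(E)^*\times\big([\mathbb{P}_{k-2}(P)]^2\big)^*,$$ where $^*$ denotes the dual space; in particular the dimension of the space is the number of degrees of freedom, $2N+Nk+N(k-1)+k(k-1)$. -/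

import Mathlib

open MeasureTheory Set Filter Topology

noncomputable section

/-- The Euclidean plane. -/
abbrev Plane : Type := EuclideanSpace ℝ (Fin 2)

/-- A polygonal element with `N` vertices (listed in cyclic order) and edges
`E_i = [X_i, X_{i+1}]`. The boundary is a simple closed polygonal line: distinct edges meet at most
at common end points (consecutive collinear edges, that is hanging nodes, are allowed). The open
element `region` is the bounded domain enclosed by that line, and it is star-shaped with respect to
a disk. The closed element is `closure region`. -/
structure PolygonalElement (N : ℕ) extends Polygon Plane N where
  three_le : 3 ≤ N
  vertices_injective : Function.Injective vertices
  edges_inter : ∀ i j : Fin N, i ≠ j →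
    toPolygon.edgeSet ℝ i ∩ toPolygon.edgeSet ℝ j ⊆
      {vertices i, vertices (finRotate N i)} ∩ {vertices j, vertices (finRotate N j)}
  region : Set Plane
  isOpen_region : IsOpen region
  isConnected_region : IsConnected region
  isBounded_region : Bornology.IsBounded region
  frontier_region : frontier region = toPolygon.boundary ℝ
  starShaped : ∃ (c : Plane) (r : ℝ), 0 < r ∧ ∀ y ∈ Metric.ball c r, StarConvex ℝ y region

/-! ### Polynomials -/

/-- Bivariate polynomials of total degree `< m`, that is `ℙ_{m-1}`; it is `{0}` for `m = 0`. -/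
def polyLT (m : ℕ) : Submodule ℝ (MvPolynomial (Fin 2) ℝ) :=
  MvPolynomial.restrictSupport ℝ {s | s.degree < m}

/-- Value of a bivariate polynomial at a point of the plane. -/
def pval (p : MvPolynomial (Fin 2) ℝ) (x : Plane) : ℝ := MvPolynomial.eval (fun i => x i) p

/-- `Q` is a space of polynomials of degree exactly `k - 1` or `k` (apart from `0`), that is,
`ℙ_k = ℙ_{k-2} ⊕ Q`. -/
def IsHighDegreePart (k : ℕ) (Q : Submodule ℝ (MvPolynomial (Fin 2) ℝ)) : Prop :=
  Disjoint Q (polyLT (k - 1)) ∧ Q ⊔ polyLT (k - 1) = polyLT (k + 1)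

/-! ### Weak derivatives -/

/-- The classical partial derivative. -/
def pd (i : Fin 2) (f : Plane → ℝ) (x : Plane) : ℝ := fderiv ℝ f x (EuclideanSpace.single i 1)

/-- Test functions: `φ ∈ C_c^∞(U)`. -/
def IsTestFun (U : Set Plane) (φ : Plane → ℝ) : Prop :=
  ContDiff ℝ (⊤ : ℕ∞) φ ∧ HasCompactSupport φ ∧ tsupport φ ⊆ U

/-- The space `L²(U)`. -/
abbrev L2 (U : Set Plane) : Type := Lp ℝ 2 (volume.restrict U)

/-- `G ∈ [L²(U)]²` is the weak gradient of `v ∈ L²(U)`; hence `v ∈ H¹(U)`. -/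
def HasWeakGrad (U : Set Plane) (v : L2 U) (G : Fin 2 → L2 U) : Prop :=
  ∀ (i : Fin 2) (φ : Plane → ℝ), IsTestFun U φ →
    ∫ x in U, v x * pd i φ x = - ∫ x in U, G i x * φ x

/-- `v ∈ H¹(U)`. -/
def MemH1 (U : Set Plane) (v : L2 U) : Prop := ∃ G, HasWeakGrad U v G

/-- `Δ v = p` in `U`, in the sense of distributions. -/
def HasLaplacian (U : Set Plane) (v : L2 U) (p : MvPolynomial (Fin 2) ℝ) : Prop :=
  ∀ φ : Plane → ℝ, IsTestFun U φ →
    ∫ x in U, v x * ∑ i, pd i (pd i φ) x = ∫ x in U, pval p x * φ x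

variable {N : ℕ}

/-- `g` is continuous on `∂P` and it is the trace on `∂P` of `v ∈ H¹(P)`: there are functions
`u_n`, smooth up to the boundary, with `u_n → v` in `H¹(P)` and `u_n|_E → g|_E` in `L²(E)`
for every edge `E` (parametrized with constant speed by `[0, 1]`). -/
def HasContTrace (P : PolygonalElement N) (v : L2 P.region) (g : Plane → ℝ) : Prop :=
  ContinuousOn g (P.boundary ℝ) ∧
  ∃ G, HasWeakGrad P.region v G ∧
  ∃ u : ℕ → Plane → ℝ, (∀ n, ContDiff ℝ (⊤ : ℕ∞) (u n)) ∧
    Tendsto (fun n => eLpNorm (fun x => u n x - v x) 2 (volume.restrict P.region)) atTop (𝓝 0) ∧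
    (∀ i, Tendsto (fun n => eLpNorm (fun x => pd i (u n) x - G i x) 2 (volume.restrict P.region))
      atTop (𝓝 0)) ∧
    ∀ e, Tendsto (fun n => eLpNorm (fun t => u n (P.edgePath ℝ e t) - g (P.edgePath ℝ e t)) 2
      (volume.restrict (Icc (0 : ℝ) 1))) atTop (𝓝 0)

/-- `p = Π^∇_k v ∈ ℙ_k(P)`, the elliptic projection of `v ∈ H¹(P)`:
`∫_P ∇(v - p)·∇q = 0` for all `q ∈ ℙ_k(P)` and `∫_{∂P} (v - p) ds = 0`. -/
def IsEllipticProj (P : PolygonalElement N) (k : ℕ) (v : L2 P.region)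
    (p : MvPolynomial (Fin 2) ℝ) : Prop :=
  p ∈ polyLT (k + 1) ∧
  (∃ G, HasWeakGrad P.region v G ∧ ∀ q ∈ polyLT (k + 1),
    ∫ x in P.region, ∑ i, (G i x - pval (MvPolynomial.pderiv i p) x) *
      pval (MvPolynomial.pderiv i q) x = 0) ∧
  ∃ g, HasContTrace P v g ∧
    ∑ e, dist (P.vertices e) (P.vertices (finRotate N e)) *
      ∫ t in Icc (0 : ℝ) 1, (g (P.edgePath ℝ e t) - pval p (P.edgePath ℝ e t)) = 0

/-- The component of the field `g` in the direction `d`, at the point with parameter `t ∈ [0, 1]`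
of the edge `e`. -/
def edgeComp (P : PolygonalElement N) (d : Fin N → Plane) (g : Fin 2 → Plane → ℝ) (e : Fin N)
    (t : ℝ) : ℝ :=
  ∑ j, g j (P.edgePath ℝ e t) * d e j

/-- On every edge the normal component of `g` is in `ℙ_{k+1}(E)` and the tangential one is in
`ℙ_k(E)`. -/
def HasPolyEdges (P : PolygonalElement N) (nrm tng : Fin N → Plane) (k : ℕ)
    (g : Fin 2 → Plane → ℝ) : Prop :=
  ∀ e, (∃ q ∈ Polynomial.degreeLT ℝ (k + 2), ∀ t ∈ Icc (0 : ℝ) 1, edgeComp P nrm g e t = q.eval t) ∧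
    (∃ q ∈ Polynomial.degreeLT ℝ (k + 1), ∀ t ∈ Icc (0 : ℝ) 1, edgeComp P tng g e t = q.eval t)

/-! ### The two local spaces as sets of vector fields -/

/-- Membership in the regular space: `v ∈ [H¹(P)]²` with continuous boundary trace,
`v·t_E ∈ ℙ_k(E)`, `v·n_E ∈ ℙ_{k+1}(E)` on every edge and `Δ v ∈ [ℙ_{k-2}(P)]²`. -/
def MemRegular (P : PolygonalElement N) (nrm tng : Fin N → Plane) (k : ℕ)
    (v : Fin 2 → L2 P.region) : Prop :=
  (∀ j, MemH1 P.region (v j)) ∧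
  (∃ g : Fin 2 → Plane → ℝ, (∀ j, HasContTrace P (v j) (g j)) ∧ HasPolyEdges P nrm tng k g) ∧
  ∀ j, ∃ p ∈ polyLT (k - 1), HasLaplacian P.region (v j) p

/-- Membership in the enhanced space: as for the regular space, but with `Δ v ∈ [ℙ_k(P)]²` and
`∫_P (v - Π^∇_k v)·q = 0` for all `q ∈ [Q]²`. -/
def MemEnhanced (P : PolygonalElement N) (nrm tng : Fin N → Plane) (k : ℕ)
    (Q : Submodule ℝ (MvPolynomial (Fin 2) ℝ)) (v : Fin 2 → L2 P.region) : Prop :=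
  (∀ j, MemH1 P.region (v j)) ∧
  (∃ g : Fin 2 → Plane → ℝ, (∀ j, HasContTrace P (v j) (g j)) ∧ HasPolyEdges P nrm tng k g) ∧
  (∀ j, ∃ p ∈ polyLT (k + 1), HasLaplacian P.region (v j) p) ∧
  ∃ π : Fin 2 → MvPolynomial (Fin 2) ℝ, (∀ j, IsEllipticProj P k (v j) (π j)) ∧
    ∀ q : Fin 2 → MvPolynomial (Fin 2) ℝ, (∀ j, q j ∈ Q) →
      ∫ x in P.region, ∑ j, (v j x - pval (π j) x) * pval (q j) x = 0

/-! ### Both sets are linear spaces -/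

lemma continuous_pval (p : MvPolynomial (Fin 2) ℝ) : Continuous (pval p) := by
  unfold pval
  exact (MvPolynomial.continuous_eval p).comp (by fun_prop)

lemma pval_lin (a : ℝ) (p q : MvPolynomial (Fin 2) ℝ) (x : Plane) :
    pval (a • p + q) x = a * pval p x + pval q x := by
  simp [pval, MvPolynomial.smul_eval]

lemma pval_zero (x : Plane) : pval 0 x = 0 := by simp [pval]

lemma pd_lin (i : Fin 2) (a : ℝ) {f g : Plane → ℝ} (hf : Differentiable ℝ f)
    (hg : Differentiable ℝ g) (x : Plane) :
    pd i (fun y => a * f y + g y) x = a * pd i f x + pd i g x := by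
  unfold pd
  rw [fderiv_fun_add ((hf x).const_mul a) (hg x), fderiv_const_mul (hf x)]
  simp

lemma continuous_pd (i : Fin 2) {f : Plane → ℝ} (hf : ContDiff ℝ (⊤ : ℕ∞) f) :
    Continuous (pd i f) :=
  (hf.continuous_fderiv (by simp)).clm_apply continuous_const

lemma contDiff_pd (i : Fin 2) {f : Plane → ℝ} (hf : ContDiff ℝ (⊤ : ℕ∞) f) :
    ContDiff ℝ (⊤ : ℕ∞) (pd i f) :=
  (hf.fderiv_right (m := (⊤ : ℕ∞)) (by simp)).clm_apply contDiff_const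

/-- On a bounded set, the product of an `L²` function and a continuous function is integrable. -/
lemma L2.integrable_mul {U : Set Plane} (ho : IsOpen U) (hb : Bornology.IsBounded U) (v : L2 U)
    {f : Plane → ℝ} (hf : Continuous f) :
    Integrable (fun x => v x * f x) (volume.restrict U) := by
  have hfin : IsFiniteMeasure (volume.restrict U) := ⟨by
    simpa using hb.measure_lt_top⟩
  have hv : Integrable v (volume.restrict U) := (Lp.memLp v).integrable (by norm_num)
  obtain ⟨C, hC⟩ := (hb.isCompact_closure).exists_bound_of_continuousOn hf.continuousOn
  refine hv.mul_bdd (c := C) hf.aestronglyMeasurable ?_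
  rw [ae_restrict_iff' ho.measurableSet]
  exact Eventually.of_forall fun x hx => hC x (subset_closure hx)

lemma integrable_cont {U : Set Plane} (hb : Bornology.IsBounded U)
    {f : Plane → ℝ} (hf : Continuous f) : Integrable f (volume.restrict U) :=
  (hf.continuousOn.integrableOn_compact hb.isCompact_closure).mono_set subset_closure

lemma L2.coe_lin {U : Set Plane} (a : ℝ) (v w : L2 U) :
    (a • v + w : L2 U) =ᵐ[volume.restrict U] fun x => a * v x + w x := by
  filter_upwards [Lp.coeFn_add (a • v) w, Lp.coeFn_smul a v] with x h1 h2
  rw [h1, Pi.add_apply, h2, Pi.smul_apply, smul_eq_mul]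

lemma L2.integral_lin {U : Set Plane} (ho : IsOpen U) (hb : Bornology.IsBounded U) (a : ℝ)
    (v w : L2 U) {f : Plane → ℝ} (hf : Continuous f) :
    ∫ x in U, (a • v + w : L2 U) x * f x = a * (∫ x in U, v x * f x) + ∫ x in U, w x * f x := by
  rw [← integral_const_mul, ← integral_add ((L2.integrable_mul ho hb v hf).const_mul a)
    (L2.integrable_mul ho hb w hf)]
  refine integral_congr_ae ?_
  filter_upwards [L2.coe_lin a v w] with x h
  rw [h]; ring

lemma L2.coe_zero (U : Set Plane) : (0 : L2 U) =ᵐ[volume.restrict U] fun _ => (0 : ℝ) :=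
  Lp.coeFn_zero ℝ 2 (volume.restrict U)

lemma L2.integral_zero_mul {U : Set Plane} (f : Plane → ℝ) :
    ∫ x in U, (0 : L2 U) x * f x = 0 := by
  refine integral_eq_zero_of_ae ?_
  filter_upwards [L2.coe_zero U] with x h
  rw [h, zero_mul, Pi.zero_apply]

lemma HasWeakGrad.lin {U : Set Plane} (ho : IsOpen U) (hb : Bornology.IsBounded U) (a : ℝ)
    {v w : L2 U} {G H : Fin 2 → L2 U} (hv : HasWeakGrad U v G) (hw : HasWeakGrad U w H) :
    HasWeakGrad U (a • v + w) (a • G + H) := by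
  intro i φ hφ
  have e : (a • G + H) i = a • G i + H i := rfl
  rw [e, L2.integral_lin ho hb a v w (continuous_pd i hφ.1),
    L2.integral_lin ho hb a (G i) (H i) hφ.1.continuous, hv i φ hφ, hw i φ hφ]
  ring

lemma HasWeakGrad.zero {U : Set Plane} : HasWeakGrad U 0 0 := by
  intro i φ _
  rw [Pi.zero_apply, L2.integral_zero_mul, L2.integral_zero_mul, neg_zero]

lemma HasLaplacian.lin {U : Set Plane} (ho : IsOpen U) (hb : Bornology.IsBounded U) (a : ℝ)
    {v w : L2 U} {p q : MvPolynomial (Fin 2) ℝ} (hv : HasLaplacian U v p)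
    (hw : HasLaplacian U w q) : HasLaplacian U (a • v + w) (a • p + q) := by
  intro φ hφ
  have hc : Continuous fun x => ∑ i, pd i (pd i φ) x :=
    continuous_finsetSum _ fun i _ => continuous_pd i (contDiff_pd i hφ.1)
  rw [L2.integral_lin ho hb a v w hc, hv φ hφ, hw φ hφ, ← integral_const_mul, ← integral_add]
  · refine integral_congr_ae (Eventually.of_forall fun x => ?_)
    simp only [pval_lin]; ring
  · exact (integrable_cont hb ((continuous_pval p).mul hφ.1.continuous)).const_mul a
  · exact integrable_cont hb ((continuous_pval q).mul hφ.1.continuous)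

lemma HasLaplacian.zero {U : Set Plane} : HasLaplacian U 0 0 := by
  intro φ _
  rw [L2.integral_zero_mul]
  simp [pval_zero]

lemma edgePath_mem (P : PolygonalElement N) (e : Fin N) {t : ℝ} (ht : t ∈ Icc (0 : ℝ) 1) :
    P.edgePath ℝ e t ∈ P.boundary ℝ :=
  mem_iUnion.2 ⟨e, t, ht, rfl⟩

lemma continuous_edgePath (P : PolygonalElement N) (e : Fin N) :
    Continuous fun t : ℝ => P.edgePath ℝ e t := by
  unfold Polygon.edgePath
  exact AffineMap.lineMap_continuous

lemma continuousOn_edge {P : PolygonalElement N} {g : Plane → ℝ}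
    (hg : ContinuousOn g (P.boundary ℝ)) (e : Fin N) :
    ContinuousOn (fun t : ℝ => g (P.edgePath ℝ e t)) (Icc 0 1) :=
  hg.comp (continuous_edgePath P e).continuousOn fun _ ht => edgePath_mem P e ht

/-- Linear combinations of `L²`-convergent sequences converge. -/
lemma tendsto_eLpNorm_lin {α : Type*} [MeasurableSpace α] {μ : Measure α} (a : ℝ)
    {f g h : ℕ → α → ℝ} (hf : ∀ n, AEStronglyMeasurable (f n) μ)
    (hg : ∀ n, AEStronglyMeasurable (g n) μ) (hh : ∀ n, h n =ᵐ[μ] fun x => a * f n x + g n x)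
    (hf0 : Tendsto (fun n => eLpNorm (f n) 2 μ) atTop (𝓝 0))
    (hg0 : Tendsto (fun n => eLpNorm (g n) 2 μ) atTop (𝓝 0)) :
    Tendsto (fun n => eLpNorm (h n) 2 μ) atTop (𝓝 0) := by
  have key : Tendsto (fun n => ‖a‖ₑ * eLpNorm (f n) 2 μ + eLpNorm (g n) 2 μ) atTop (𝓝 0) := by
    simpa using (ENNReal.Tendsto.const_mul hf0 (Or.inr (by simp))).add hg0
  refine tendsto_of_tendsto_of_tendsto_of_le_of_le tendsto_const_nhds key (fun _ => zero_le) ?_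
  intro n
  dsimp only
  rw [eLpNorm_congr_ae (hh n), ← eLpNorm_const_smul a (f n) 2 μ]
  exact eLpNorm_add_le ((hf n).const_smul a) (hg n) (by norm_num)

lemma HasContTrace.lin {P : PolygonalElement N} (a : ℝ) {v w : L2 P.region} {g h : Plane → ℝ}
    (hv : HasContTrace P v g) (hw : HasContTrace P w h) :
    HasContTrace P (a • v + w) (fun x => a * g x + h x) := by
  obtain ⟨hg, G, hG, u, hu, hu0, hu1, hu2⟩ := hv
  obtain ⟨hh, H, hH, z, hz, hz0, hz1, hz2⟩ := hw
  refine ⟨(continuousOn_const.mul hg).add hh, a • G + H,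
    hG.lin P.isOpen_region P.isBounded_region a hH, fun n x => a * u n x + z n x,
    fun n => (contDiff_const.mul (hu n)).add (hz n), ?_, fun i => ?_, fun e => ?_⟩
  · refine tendsto_eLpNorm_lin a (fun n => ?_) (fun n => ?_) (fun n => ?_) hu0 hz0
    · exact (hu n).continuous.aestronglyMeasurable.sub (Lp.aestronglyMeasurable v)
    · exact (hz n).continuous.aestronglyMeasurable.sub (Lp.aestronglyMeasurable w)
    · filter_upwards [L2.coe_lin a v w] with x h
      rw [h]; ring
  · refine tendsto_eLpNorm_lin a (fun n => ?_) (fun n => ?_) (fun n => ?_) (hu1 i) (hz1 i)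
    · exact (continuous_pd i (hu n)).aestronglyMeasurable.sub (Lp.aestronglyMeasurable (G i))
    · exact (continuous_pd i (hz n)).aestronglyMeasurable.sub (Lp.aestronglyMeasurable (H i))
    · filter_upwards [L2.coe_lin a (G i) (H i)] with x h
      have e : (a • G + H) i = a • G i + H i := rfl
      rw [e, h, pd_lin i a ((hu n).differentiable (by simp)) ((hz n).differentiable (by simp))]
      ring
  · refine tendsto_eLpNorm_lin a (fun n => ?_) (fun n => ?_) (fun n => ?_) (hu2 e) (hz2 e)
    · exact ((((hu n).continuous.comp (continuous_edgePath P e)).continuousOn).sub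
        (continuousOn_edge hg e)).aestronglyMeasurable measurableSet_Icc
    · exact ((((hz n).continuous.comp (continuous_edgePath P e)).continuousOn).sub
        (continuousOn_edge hh e)).aestronglyMeasurable measurableSet_Icc
    · exact Eventually.of_forall fun t => by ring

lemma HasContTrace.zero {P : PolygonalElement N} : HasContTrace P 0 (fun _ => 0) := by
  refine ⟨continuousOn_const, 0, HasWeakGrad.zero, fun _ _ => 0, fun _ => contDiff_const, ?_,
    fun i => ?_, fun e => ?_⟩
  · have e : (fun x => (0 : ℝ) - (0 : L2 P.region) x) =ᵐ[volume.restrict P.region] 0 := by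
      filter_upwards [L2.coe_zero P.region] with x h
      rw [h, sub_zero, Pi.zero_apply]
    simp only [eLpNorm_congr_ae e, eLpNorm_zero, tendsto_const_nhds]
  · have e : (fun x => pd i (fun _ => (0 : ℝ)) x - (0 : Fin 2 → L2 P.region) i x)
        =ᵐ[volume.restrict P.region] 0 := by
      filter_upwards [L2.coe_zero P.region] with x h
      rw [Pi.zero_apply, h, sub_zero, Pi.zero_apply]
      simp [pd]
    simp only [eLpNorm_congr_ae e, eLpNorm_zero, tendsto_const_nhds]
  · simp

lemma HasPolyEdges.lin {P : PolygonalElement N} {nrm tng : Fin N → Plane} {k : ℕ} (a : ℝ)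
    {g h : Fin 2 → Plane → ℝ} (hg : HasPolyEdges P nrm tng k g)
    (hh : HasPolyEdges P nrm tng k h) :
    HasPolyEdges P nrm tng k (fun j x => a * g j x + h j x) := by
  have key : ∀ (d : Fin N → Plane) (e : Fin N) (t : ℝ),
      edgeComp P d (fun j x => a * g j x + h j x) e t
        = a * edgeComp P d g e t + edgeComp P d h e t := by
    intro d e t
    simp only [edgeComp, Finset.mul_sum, ← Finset.sum_add_distrib]
    exact Finset.sum_congr rfl fun j _ => by ring
  intro e
  obtain ⟨⟨q, hq, hq'⟩, r, hr, hr'⟩ := hg e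
  obtain ⟨⟨q1, hq1, hq1'⟩, r1, hr1, hr1'⟩ := hh e
  refine ⟨⟨a • q + q1, Submodule.add_mem _ (Submodule.smul_mem _ a hq) hq1, fun t ht => ?_⟩,
    a • r + r1, Submodule.add_mem _ (Submodule.smul_mem _ a hr) hr1, fun t ht => ?_⟩
  · rw [key, hq' t ht, hq1' t ht]; simp
  · rw [key, hr' t ht, hr1' t ht]; simp

lemma HasPolyEdges.zero {P : PolygonalElement N} {nrm tng : Fin N → Plane} {k : ℕ} :
    HasPolyEdges P nrm tng k (fun _ _ => 0) := fun e =>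
  ⟨⟨0, Submodule.zero_mem _, fun t _ => by simp [edgeComp]⟩,
    0, Submodule.zero_mem _, fun t _ => by simp [edgeComp]⟩

lemma IsEllipticProj.lin {P : PolygonalElement N} {k : ℕ} (a : ℝ) {v w : L2 P.region}
    {p q : MvPolynomial (Fin 2) ℝ} (hv : IsEllipticProj P k v p) (hw : IsEllipticProj P k w q) :
    IsEllipticProj P k (a • v + w) (a • p + q) := by
  obtain ⟨hp, ⟨G, hG, hG'⟩, g, hg, hg'⟩ := hv
  obtain ⟨hq, ⟨H, hH, hH'⟩, h, hh, hh'⟩ := hw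
  refine ⟨Submodule.add_mem _ (Submodule.smul_mem _ a hp) hq,
    ⟨a • G + H, hG.lin P.isOpen_region P.isBounded_region a hH, fun r hr => ?_⟩,
    fun x => a * g x + h x, hg.lin a hh, ?_⟩
  · have int : ∀ (F : Fin 2 → L2 P.region) (s : MvPolynomial (Fin 2) ℝ),
        Integrable (fun x => ∑ i, (F i x - pval (MvPolynomial.pderiv i s) x) *
          pval (MvPolynomial.pderiv i r) x) (volume.restrict P.region) := by
      intro F s
      refine integrable_finsetSum _ fun i _ => ?_
      simp only [sub_mul]
      exact (L2.integrable_mul P.isOpen_region P.isBounded_region (F i) (continuous_pval _)).sub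
        (integrable_cont P.isBounded_region ((continuous_pval _).mul (continuous_pval _)))
    have e : ∫ x in P.region, ∑ i, ((a • G + H) i x - pval (MvPolynomial.pderiv i (a • p + q)) x) *
        pval (MvPolynomial.pderiv i r) x
        = a * (∫ x in P.region, ∑ i, (G i x - pval (MvPolynomial.pderiv i p) x) *
            pval (MvPolynomial.pderiv i r) x)
          + ∫ x in P.region, ∑ i, (H i x - pval (MvPolynomial.pderiv i q) x) *
            pval (MvPolynomial.pderiv i r) x := by
      rw [← integral_const_mul, ← integral_add ((int G p).const_mul a) (int H q)]
      refine integral_congr_ae ?_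
      filter_upwards [ae_all_iff.2 fun i => L2.coe_lin a (G i) (H i)] with x hx
      rw [Finset.mul_sum, ← Finset.sum_add_distrib]
      refine Finset.sum_congr rfl fun i _ => ?_
      have e1 : (a • G + H) i = a • G i + H i := rfl
      rw [e1, hx i, map_add, Derivation.map_smul, pval_lin]
      ring
    rw [e, hG' r hr, hH' r hr]; simp
  · have int : ∀ (f : Plane → ℝ) (s : MvPolynomial (Fin 2) ℝ) (e : Fin N),
        ContinuousOn f (P.boundary ℝ) →
        Integrable (fun t : ℝ => f (P.edgePath ℝ e t) - pval s (P.edgePath ℝ e t))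
          (volume.restrict (Icc 0 1)) := fun f s e hf =>
      ((continuousOn_edge hf e).sub ((continuous_pval s).comp
        (continuous_edgePath P e)).continuousOn).integrableOn_compact isCompact_Icc
    have e : ∀ e, ∫ t in Icc (0 : ℝ) 1, (a * g (P.edgePath ℝ e t) + h (P.edgePath ℝ e t)
          - pval (a • p + q) (P.edgePath ℝ e t))
        = a * (∫ t in Icc (0 : ℝ) 1, (g (P.edgePath ℝ e t) - pval p (P.edgePath ℝ e t)))
          + ∫ t in Icc (0 : ℝ) 1, (h (P.edgePath ℝ e t) - pval q (P.edgePath ℝ e t)) := by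
      intro e
      rw [← integral_const_mul, ← integral_add ((int g p e hg.1).const_mul a) (int h q e hh.1)]
      refine integral_congr_ae (Eventually.of_forall fun t => ?_)
      simp only [pval_lin]; ring
    simp only [e, mul_add, Finset.sum_add_distrib, hh', mul_left_comm _ a, ← Finset.mul_sum, hg']
    simp

lemma IsEllipticProj.zero {P : PolygonalElement N} {k : ℕ} : IsEllipticProj P k 0 0 := by
  refine ⟨Submodule.zero_mem _, ⟨0, HasWeakGrad.zero, fun q _ => ?_⟩, fun _ => 0,
    HasContTrace.zero, by simp [pval_zero]⟩
  refine integral_eq_zero_of_ae ?_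
  filter_upwards [L2.coe_zero P.region] with x h
  refine Finset.sum_eq_zero fun i _ => ?_
  simp only [Pi.zero_apply, h, pval_zero, sub_zero, zero_mul, map_zero]

lemma MemRegular.lin {P : PolygonalElement N} {nrm tng : Fin N → Plane} {k : ℕ} (a : ℝ)
    {v w : Fin 2 → L2 P.region} (hv : MemRegular P nrm tng k v) (hw : MemRegular P nrm tng k w) :
    MemRegular P nrm tng k (a • v + w) := by
  obtain ⟨hv1, ⟨g, hg, hg'⟩, hvl⟩ := hv
  obtain ⟨hw1, ⟨h, hh, hh'⟩, hwl⟩ := hw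
  refine ⟨fun j => ?_, ⟨_, fun j => (hg j).lin a (hh j), hg'.lin a hh'⟩, fun j => ?_⟩
  · obtain ⟨G, hG⟩ := hv1 j
    obtain ⟨H, hH⟩ := hw1 j
    exact ⟨_, hG.lin P.isOpen_region P.isBounded_region a hH⟩
  · obtain ⟨p, hp, hp'⟩ := hvl j
    obtain ⟨q, hq, hq'⟩ := hwl j
    exact ⟨_, Submodule.add_mem _ (Submodule.smul_mem _ a hp) hq,
      hp'.lin P.isOpen_region P.isBounded_region a hq'⟩

lemma MemRegular.zero {P : PolygonalElement N} {nrm tng : Fin N → Plane} {k : ℕ} :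
    MemRegular P nrm tng k 0 :=
  ⟨fun _ => ⟨0, HasWeakGrad.zero⟩, ⟨fun _ _ => 0, fun _ => HasContTrace.zero, HasPolyEdges.zero⟩,
    fun _ => ⟨0, Submodule.zero_mem _, HasLaplacian.zero⟩⟩

lemma MemEnhanced.lin {P : PolygonalElement N} {nrm tng : Fin N → Plane} {k : ℕ}
    {Q : Submodule ℝ (MvPolynomial (Fin 2) ℝ)} (a : ℝ)
    {v w : Fin 2 → L2 P.region} (hv : MemEnhanced P nrm tng k Q v)
    (hw : MemEnhanced P nrm tng k Q w) : MemEnhanced P nrm tng k Q (a • v + w) := by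
  obtain ⟨hv1, ⟨g, hg, hg'⟩, hvl, π, hπ, hπ'⟩ := hv
  obtain ⟨hw1, ⟨h, hh, hh'⟩, hwl, ρ, hρ, hρ'⟩ := hw
  refine ⟨fun j => ?_, ⟨_, fun j => (hg j).lin a (hh j), hg'.lin a hh'⟩, fun j => ?_,
    a • π + ρ, fun j => (hπ j).lin a (hρ j), fun q hq => ?_⟩
  · obtain ⟨G, hG⟩ := hv1 j
    obtain ⟨H, hH⟩ := hw1 j
    exact ⟨_, hG.lin P.isOpen_region P.isBounded_region a hH⟩
  · obtain ⟨p, hp, hp'⟩ := hvl j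
    obtain ⟨q, hq, hq'⟩ := hwl j
    exact ⟨_, Submodule.add_mem _ (Submodule.smul_mem _ a hp) hq,
      hp'.lin P.isOpen_region P.isBounded_region a hq'⟩
  · have int : ∀ (F : Fin 2 → L2 P.region) (s : Fin 2 → MvPolynomial (Fin 2) ℝ),
        Integrable (fun x => ∑ i, (F i x - pval (s i) x) * pval (q i) x)
          (volume.restrict P.region) := by
      intro F s
      refine integrable_finsetSum _ fun i _ => ?_
      simp only [sub_mul]
      exact (L2.integrable_mul P.isOpen_region P.isBounded_region (F i) (continuous_pval _)).sub
        (integrable_cont P.isBounded_region ((continuous_pval _).mul (continuous_pval _)))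
    have e : ∫ x in P.region, ∑ j, ((a • v + w) j x - pval ((a • π + ρ) j) x) * pval (q j) x
        = a * (∫ x in P.region, ∑ j, (v j x - pval (π j) x) * pval (q j) x)
          + ∫ x in P.region, ∑ j, (w j x - pval (ρ j) x) * pval (q j) x := by
      rw [← integral_const_mul, ← integral_add ((int v π).const_mul a) (int w ρ)]
      refine integral_congr_ae ?_
      filter_upwards [ae_all_iff.2 fun i => L2.coe_lin a (v i) (w i)] with x hx
      rw [Finset.mul_sum, ← Finset.sum_add_distrib]
      refine Finset.sum_congr rfl fun i _ => ?_
      have e1 : (a • v + w) i = a • v i + w i := rfl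
      have e2 : (a • π + ρ) i = a • π i + ρ i := rfl
      rw [e1, e2, hx i, pval_lin]
      ring
    rw [e, hπ' q hq, hρ' q hq]; simp

lemma MemEnhanced.zero {P : PolygonalElement N} {nrm tng : Fin N → Plane} {k : ℕ}
    {Q : Submodule ℝ (MvPolynomial (Fin 2) ℝ)} : MemEnhanced P nrm tng k Q 0 := by
  refine ⟨fun _ => ⟨0, HasWeakGrad.zero⟩,
    ⟨fun _ _ => 0, fun _ => HasContTrace.zero, HasPolyEdges.zero⟩,
    fun _ => ⟨0, Submodule.zero_mem _, HasLaplacian.zero⟩, 0, fun _ => IsEllipticProj.zero,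
    fun q _ => integral_eq_zero_of_ae ?_⟩
  filter_upwards [L2.coe_zero P.region] with x h
  refine Finset.sum_eq_zero fun i _ => ?_
  simp only [Pi.zero_apply, h, pval_zero, sub_zero, zero_mul]

/-- The regular local virtual element space. -/
def regularSpace (P : PolygonalElement N) (nrm tng : Fin N → Plane) (k : ℕ) :
    Submodule ℝ (Fin 2 → L2 P.region) where
  carrier := {v | MemRegular P nrm tng k v}
  zero_mem' := MemRegular.zero
  add_mem' := fun {v w} hv hw => by simpa using MemRegular.lin 1 hv hw
  smul_mem' := fun a v hv => by simpa using MemRegular.lin a hv MemRegular.zero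

/-- The enhanced local virtual element space. -/
def enhancedSpace (P : PolygonalElement N) (nrm tng : Fin N → Plane) (k : ℕ)
    (Q : Submodule ℝ (MvPolynomial (Fin 2) ℝ)) : Submodule ℝ (Fin 2 → L2 P.region) where
  carrier := {v | MemEnhanced P nrm tng k Q v}
  zero_mem' := MemEnhanced.zero
  add_mem' := fun {v w} hv hw => by simpa using MemEnhanced.lin 1 hv hw
  smul_mem' := fun a v hv => by simpa using MemEnhanced.lin a hv MemEnhanced.zero

/-! ### Degrees of freedom -/

/-- `[ℙ_{m-1}(P)]²`. -/
abbrev VecPolyLT (m : ℕ) : Type := Fin 2 → polyLT m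

/-- Tables of values of the degrees of freedom: one vector per vertex, one number for each normal
moment against `ℙ_{k-1}(E)` and tangential moment against `ℙ_{k-2}(E)` on each edge, and one number
for each moment against `[ℙ_{k-2}(P)]²`. The moments against a polynomial space depend linearly on
the polynomial, so that a table of moments is a linear functional on that space (equivalently, a
list of free values, one for each element of a basis of the space). -/
abbrev DofValues (N k : ℕ) : Type :=
  (Fin N → Fin 2 → ℝ) ×
  (Fin N → Module.Dual ℝ (Polynomial.degreeLT ℝ k)) ×
  (Fin N → Module.Dual ℝ (Polynomial.degreeLT ℝ (k - 1))) ×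
  Module.Dual ℝ (VecPolyLT (k - 1))

/-- `d` is the table of the degrees of freedom of `v`: vertex values, normal edge moments,
tangential edge moments and cell moments. With the constant speed parametrization of an edge `E` by
`[0, 1]`, `|E|⁻¹ ∫_E f ds` is the integral over `[0, 1]`. -/
def HasDofs (P : PolygonalElement N) (nrm tng : Fin N → Plane) (k : ℕ) (v : Fin 2 → L2 P.region)
    (d : DofValues N k) : Prop :=
  (∃ g : Fin 2 → Plane → ℝ, (∀ j, HasContTrace P (v j) (g j)) ∧
    (∀ i j, d.1 i j = g j (P.vertices i)) ∧
    (∀ e q, d.2.1 e q = ∫ t in Icc (0 : ℝ) 1, edgeComp P nrm g e t * (q : Polynomial ℝ).eval t) ∧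
    (∀ e q, d.2.2.1 e q =
      ∫ t in Icc (0 : ℝ) 1, edgeComp P tng g e t * (q : Polynomial ℝ).eval t)) ∧
  ∀ q, d.2.2.2 q = (volume P.region).toReal⁻¹ * ∫ x in P.region, ∑ j, v j x * pval (q j) x

/-- The degrees of freedom are unisolvent in the space `V`: they are well defined on `V`, and the
map that takes `v ∈ V` to the table of its degrees of freedom is a linear bijection from `V` to the
space of all tables (so that their number is the dimension of `V`). -/
def IsUnisolvent (P : PolygonalElement N) (nrm tng : Fin N → Plane) (k : ℕ)
    (V : Submodule ℝ (Fin 2 → L2 P.region)) : Prop :=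
  ∃ e : V ≃ₗ[ℝ] DofValues N k, ∀ (v : V) (d : DofValues N k), HasDofs P nrm tng k v d ↔ e v = d

end

/-! The boundary and the interior decouple. On an edge the normal and tangential components are
polynomials of degree at most `k + 1` and `k`, and in each case the two end values together with the
moments against polynomials of degree two less determine the component: if they vanish, the
polynomial is `t (t - 1) r` with `r` an admissible test polynomial, so `∫ t (1 - t) r² = 0`. A
dimension count turns this uniqueness into existence (`edgePoly_eq_zero`, `exists_edgePoly`). The
edge data agree at the vertices, and edges with a common vertex leave it at a positive angle, so the
data extend to a Lipschitz function on the plane (`exists_lipschitz_extension`), which has a trace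
by mollification.

Inside, let `v` have zero trace, let `Δ v = p` with `p` in a polynomial space `W`, and let `v` be
orthogonal to `W`. Then `∫ |∇v|² = - ∫ p v = 0`, and Poincaré's inequality gives `v = 0`
(`eq_zero_of_moment_eq_zero`). Hence the map that sends `p ∈ W` to the moments against `W` of the
solution of `Δ w = p` with zero trace is injective from `W` to its dual. The dimensions agree, so it
is onto, and trace and moments can be prescribed together (`exists_laplacian_moment`). With `W =
ℙ_{k-2}` this settles the regular space.

For the enhanced space, the elliptic projection depends only on the trace and the moments against
`ℙ_{k-2}`, because `∫ ∇v·∇q` is a boundary term minus `∫ v Δq`. If the degrees of freedom vanish, so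
does the projection. The enhancement condition then kills the moments against `Q`, hence all those
against `ℙ_k`, and the uniqueness argument applies with `W = ℙ_k`. Conversely, a regular field is
corrected by a field with zero trace, zero moments against `ℙ_{k-2}` and suitable moments against
`Q`; this changes neither the degrees of freedom nor the projection.

The analytic core consists of two statements about traces defined by smooth approximation: the trace
is unique (`trace_eq_zero`), and zero trace implies membership in `H¹₀`
(`mem_sobolevZero_of_trace_eq_zero`). Both use rays from the centre `c` of the disk: each edge spans
with `c` a nondegenerate triangle, in which values inside are compared with values on the edge by
integrating the gradient along rays. A strip of relative width `1 - l` carries a cutoff with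
gradient of order `1 / (1 - l)`, and the squared norm of a function there is bounded by its edge
values plus `(1 - l)²` times its energy, so the two powers cancel. Existence for the Dirichlet
problem is Lax–Milgram in `H¹₀`.

Since traces enter the definitions through existential quantifiers, the degrees of freedom are
handled as a linear relation; `exists_linearEquiv_of_relation` reduces unisolvence to the facts
above. -/

noncomputable section

variable {N : ℕ}

/-! ### Geometry of star-shaped polygons -/

namespace PolygonalElement

variable (P : PolygonalElement N) {c : Plane} {r : ℝ}

lemma edgePath_apply (e : Fin N) (t : ℝ) : P.edgePath ℝ e t
    = P.vertices e + t • (P.vertices (finRotate N e) - P.vertices e) := by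
  simp [Polygon.edgePath, AffineMap.lineMap_apply, add_comm]

lemma edgePath_zero (e : Fin N) : P.edgePath ℝ e 0 = P.vertices e := by
  simp [edgePath_apply]

lemma edgePath_one (e : Fin N) : P.edgePath ℝ e 1 = P.vertices (finRotate N e) := by
  simp [edgePath_apply]

lemma finRotate_ne (P : PolygonalElement N) (e : Fin N) : finRotate N e ≠ e := by
  obtain ⟨n, rfl⟩ : ∃ n, N = n + 2 := ⟨N - 2, by have := P.three_le; omega⟩
  have h : e ∈ (finRotate (n + 2)).support := by rw [support_finRotate]; exact Finset.mem_univ _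
  exact Equiv.Perm.mem_support.1 h

lemma edge_ne_zero (e : Fin N) : P.vertices (finRotate N e) - P.vertices e ≠ 0 :=
  sub_ne_zero.2 fun h => P.finRotate_ne e (P.vertices_injective h)

lemma edgePath_notMem_region (e : Fin N) {t : ℝ} (ht : t ∈ Icc (0 : ℝ) 1) :
    P.edgePath ℝ e t ∉ P.region := by
  have h := edgePath_mem P e ht
  rw [← P.frontier_region, P.isOpen_region.frontier_eq] at h
  exact h.2

lemma edgePath_mem_closure (e : Fin N) {t : ℝ} (ht : t ∈ Icc (0 : ℝ) 1) :
    P.edgePath ℝ e t ∈ closure P.region := by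
  have h := edgePath_mem P e ht
  rw [← P.frontier_region, P.isOpen_region.frontier_eq] at h
  exact h.1

variable {P}

/-- Star-shapedness with respect to a whole disk, and not only its centre, gives room: the homothety
towards `c` moves the closure to a distance proportional to `1 - l` from the complement. This
supplies the cutoff functions below. -/
lemma ball_subset_region (hs : ∀ y ∈ Metric.ball c r, StarConvex ℝ y P.region) {x : Plane}
    (hx : x ∈ closure P.region) {l : ℝ} (h0 : 0 ≤ l) (h1 : l < 1) :
    Metric.ball (c + l • (x - c)) ((1 - l) * r) ⊆ P.region := by
  intro y hy
  have hl : 0 < 1 - l := by linarith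
  have hev : ∀ᶠ x' in 𝓝 x, y ∈ Metric.ball (c + l • (x' - c)) ((1 - l) * r) := by
    have hc : Continuous fun x' : Plane => dist y (c + l • (x' - c)) := by fun_prop
    exact hc.tendsto x (Iio_mem_nhds hy)
  obtain ⟨x', hx', hy'⟩ : ∃ x', y ∈ Metric.ball (c + l • (x' - c)) ((1 - l) * r) ∧ x' ∈ P.region :=
    (hev.and_frequently (mem_closure_iff_frequently.1 hx)).exists
  -- This `b` solves `y = (1 - l) b + l x'`; it lies in the disk exactly because `y` is within `(1 -
  -- l) r` of `c + l (x' - c)`.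
  set b : Plane := c + (1 - l)⁻¹ • (y - (c + l • (x' - c))) with hb
  have hbm : b ∈ Metric.ball c r := by
    rw [Metric.mem_ball, dist_eq_norm] at hx' ⊢
    rw [hb, add_sub_cancel_left, norm_smul, norm_inv, Real.norm_of_nonneg hl.le,
      inv_mul_lt_iff₀ hl]
    exact hx'
  have := hs b hbm hy' (a := 1 - l) (b := l) hl.le h0 (by ring)
  convert this using 1
  rw [hb, smul_add, smul_smul, mul_inv_cancel₀ hl.ne']
  module

lemma shrink_mem_region (hr : 0 < r) (hs : ∀ y ∈ Metric.ball c r, StarConvex ℝ y P.region)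
    {x : Plane} (hx : x ∈ closure P.region) {l : ℝ} (h0 : 0 ≤ l) (h1 : l < 1) :
    c + l • (x - c) ∈ P.region :=
  ball_subset_region hs hx h0 h1 (Metric.mem_ball_self (mul_pos (by linarith) hr))

lemma center_mem (hr : 0 < r) (hs : ∀ y ∈ Metric.ball c r, StarConvex ℝ y P.region) :
    c ∈ P.region := by
  obtain ⟨x, hx⟩ := P.isConnected_region.nonempty
  simpa using shrink_mem_region hr hs (subset_closure hx) le_rfl one_pos

variable (P) in
/-- Twice the signed area of the triangle spanned by `c` and the edge `e`. -/
def edgeDet (c : Plane) (e : Fin N) : ℝ :=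
  (P.vertices e 0 - c 0) * (P.vertices (finRotate N e) 1 - P.vertices e 1) -
    (P.vertices e 1 - c 1) * (P.vertices (finRotate N e) 0 - P.vertices e 0)

/-- If `c` were on the line of an edge, two boundary points of that edge would lie on one ray from
`c` (or `c` would itself be a boundary point). The nearer one is a proper contraction of the farther
one, hence interior, which is absurd. -/
lemma edgeDet_ne_zero (hr : 0 < r) (hs : ∀ y ∈ Metric.ball c r, StarConvex ℝ y P.region)
    (e : Fin N) : P.edgeDet c e ≠ 0 := by
  intro h
  set B := P.vertices (finRotate N e) - P.vertices e with hB
  obtain ⟨m, hm⟩ : ∃ m : ℝ, P.vertices e - c = m • B := by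
    have hB0 : B 0 = P.vertices (finRotate N e) 0 - P.vertices e 0 := by simp [hB]
    have hB1 : B 1 = P.vertices (finRotate N e) 1 - P.vertices e 1 := by simp [hB]
    rw [edgeDet, ← hB0, ← hB1] at h
    by_cases h0 : B 0 = 0
    · have h1 : B 1 ≠ 0 := by
        intro h1
        apply P.edge_ne_zero e
        ext i; fin_cases i
        · exact h0
        · exact h1
      have h2 : P.vertices e 0 - c 0 = 0 := by simpa [h0, h1] using h
      refine ⟨(P.vertices e 1 - c 1) / B 1, ?_⟩
      ext i; fin_cases i
      · simp [h0, h2]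
      · simp [h1]
    · refine ⟨(P.vertices e 0 - c 0) / B 0, ?_⟩
      ext i; fin_cases i
      · simp [h0]
      · simp only [Fin.mk_one, PiLp.sub_apply, PiLp.smul_apply, smul_eq_mul]
        field_simp
        linarith
  -- Points of the edge are `c + (m + t) B`, so the hypothesis on `l` says that the boundary point
  -- at `t1` is the contraction by `l` of the one at `t2`.
  have key : ∀ t1 ∈ Icc (0 : ℝ) 1, ∀ t2 ∈ Icc (0 : ℝ) 1, ∀ l : ℝ, 0 ≤ l → l < 1 →
      m + t1 = l * (m + t2) → False := by
    intro t1 h1 t2 h2 l hl hl1 hlt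
    apply P.edgePath_notMem_region e h1
    have e2 : ∀ t, P.edgePath ℝ e t = c + (m + t) • B := by
      intro t
      rw [edgePath_apply, add_smul, ← hm]; module
    have := shrink_mem_region hr hs (P.edgePath_mem_closure e h2) hl hl1
    rwa [e2 t2, add_sub_cancel_left, smul_smul, ← hlt, ← e2] at this
  have i0 : (0 : ℝ) ∈ Icc (0 : ℝ) 1 := by simp
  have i1 : (1 : ℝ) ∈ Icc (0 : ℝ) 1 := by simp
  -- The three cases are the positions of `c` on the line: before the first end point or at it, past
  -- the last one or at it, and strictly between them, where `l = 0` is used.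
  rcases le_or_gt 0 m with hm0 | hm0
  · refine key 0 i0 1 i1 (m / (m + 1)) (by positivity) ?_ ?_
    · rw [div_lt_one (by linarith)]; linarith
    · field_simp; ring
  · rcases le_or_gt m (-1) with hm1 | hm1
    · refine key 1 i1 0 i0 ((m + 1) / m) (div_nonneg_of_nonpos (by linarith) hm0.le) ?_ ?_
      · rw [div_lt_one_of_neg hm0]; linarith
      · rw [add_zero, div_mul_cancel₀ _ hm0.ne]
    · exact key (-m) ⟨by linarith, by linarith⟩ 0 i0 0 le_rfl one_pos (by ring)

variable (P) in
/-- The parametrization `(s, t) ↦ c + s (X_e(t) - c)` of the triangle spanned by `c` and `e`. -/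
def coneMap (c : Plane) (e : Fin N) (p : Plane) : Plane :=
  c + p 0 • (P.edgePath ℝ e (p 1) - c)

/-- Parameter domain of the part of a triangle near its edge. -/
def coneDomain (l : ℝ) : Set Plane := {p | p 0 ∈ Ico l 1 ∧ p 1 ∈ Icc (0 : ℝ) 1}

variable (P) in
/-- The part near the edge `e` of the triangle spanned by `c` and `e`. -/
def strip (c : Plane) (e : Fin N) (l : ℝ) : Set Plane := P.coneMap c e '' coneDomain l

lemma measurableSet_coneDomain (l : ℝ) : MeasurableSet (coneDomain l) := by
  have h0 : Measurable fun p : Plane => p 0 := by fun_prop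
  have h1 : Measurable fun p : Plane => p 1 := by fun_prop
  exact (h0 measurableSet_Ico).inter (h1 measurableSet_Icc)

lemma coneMap_coord (e : Fin N) (p : Plane) (i : Fin 2) : P.coneMap c e p i
    = c i + p 0 * (P.vertices e i + p 1 * (P.vertices (finRotate N e) i - P.vertices e i) - c i) := by
  simp [coneMap, edgePath_apply]

/-- Cramer's rule: the determinant with the edge direction eliminates `t` and recovers `s`; the
determinant with `X_e - c` then recovers `t`, since `s ≥ l > 0`. -/
lemma injOn_coneMap (hr : 0 < r) (hs : ∀ y ∈ Metric.ball c r, StarConvex ℝ y P.region)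
    (e : Fin N) {l : ℝ} (hl : 0 < l) : InjOn (P.coneMap c e) (coneDomain l) := by
  intro p hp q hq h
  have hD := edgeDet_ne_zero hr hs e
  have h0 := congrArg (fun x : Plane => x 0) h
  have h1 := congrArg (fun x : Plane => x 1) h
  simp only [coneMap_coord] at h0 h1
  have e0 : p 0 = q 0 := by
    apply mul_right_cancel₀ hD
    rw [edgeDet]
    linear_combination (P.vertices (finRotate N e) 1 - P.vertices e 1) * h0
      - (P.vertices (finRotate N e) 0 - P.vertices e 0) * h1
  have e1 : p 1 = q 1 := by
    have hq0 : q 0 ≠ 0 := (hl.trans_le hq.1.1).ne'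
    apply mul_right_cancel₀ (mul_ne_zero hq0 hD)
    rw [e0] at h0 h1
    rw [edgeDet]
    linear_combination (P.vertices e 0 - c 0) * h1 - (P.vertices e 1 - c 1) * h0
  ext i; fin_cases i
  · exact e0
  · exact e1

lemma strip_subset (hr : 0 < r) (hs : ∀ y ∈ Metric.ball c r, StarConvex ℝ y P.region)
    (e : Fin N) {l : ℝ} (hl : 0 < l) : P.strip c e l ⊆ P.region := by
  rintro _ ⟨p, hp, rfl⟩
  exact shrink_mem_region hr hs (P.edgePath_mem_closure e hp.2) (hl.le.trans hp.1.1) hp.1.2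

/-- The ray from `c` through `x` leaves the bounded region at a boundary point, which lies on some
edge. This gives cone coordinates for `x`, and the radial one is at least `l` unless `x` is a
contraction by `l` of an interior point. -/
lemma exists_mem_strip (hr : 0 < r) (hs : ∀ y ∈ Metric.ball c r, StarConvex ℝ y P.region)
    {l : ℝ} (hl : 0 < l) {x : Plane} (hx : x ∈ P.region)
    (hxl : ∀ z ∈ P.region, x ≠ c + l • (z - c)) : ∃ e, x ∈ P.strip c e l := by
  have hxc : x ≠ c := by simpa using hxl c (center_mem hr hs)
  have hn : 0 < ‖x - c‖ := norm_pos_iff.2 (sub_ne_zero.2 hxc)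
  obtain ⟨R, hR⟩ := P.isBounded_region.subset_closedBall c
  have hxR : ‖x - c‖ ≤ R := by simpa [dist_eq_norm] using hR hx
  -- At parameter `T` the ray is at distance `R + ‖x - c‖ > R` from `c`, hence outside the region.
  set T := R / ‖x - c‖ + 1 with hT
  have hT1 : 1 ≤ T := by
    have : 0 ≤ R / ‖x - c‖ := div_nonneg (hn.le.trans hxR) hn.le
    linarith
  set γ : ℝ → Plane := fun τ => c + τ • (x - c) with hγ
  have hγc : Continuous γ := by fun_prop
  have hTn : γ T ∉ P.region := by
    intro h
    have := hR h
    rw [Metric.mem_closedBall, dist_eq_norm, hγ, add_sub_cancel_left, norm_smul,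
      Real.norm_of_nonneg (by linarith), hT, add_mul, div_mul_cancel₀ _ hn.ne'] at this
    linarith
  have hpre : IsPreconnected (γ '' Icc 1 T) := isPreconnected_Icc.image _ hγc.continuousOn
  have hγ1 : γ 1 = x := by simp [hγ]
  -- Without a frontier point, the region and the complement of its closure would disconnect the
  -- image of `[1, T]`.
  obtain ⟨τ, hτ, hf⟩ : ∃ τ ∈ Icc 1 T, γ τ ∈ frontier P.region := by
    by_contra! hno
    have hcov : γ '' Icc 1 T ⊆ P.region ∪ (closure P.region)ᶜ := by
      rintro _ ⟨τ, hτ, rfl⟩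
      have := hno τ hτ
      rw [P.isOpen_region.frontier_eq] at this
      by_cases h : γ τ ∈ P.region
      · exact Or.inl h
      · exact Or.inr fun h' => this ⟨h', h⟩
    obtain ⟨y, -, hy, hy'⟩ := hpre _ _ P.isOpen_region isClosed_closure.isOpen_compl hcov
      ⟨x, ⟨1, ⟨le_rfl, hT1⟩, hγ1⟩, hx⟩ ⟨γ T, ⟨T, ⟨hT1, le_rfl⟩, rfl⟩, fun h =>
        hno T ⟨hT1, le_rfl⟩ (by rw [P.isOpen_region.frontier_eq]; exact ⟨h, hTn⟩)⟩
    exact hy' (subset_closure hy)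
  have hτn : γ τ ∉ P.region := by
    rw [P.isOpen_region.frontier_eq] at hf; exact hf.2
  have hτ1 : 1 < τ := lt_of_le_of_ne hτ.1 (by rintro rfl; rw [hγ1] at hτn; exact hτn hx)
  have hτ0 : 0 < τ := by linarith
  have hcl : γ τ ∈ closure P.region := frontier_subset_closure hf
  rw [P.frontier_region] at hf
  obtain ⟨e, t, ht, hte⟩ := mem_iUnion.1 hf
  have hxs : x = c + τ⁻¹ • (γ τ - c) := by
    simp only [hγ, add_sub_cancel_left, smul_smul, inv_mul_cancel₀ hτ0.ne', one_smul]
    module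
  refine ⟨e, !₂[τ⁻¹, t], ⟨⟨?_, ?_⟩, ?_⟩, ?_⟩
  · by_contra hlt
    have hlt : τ⁻¹ < l := by simpa using hlt
    refine hxl (c + (τ⁻¹ / l) • (γ τ - c)) (shrink_mem_region hr hs hcl (by positivity)
      ((div_lt_one hl).2 hlt)) ?_
    rw [add_sub_cancel_left, smul_smul, mul_div_cancel₀ _ hl.ne']
    exact hxs
  · simpa using inv_lt_one_of_one_lt₀ hτ1
  · simpa using ht
  · simp only [coneMap]
    have : P.edgePath ℝ e t = γ τ := hte
    simpa [this] using hxs.symm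

lemma hasFDerivAt_coneMap (c : Plane) (e : Fin N) (p : Plane) :
    HasFDerivAt (P.coneMap c e)
      ((EuclideanSpace.proj (0 : Fin 2) : Plane →L[ℝ] ℝ).smulRight (P.edgePath ℝ e (p 1) - c) +
        p 0 • (EuclideanSpace.proj (1 : Fin 2) : Plane →L[ℝ] ℝ).smulRight
          (P.vertices (finRotate N e) - P.vertices e)) p := by
  have h0 : HasFDerivAt (fun p : Plane => p 0) (EuclideanSpace.proj (0 : Fin 2) : Plane →L[ℝ] ℝ) p :=
    (EuclideanSpace.proj (0 : Fin 2) : Plane →L[ℝ] ℝ).hasFDerivAt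
  have h1 : HasFDerivAt (fun p : Plane => p 1) (EuclideanSpace.proj (1 : Fin 2) : Plane →L[ℝ] ℝ) p :=
    (EuclideanSpace.proj (1 : Fin 2) : Plane →L[ℝ] ℝ).hasFDerivAt
  have h2 : HasFDerivAt (fun p : Plane => P.edgePath ℝ e (p 1) - c)
      ((EuclideanSpace.proj (1 : Fin 2) : Plane →L[ℝ] ℝ).smulRight
          (P.vertices (finRotate N e) - P.vertices e)) p := by
    simp only [edgePath_apply]
    exact ((h1.smul_const _).const_add _).sub_const _
  have h3 := (h0.smul h2).const_add c
  rw [add_comm] at h3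
  exact h3

lemma det_coneMap (c : Plane) (e : Fin N) (p : Plane) :
    ((EuclideanSpace.proj (0 : Fin 2) : Plane →L[ℝ] ℝ).smulRight (P.edgePath ℝ e (p 1) - c) +
        p 0 • (EuclideanSpace.proj (1 : Fin 2) : Plane →L[ℝ] ℝ).smulRight
          (P.vertices (finRotate N e) - P.vertices e)).det = p 0 * P.edgeDet c e := by
  rw [ContinuousLinearMap.det, ← LinearMap.det_toMatrix (EuclideanSpace.basisFun (Fin 2) ℝ).toBasis,
    Matrix.det_fin_two]
  simp [LinearMap.toMatrix_apply, edgePath_apply, edgeDet]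
  ring

lemma lintegral_plane {F : Plane → ENNReal} (hF : Measurable F) (l : ℝ) :
    ∫⁻ p in coneDomain l, F p
      = ∫⁻ t in Icc (0 : ℝ) 1, ∫⁻ s in Ico l 1, F !₂[s, t] := by
  have m1 : MeasurePreserving (fun q : ℝ × ℝ => (!₂[q.1, q.2] : Plane)) := by
    have h := (PiLp.volume_preserving_toLp (Fin 2)).comp
      ((volume_preserving_finTwoArrow ℝ).symm MeasurableEquiv.finTwoArrow)
    have e : (fun q : ℝ × ℝ => (!₂[q.1, q.2] : Plane))
        = WithLp.toLp 2 ∘ ⇑(MeasurableEquiv.finTwoArrow (α := ℝ)).symm := by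
      funext q; ext i; fin_cases i <;> rfl
    rw [e]; exact h
  have hpre : (fun q : ℝ × ℝ => (!₂[q.1, q.2] : Plane)) ⁻¹' coneDomain l = Ico l 1 ×ˢ Icc 0 1 := by
    ext q; simp [coneDomain]
  have hm : Measurable fun q : ℝ × ℝ => F !₂[q.1, q.2] := hF.comp m1.measurable
  rw [← (m1.restrict_preimage (measurableSet_coneDomain l)).lintegral_comp hF, hpre,
    Measure.volume_eq_prod, ← Measure.prod_restrict, lintegral_prod_symm _ hm.aemeasurable]

/-- Change of variables with Jacobian `s |D|`, ordered so that the inner integral runs along a ray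
from `c`. -/
lemma lintegral_strip (hr : 0 < r) (hs : ∀ y ∈ Metric.ball c r, StarConvex ℝ y P.region)
    (e : Fin N) {l : ℝ} (hl : 0 < l) {F : Plane → ENNReal} (hF : Measurable F) :
    ∫⁻ x in P.strip c e l, F x = ∫⁻ t in Icc (0 : ℝ) 1, ∫⁻ s in Ico l 1,
      ENNReal.ofReal (s * |P.edgeDet c e|) * F (c + s • (P.edgePath ℝ e t - c)) := by
  rw [strip, lintegral_image_eq_lintegral_abs_det_fderiv_mul volume (measurableSet_coneDomain l)
    (fun p _ => (hasFDerivAt_coneMap c e p).hasFDerivWithinAt) (injOn_coneMap hr hs e hl)]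
  simp only [det_coneMap]
  have hc : Continuous (P.coneMap c e) :=
    continuous_iff_continuousAt.2 fun p => (hasFDerivAt_coneMap c e p).continuousAt
  have hm : Measurable fun p : Plane => ENNReal.ofReal |p 0 * P.edgeDet c e| :=
    (by fun_prop : Continuous fun p : Plane => |p 0 * P.edgeDet c e|).measurable.ennreal_ofReal
  refine (lintegral_plane (hm.mul (hF.comp hc.measurable)) l).trans ?_
  refine lintegral_congr fun t => setLIntegral_congr_fun measurableSet_Ico fun s hs' => ?_
  have hs0 : 0 < s := hl.trans_le hs'.1
  simp [coneMap, abs_mul, abs_of_pos hs0, ENNReal.ofReal_mul hs0.le]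

lemma measurableSet_strip (hr : 0 < r) (hs : ∀ y ∈ Metric.ball c r, StarConvex ℝ y P.region)
    (e : Fin N) {l : ℝ} (hl : 0 < l) : MeasurableSet (P.strip c e l) :=
  measurable_image_of_fderivWithin (measurableSet_coneDomain l)
    (fun p _ => (hasFDerivAt_coneMap c e p).hasFDerivWithinAt) (injOn_coneMap hr hs e hl)

end PolygonalElement

/-! ### Estimates on strips -/

lemma ENNReal.add_sq_le (a b : ENNReal) : (a + b) ^ 2 ≤ 2 * a ^ 2 + 2 * b ^ 2 := by
  rcases eq_or_ne a ⊤ with rfl | ha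
  · simp
  rcases eq_or_ne b ⊤ with rfl | hb
  · simp
  lift a to NNReal using ha
  lift b to NNReal using hb
  have : (a + b) ^ 2 ≤ 2 * a ^ 2 + 2 * b ^ 2 := by
    rw [← NNReal.coe_le_coe]; push_cast
    nlinarith [sq_nonneg ((a : ℝ) - b)]
  exact_mod_cast this

lemma enorm_sq_le_sub (a b : ℝ) : ‖a‖ₑ ^ 2 ≤ 2 * ‖b‖ₑ ^ 2 + 2 * ‖a - b‖ₑ ^ 2 := by
  refine le_trans ?_ (ENNReal.add_sq_le _ _)
  gcongr
  calc ‖a‖ₑ = ‖b + (a - b)‖ₑ := by congr 1; ring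
    _ ≤ _ := enorm_add_le _ _

lemma lintegral_sq_le {α : Type*} [MeasurableSpace α] {μ : Measure α} {f : α → ENNReal}
    (hf : AEMeasurable f μ) : (∫⁻ x, f x ∂μ) ^ 2 ≤ μ univ * ∫⁻ x, f x ^ 2 ∂μ := by
  have h := ENNReal.lintegral_mul_le_Lp_mul_Lq μ Real.HolderConjugate.two_two hf
    (aemeasurable_const (b := (1 : ENNReal)))
  simp only [Pi.mul_apply, mul_one, ENNReal.rpow_two, one_pow, lintegral_one] at h
  calc (∫⁻ x, f x ∂μ) ^ 2
      ≤ ((∫⁻ x, f x ^ 2 ∂μ) ^ (1 / 2 : ℝ) * μ univ ^ (1 / 2 : ℝ)) ^ 2 := by gcongr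
    _ = μ univ * ∫⁻ x, f x ^ 2 ∂μ := by
      rw [mul_pow, ← ENNReal.rpow_two, ← ENNReal.rpow_two, ← ENNReal.rpow_mul, ← ENNReal.rpow_mul]
      norm_num [mul_comm]

/-- The fundamental theorem of calculus followed by Cauchy–Schwarz; the length `1 - l` of the
interval is the first of the two factors needed in the strip estimate. -/
lemma enorm_sub_sq_le_lintegral_deriv {h h' : ℝ → ℝ} (hd : ∀ s, HasDerivAt h (h' s) s)
    (hc : Continuous h') {l s : ℝ} (hs : s ∈ Icc l 1) :
    ‖h s - h 1‖ₑ ^ 2 ≤ ENNReal.ofReal (1 - l) * ∫⁻ σ in Ico l 1, ‖h' σ‖ₑ ^ 2 := by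
  have e : h 1 - h s = ∫ σ in s..1, h' σ :=
    (intervalIntegral.integral_eq_sub_of_hasDerivAt (fun x _ => hd x)
      (hc.intervalIntegrable _ _)).symm
  have h1 : ‖h s - h 1‖ₑ ≤ ∫⁻ σ in Ico l 1, ‖h' σ‖ₑ := by
    rw [← enorm_neg, neg_sub, e, intervalIntegral.integral_of_le hs.2]
    refine (enorm_integral_le_lintegral_enorm _).trans ?_
    rw [restrict_Ico_eq_restrict_Ioc]
    exact lintegral_mono_set (Ioc_subset_Ioc_left hs.1)
  calc _ ≤ (∫⁻ σ in Ico l 1, ‖h' σ‖ₑ) ^ 2 := by gcongr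
    _ ≤ _ := lintegral_sq_le hc.measurable.enorm.aemeasurable
    _ = _ := by simp

/-- The squared length of the gradient. -/
def gradSq (u : Plane → ℝ) (x : Plane) : ENNReal := ∑ i, ‖pd i u x‖ₑ ^ 2

lemma measurable_gradSq {u : Plane → ℝ} (hu : ContDiff ℝ (⊤ : ℕ∞) u) : Measurable (gradSq u) := by
  unfold gradSq
  exact Finset.measurable_sum _ fun i _ => (continuous_pd i hu).measurable.enorm.pow_const 2

lemma fderiv_apply_eq_sum (u : Plane → ℝ) (x v : Plane) :
    fderiv ℝ u x v = ∑ i, v i * pd i u x := by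
  conv_lhs => rw [← (EuclideanSpace.basisFun (Fin 2) ℝ).sum_repr v]
  simp [pd]

namespace PolygonalElement

variable {P : PolygonalElement N} {c : Plane} {r : ℝ}

variable (P) in
lemma exists_bound_edge (c : Plane) : ∃ M : NNReal, ∀ e, ∀ t ∈ Icc (0 : ℝ) 1, ∀ i,
    ‖(P.edgePath ℝ e t - c) i‖ₑ ≤ M := by
  obtain ⟨R, hR⟩ := P.isBounded_region.closure.subset_closedBall c
  refine ⟨R.toNNReal, fun e t ht i => ?_⟩
  rw [← enorm_norm, Real.enorm_of_nonneg (norm_nonneg _)]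
  refine ENNReal.ofReal_le_ofReal ((PiLp.norm_apply_le _ i).trans ?_)
  simpa [dist_eq_norm] using hR (P.edgePath_mem_closure e ht)

lemma enorm_cone_sub_sq_le {M : NNReal}
    (hM : ∀ e, ∀ t ∈ Icc (0 : ℝ) 1, ∀ i, ‖(P.edgePath ℝ e t - c) i‖ₑ ≤ M)
    {u : Plane → ℝ} (hu : ContDiff ℝ (⊤ : ℕ∞) u) (e : Fin N) {l s t : ℝ} (hs : s ∈ Icc l 1)
    (ht : t ∈ Icc (0 : ℝ) 1) :
    ‖u (c + s • (P.edgePath ℝ e t - c)) - u (P.edgePath ℝ e t)‖ₑ ^ 2 ≤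
      ENNReal.ofReal (1 - l) * (2 * M ^ 2) *
        ∫⁻ σ in Ico l 1, gradSq u (c + σ • (P.edgePath ℝ e t - c)) := by
  set w := P.edgePath ℝ e t - c with hw
  have hline : ∀ s : ℝ, HasDerivAt (fun s : ℝ => c + s • w) w s := fun s => by
    simpa using ((hasDerivAt_id s).smul_const w).const_add c
  have hcl : Continuous fun s : ℝ => c + s • w := by fun_prop
  have hd : ∀ s : ℝ, HasDerivAt (fun s : ℝ => u (c + s • w))
      (∑ i, w i * pd i u (c + s • w)) s := fun s => by
    rw [← fderiv_apply_eq_sum]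
    exact ((hu.differentiable (by simp)) _).hasFDerivAt.comp_hasDerivAt s (hline s)
  have hc : Continuous fun s : ℝ => ∑ i, w i * pd i u (c + s • w) :=
    continuous_finsetSum _ fun i _ => continuous_const.mul ((continuous_pd i hu).comp hcl)
  have h := enorm_sub_sq_le_lintegral_deriv hd hc hs
  have e1 : c + (1 : ℝ) • w = P.edgePath ℝ e t := by simp [hw]
  simp only [e1] at h
  refine h.trans ?_
  rw [mul_assoc]
  gcongr
  rw [← lintegral_const_mul' _ _ (by finiteness)]
  refine lintegral_mono fun σ => ?_
  have hb : ∀ i, ‖w i * pd i u (c + σ • w)‖ₑ ^ 2 ≤ M ^ 2 * ‖pd i u (c + σ • w)‖ₑ ^ 2 := by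
    intro i
    rw [enorm_mul, mul_pow]
    gcongr
    exact hM e t ht i
  calc ‖∑ i, w i * pd i u (c + σ • w)‖ₑ ^ 2
      ≤ (‖w 0 * pd 0 u (c + σ • w)‖ₑ + ‖w 1 * pd 1 u (c + σ • w)‖ₑ) ^ 2 := by
        rw [Fin.sum_univ_two]; gcongr; exact enorm_add_le _ _
    _ ≤ 2 * ‖w 0 * pd 0 u (c + σ • w)‖ₑ ^ 2 + 2 * ‖w 1 * pd 1 u (c + σ • w)‖ₑ ^ 2 :=
        ENNReal.add_sq_le _ _
    _ ≤ 2 * (M ^ 2 * ‖pd 0 u (c + σ • w)‖ₑ ^ 2) + 2 * (M ^ 2 * ‖pd 1 u (c + σ • w)‖ₑ ^ 2) := by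
        gcongr
        · exact hb 0
        · exact hb 1
    _ = 2 * M ^ 2 * gradSq u (c + σ • w) := by
        rw [gradSq, Fin.sum_univ_two]; ring

lemma lintegral_strip_le (hr : 0 < r) (hs : ∀ y ∈ Metric.ball c r, StarConvex ℝ y P.region)
    (e : Fin N) {l : ℝ} (hl : 0 < l) {F : Plane → ENNReal} (hF : Measurable F) :
    ∫⁻ x in P.strip c e l, F x ≤ ENNReal.ofReal |P.edgeDet c e| *
      ∫⁻ t in Icc (0 : ℝ) 1, ∫⁻ s in Ico l 1, F (c + s • (P.edgePath ℝ e t - c)) := by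
  rw [lintegral_strip hr hs e hl hF, ← lintegral_const_mul' _ _ ENNReal.ofReal_ne_top]
  refine lintegral_mono fun t => ?_
  rw [← lintegral_const_mul' _ _ ENNReal.ofReal_ne_top]
  refine setLIntegral_mono' measurableSet_Ico fun s hs => ?_
  gcongr
  exact mul_le_of_le_one_left (abs_nonneg _) hs.2.le

/-- For `s ≥ 1/2` the Jacobian `s |D|` is at least `|D| / 2`, so cone coordinates cost only a factor
`2`. -/
lemma lintegral_cone_le (hr : 0 < r) (hs : ∀ y ∈ Metric.ball c r, StarConvex ℝ y P.region)
    (e : Fin N) {l : ℝ} (hl : 1 / 2 ≤ l) {F : Plane → ENNReal} (hF : Measurable F) :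
    ∫⁻ t in Icc (0 : ℝ) 1, ∫⁻ s in Ico l 1, F (c + s • (P.edgePath ℝ e t - c)) ≤
      (ENNReal.ofReal |P.edgeDet c e|)⁻¹ * (2 * ∫⁻ x in P.strip c e l, F x) := by
  have hD : ENNReal.ofReal |P.edgeDet c e| ≠ 0 := by
    simpa using edgeDet_ne_zero hr hs e
  rw [mul_comm, ← div_eq_mul_inv, ENNReal.le_div_iff_mul_le (Or.inl hD)
    (Or.inl ENNReal.ofReal_ne_top), mul_comm, lintegral_strip hr hs e (by linarith) hF,
    ← lintegral_const_mul' _ _ ENNReal.ofReal_ne_top, ← lintegral_const_mul' _ _ (by simp)]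
  refine lintegral_mono fun t => ?_
  rw [← lintegral_const_mul' _ _ ENNReal.ofReal_ne_top, ← lintegral_const_mul' _ _ (by simp)]
  refine setLIntegral_mono' measurableSet_Ico fun s hs => ?_
  rw [← mul_assoc]
  gcongr
  rw [← ENNReal.ofReal_ofNat, ← ENNReal.ofReal_mul (by norm_num)]
  refine ENNReal.ofReal_le_ofReal ?_
  have := abs_nonneg (P.edgeDet c e)
  nlinarith [hs.1]

/-- Each value in the strip is compared with the value at the end of its ray on the edge. One factor
`1 - l` comes from Cauchy–Schwarz along the ray, the other from integrating over the width of the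
strip. The power `(1 - l)²`, with `C` independent of `l`, is what later compensates the gradient of
a cutoff function. -/
lemma exists_strip_estimate (hr : 0 < r)
    (hs : ∀ y ∈ Metric.ball c r, StarConvex ℝ y P.region) :
    ∃ C : ENNReal, C ≠ ⊤ ∧ ∀ l, 1 / 2 ≤ l → ∀ u : Plane → ℝ, ContDiff ℝ (⊤ : ℕ∞) u → ∀ e,
      ∫⁻ x in P.strip c e l, ‖u x‖ₑ ^ 2 ≤
        C * (∫⁻ t in Icc (0 : ℝ) 1, ‖u (P.edgePath ℝ e t)‖ₑ ^ 2) +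
        C * ENNReal.ofReal (1 - l) ^ 2 * ∫⁻ x in P.strip c e l, gradSq u x := by
  obtain ⟨M, hM⟩ := P.exists_bound_edge c
  set D : ENNReal := ∑ e, ENNReal.ofReal |P.edgeDet c e| with hDdef
  have hD : D ≠ ⊤ := by simp [hDdef]
  refine ⟨2 * D + 8 * M ^ 2, by finiteness, fun l hl u hu e => ?_⟩
  have hFm : Measurable fun x => ‖u x‖ₑ ^ 2 := hu.continuous.measurable.enorm.pow_const 2
  have hGm := measurable_gradSq hu
  have hd0 : ENNReal.ofReal |P.edgeDet c e| ≠ 0 := by simpa using edgeDet_ne_zero hr hs e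
  set d := ENNReal.ofReal |P.edgeDet c e| with hd
  have hdt : d ≠ ⊤ := ENNReal.ofReal_ne_top
  have hdD : d ≤ D := Finset.single_le_sum (f := fun e => ENNReal.ofReal |P.edgeDet c e|)
    (fun _ _ => zero_le) (Finset.mem_univ e)
  have h1l : ENNReal.ofReal (1 - l) ≤ 1 := by
    rw [← ENNReal.ofReal_one]; exact ENNReal.ofReal_le_ofReal (by linarith)
  set H : ℝ → ENNReal := fun t => ∫⁻ σ in Ico l 1, gradSq u (c + σ • (P.edgePath ℝ e t - c)) with hH
  have hvol : volume (Ico l 1) = ENNReal.ofReal (1 - l) := by simp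
  have hcomp : Continuous fun t : ℝ => u (P.edgePath ℝ e t) :=
    hu.continuous.comp (continuous_edgePath P e)
  calc ∫⁻ x in P.strip c e l, ‖u x‖ₑ ^ 2
      ≤ d * ∫⁻ t in Icc (0 : ℝ) 1, ∫⁻ s in Ico l 1, ‖u (c + s • (P.edgePath ℝ e t - c))‖ₑ ^ 2 :=
        lintegral_strip_le hr hs e (by linarith) hFm
    _ ≤ d * ∫⁻ t in Icc (0 : ℝ) 1, ∫⁻ _ in Ico l 1, (2 * ‖u (P.edgePath ℝ e t)‖ₑ ^ 2 +
          2 * (ENNReal.ofReal (1 - l) * (2 * M ^ 2) * H t)) := by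
        refine mul_le_mul_right ?_ _
        refine setLIntegral_mono' measurableSet_Icc fun t ht =>
          setLIntegral_mono' measurableSet_Ico fun s hs' =>
            (enorm_sq_le_sub _ (u (P.edgePath ℝ e t))).trans ?_
        gcongr
        exact enorm_cone_sub_sq_le hM hu e ⟨hs'.1, hs'.2.le⟩ ht
    _ = d * (ENNReal.ofReal (1 - l) * (2 * (∫⁻ t in Icc (0 : ℝ) 1, ‖u (P.edgePath ℝ e t)‖ₑ ^ 2) +
          2 * (ENNReal.ofReal (1 - l) * (2 * M ^ 2) * ∫⁻ t in Icc (0 : ℝ) 1, H t))) := by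
        simp only [lintegral_const, Measure.restrict_apply_univ, hvol]
        rw [lintegral_mul_const' _ _ ENNReal.ofReal_ne_top,
          lintegral_add_left ((hcomp.measurable.enorm.pow_const 2).const_mul 2),
          lintegral_const_mul' _ _ (by simp), lintegral_const_mul' _ _ (by simp),
          lintegral_const_mul' _ _ (by finiteness)]
        ring
    _ ≤ d * (ENNReal.ofReal (1 - l) * (2 * (∫⁻ t in Icc (0 : ℝ) 1, ‖u (P.edgePath ℝ e t)‖ₑ ^ 2) +
          2 * (ENNReal.ofReal (1 - l) * (2 * M ^ 2) *
            (d⁻¹ * (2 * ∫⁻ x in P.strip c e l, gradSq u x))))) := by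
        gcongr
        exact lintegral_cone_le hr hs e hl hGm
    _ = 2 * d * ENNReal.ofReal (1 - l) * (∫⁻ t in Icc (0 : ℝ) 1, ‖u (P.edgePath ℝ e t)‖ₑ ^ 2) +
          (d * d⁻¹) * (8 * M ^ 2) * ENNReal.ofReal (1 - l) ^ 2 *
            ∫⁻ x in P.strip c e l, gradSq u x := by ring
    _ ≤ _ := by
        rw [ENNReal.mul_inv_cancel hd0 hdt, one_mul]
        gcongr
        · calc 2 * d * ENNReal.ofReal (1 - l) ≤ 2 * D * 1 := by gcongr
            _ = 2 * D := mul_one _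
            _ ≤ _ := le_self_add
        · exact le_add_self

/-- The trace inequality: the value on the edge is compared with the values on the outer half of its
ray, and the result is averaged over that half. -/
lemma exists_trace_estimate (hr : 0 < r)
    (hs : ∀ y ∈ Metric.ball c r, StarConvex ℝ y P.region) :
    ∃ C : ENNReal, C ≠ ⊤ ∧ ∀ u : Plane → ℝ, ContDiff ℝ (⊤ : ℕ∞) u → ∀ e,
      ∫⁻ t in Icc (0 : ℝ) 1, ‖u (P.edgePath ℝ e t)‖ₑ ^ 2 ≤
        C * ((∫⁻ x in P.region, ‖u x‖ₑ ^ 2) + ∫⁻ x in P.region, gradSq u x) := by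
  obtain ⟨M, hM⟩ := P.exists_bound_edge c
  set D : ENNReal := ∑ e, (ENNReal.ofReal |P.edgeDet c e|)⁻¹ with hDdef
  have hd0 : ∀ e, ENNReal.ofReal |P.edgeDet c e| ≠ 0 := fun e => by
    simpa using edgeDet_ne_zero hr hs e
  have hD : D ≠ ⊤ := by
    rw [hDdef]
    exact (ENNReal.sum_ne_top).2 fun e _ => ENNReal.inv_ne_top.2 (hd0 e)
  refine ⟨8 * D + 4 * M ^ 2 * D, by finiteness, fun u hu e => ?_⟩
  have hFm : Measurable fun x => ‖u x‖ₑ ^ 2 := hu.continuous.measurable.enorm.pow_const 2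
  have hGm := measurable_gradSq hu
  have hdD : (ENNReal.ofReal |P.edgeDet c e|)⁻¹ ≤ D :=
    Finset.single_le_sum (f := fun e => (ENNReal.ofReal |P.edgeDet c e|)⁻¹)
      (fun _ _ => zero_le) (Finset.mem_univ e)
  set H : ℝ → ENNReal := fun t =>
    ∫⁻ σ in Ico (1 / 2 : ℝ) 1, gradSq u (c + σ • (P.edgePath ℝ e t - c)) with hH
  set K : ℝ → ENNReal := fun t =>
    ∫⁻ σ in Ico (1 / 2 : ℝ) 1, ‖u (c + σ • (P.edgePath ℝ e t - c))‖ₑ ^ 2 with hK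
  have hvol : volume (Ico (1 / 2 : ℝ) 1) = 2⁻¹ := by
    rw [Real.volume_Ico, show (1 : ℝ) - 1 / 2 = 2⁻¹ by norm_num, ENNReal.ofReal_inv_of_pos (by simp)]
    simp
  have hcone : Continuous fun q : ℝ × ℝ => c + q.2 • (P.edgePath ℝ e q.1 - c) :=
    continuous_const.add (continuous_snd.smul
      (((continuous_edgePath P e).comp continuous_fst).sub continuous_const))
  have hKm : Measurable K := (hFm.comp hcone.measurable).lintegral_prod_right'
  have hstrip := strip_subset hr hs e (l := 1 / 2) (by norm_num)
  -- The inequality holds for every `s` in `[1/2, 1)`; integrating over this interval of length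
  -- `1/2` and multiplying by `2` gives the bound.
  have hpt : ∀ t ∈ Icc (0 : ℝ) 1, ‖u (P.edgePath ℝ e t)‖ₑ ^ 2 ≤ 4 * K t + 2 * (M ^ 2 * H t) := by
    intro t ht
    have h1 : ∫⁻ _ in Ico (1 / 2 : ℝ) 1, ‖u (P.edgePath ℝ e t)‖ₑ ^ 2 ≤
        ∫⁻ s in Ico (1 / 2 : ℝ) 1, (2 * ‖u (c + s • (P.edgePath ℝ e t - c))‖ₑ ^ 2 +
          2 * (2⁻¹ * (2 * M ^ 2) * H t)) :=
      setLIntegral_mono' measurableSet_Ico fun s hs' =>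
        (enorm_sq_le_sub _ (u (c + s • (P.edgePath ℝ e t - c)))).trans (by
          rw [← enorm_neg (u (P.edgePath ℝ e t) - _), neg_sub]
          gcongr
          refine (enorm_cone_sub_sq_le hM hu e ⟨hs'.1, hs'.2.le⟩ ht).trans_eq ?_
          rw [show (1 : ℝ) - 1 / 2 = 2⁻¹ by norm_num, ENNReal.ofReal_inv_of_pos (by simp)]
          simp [hH])
    have hum : Measurable fun s : ℝ => ‖u (c + s • (P.edgePath ℝ e t - c))‖ₑ ^ 2 :=
      hFm.comp (by fun_prop)
    rw [lintegral_add_left (hum.const_mul 2), lintegral_const, lintegral_const,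
      Measure.restrict_apply_univ, hvol, lintegral_const_mul' _ _ (by simp)] at h1
    have h2 : (2 : ENNReal) * 2⁻¹ = 1 := ENNReal.mul_inv_cancel (by simp) (by simp)
    calc ‖u (P.edgePath ℝ e t)‖ₑ ^ 2 = 2 * (‖u (P.edgePath ℝ e t)‖ₑ ^ 2 * 2⁻¹) := by
          rw [mul_left_comm, h2, mul_one]
      _ ≤ 2 * (2 * K t + 2 * (2⁻¹ * (2 * M ^ 2) * H t) * 2⁻¹) := by gcongr
      _ = 4 * K t + 2 * (M ^ 2 * H t) * (2 * 2⁻¹) * (2 * 2⁻¹) := by ring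
      _ = _ := by rw [h2]; ring
  calc ∫⁻ t in Icc (0 : ℝ) 1, ‖u (P.edgePath ℝ e t)‖ₑ ^ 2
      ≤ ∫⁻ t in Icc (0 : ℝ) 1, (4 * K t + 2 * (M ^ 2 * H t)) :=
        setLIntegral_mono' measurableSet_Icc hpt
    _ = 4 * (∫⁻ t in Icc (0 : ℝ) 1, K t) + 2 * (M ^ 2 * ∫⁻ t in Icc (0 : ℝ) 1, H t) := by
        rw [lintegral_add_left (hKm.const_mul 4), lintegral_const_mul' _ _ (by simp),
          lintegral_const_mul' _ _ (by simp), lintegral_const_mul' _ _ (by finiteness)]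
    _ ≤ 4 * (D * (2 * ∫⁻ x in P.region, ‖u x‖ₑ ^ 2)) +
          2 * (M ^ 2 * (D * (2 * ∫⁻ x in P.region, gradSq u x))) := by
        gcongr
        · refine (lintegral_cone_le hr hs e le_rfl hFm).trans ?_
          gcongr
        · refine (lintegral_cone_le hr hs e le_rfl hGm).trans ?_
          gcongr
    _ = 8 * D * (∫⁻ x in P.region, ‖u x‖ₑ ^ 2) +
          4 * M ^ 2 * D * ∫⁻ x in P.region, gradSq u x := by ring
    _ ≤ _ := by
        rw [mul_add]
        gcongr
        · exact le_self_add
        · exact le_add_self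

end PolygonalElement

/-! ### The space `H¹₀` -/

section Sobolev

variable {U : Set Plane}

lemma memLp_cont (hb : Bornology.IsBounded U) {f : Plane → ℝ} (hf : Continuous f) :
    MemLp f 2 (volume.restrict U) := by
  have hfin : IsFiniteMeasure (volume.restrict U) := ⟨by simpa using hb.measure_lt_top⟩
  obtain ⟨C, hC⟩ := hb.isCompact_closure.exists_bound_of_continuousOn hf.continuousOn
  refine MemLp.of_bound hf.aestronglyMeasurable C ?_
  have h : ∀ᵐ x ∂(volume.restrict (closure U)), ‖f x‖ ≤ C :=
    ae_restrict_of_forall_mem isClosed_closure.measurableSet hC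
  exact ae_restrict_of_ae_restrict_of_subset subset_closure h

lemma L2.inner_eq (v w : L2 U) : inner ℝ v w = ∫ x in U, v x * w x := by
  rw [MeasureTheory.L2.inner_def]
  refine integral_congr_ae (Eventually.of_forall fun x => ?_)
  simp [mul_comm]

lemma L2.integral_mul_eq_inner (v : L2 U) {f : Plane → ℝ} (hf : MemLp f 2 (volume.restrict U)) :
    ∫ x in U, v x * f x = inner ℝ v (hf.toLp f) := by
  rw [L2.inner_eq]
  refine integral_congr_ae ?_
  filter_upwards [hf.coeFn_toLp] with x hx
  rw [hx]

lemma L2.norm_sq_eq (v : L2 U) : ‖v‖ ^ 2 = ∫ x in U, v x ^ 2 := by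
  rw [← real_inner_self_eq_norm_sq, L2.inner_eq]
  simp only [sq]

lemma IsTestFun.pd {φ : Plane → ℝ} (h : IsTestFun U φ) (i : Fin 2) : IsTestFun U (pd i φ) := by
  have hs : tsupport (_root_.pd i φ) ⊆ tsupport φ := by
    refine closure_minimal (fun x hx => ?_) (isClosed_tsupport _)
    by_contra hx'
    apply hx
    have : fderiv ℝ φ x = 0 := by
      by_contra h0
      exact hx' (support_fderiv_subset ℝ h0)
    simp [_root_.pd, this]
  exact ⟨contDiff_pd i h.1, h.2.1.of_isClosed_subset (isClosed_tsupport _) hs, hs.trans h.2.2⟩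

lemma IsTestFun.eq_zero {φ : Plane → ℝ} (h : IsTestFun U φ) {x : Plane} (hx : x ∉ U) : φ x = 0 :=
  image_eq_zero_of_notMem_tsupport fun h' => hx (h.2.2 h')

lemma IsTestFun.lin {φ ψ : Plane → ℝ} (a : ℝ) (h : IsTestFun U φ) (h' : IsTestFun U ψ) :
    IsTestFun U (fun x => a * φ x + ψ x) := by
  refine ⟨(contDiff_const.mul h.1).add h'.1, ?_, ?_⟩
  · exact (h.2.1.mul_left (f := fun _ => a)).add h'.2.1
  · refine (tsupport_add _ _).trans (union_subset ?_ h'.2.2)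
    exact (tsupport_mul_subset_right (f := fun _ => a)).trans h.2.2

lemma IsTestFun.mul_smooth {φ f : Plane → ℝ} (h : IsTestFun U φ) (hf : ContDiff ℝ (⊤ : ℕ∞) f) :
    IsTestFun U (fun x => φ x * f x) :=
  ⟨h.1.mul hf, h.2.1.mul_right, (tsupport_mul_subset_left).trans h.2.2⟩

lemma IsTestFun.integral_mul_pd {φ f : Plane → ℝ} (h : IsTestFun U φ)
    (hf : ContDiff ℝ (⊤ : ℕ∞) f) (i : Fin 2) :
    ∫ x in U, φ x * _root_.pd i f x = - ∫ x in U, _root_.pd i φ x * f x := by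
  rw [setIntegral_eq_integral_of_forall_compl_eq_zero fun x hx => by rw [h.eq_zero hx, zero_mul],
    setIntegral_eq_integral_of_forall_compl_eq_zero
      fun x hx => by rw [(h.pd i).eq_zero hx, zero_mul]]
  have hc : ∀ {a b : Plane → ℝ}, Continuous a → HasCompactSupport a → Continuous b →
      Integrable (fun x => a x * b x) volume := fun ha hs hb =>
    (ha.mul hb).integrable_of_hasCompactSupport hs.mul_right
  exact integral_mul_fderiv_eq_neg_fderiv_mul_of_integrable
    (hc (continuous_pd i h.1) (h.pd i).2.1 hf.continuous)
    (hc h.1.continuous h.2.1 (continuous_pd i hf)) (hc h.1.continuous h.2.1 hf.continuous)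
    (fun x _ => h.1.differentiable (by simp) x) (fun x _ => hf.differentiable (by simp) x)

lemma pd_mul (i : Fin 2) {f g : Plane → ℝ} (hf : Differentiable ℝ f) (hg : Differentiable ℝ g)
    (x : Plane) : pd i (fun y => f y * g y) x = f x * pd i g x + pd i f x * g x := by
  unfold pd
  rw [fderiv_fun_mul (hf x) (hg x)]
  simp [mul_comm]

lemma pd_coord (x : Plane) : pd 0 (fun y : Plane => y 0) x = 1 := by
  have : HasFDerivAt (fun p : Plane => p 0) (EuclideanSpace.proj (0 : Fin 2) : Plane →L[ℝ] ℝ) x :=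
    (EuclideanSpace.proj (0 : Fin 2) : Plane →L[ℝ] ℝ).hasFDerivAt
  rw [pd, this.fderiv]
  simp

/-- Integration by parts against the coordinate `x₀`, whose derivative is `1`, gives `∫ φ² = - 2 ∫
x₀ φ ∂₀φ`. Young's inequality bounds the right side by `½ ∫ φ² + 2 R² ∫ (∂₀φ)²`, and the first term
is absorbed. -/
lemma IsTestFun.integral_sq_le {φ : Plane → ℝ} (hb : Bornology.IsBounded U) (h : IsTestFun U φ)
    {R : ℝ} (hR : ∀ x ∈ U, |x 0| ≤ R) (ho : IsOpen U) :
    ∫ x in U, φ x ^ 2 ≤ 4 * R ^ 2 * ∫ x in U, _root_.pd 0 φ x ^ 2 := by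
  have hx0 : ContDiff ℝ (⊤ : ℕ∞) (fun y : Plane => y 0) := by fun_prop
  have hd : Differentiable ℝ φ := h.1.differentiable (by simp)
  have e := (h.mul_smooth h.1).integral_mul_pd hx0 0
  simp only [pd_coord, mul_one, pd_mul 0 hd hd] at e
  have i1 : Integrable (fun x => φ x ^ 2) (volume.restrict U) :=
    integrable_cont hb (h.1.continuous.pow 2)
  have i2 : Integrable (fun x => _root_.pd 0 φ x ^ 2) (volume.restrict U) :=
    integrable_cont hb ((continuous_pd 0 h.1).pow 2)
  have key : ∫ x in U, φ x * φ x ≤ ∫ x in U, (1 / 2 * φ x ^ 2 + 2 * R ^ 2 * _root_.pd 0 φ x ^ 2) := by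
    rw [e, ← integral_neg]
    have hint : Integrable (fun x => -((φ x * _root_.pd 0 φ x + _root_.pd 0 φ x * φ x) * x 0))
        (volume.restrict U) := by
      refine integrable_cont hb ?_
      have := continuous_pd 0 h.1
      have := h.1.continuous
      fun_prop
    refine setIntegral_mono_on hint ((i1.const_mul _).add (i2.const_mul _)) ho.measurableSet
      fun x hx => ?_
    have h1 : (x 0) ^ 2 ≤ R ^ 2 := sq_le_sq' (neg_le_of_abs_le (hR x hx)) (le_of_abs_le (hR x hx))
    have h2 := mul_le_mul_of_nonneg_right h1 (sq_nonneg (_root_.pd 0 φ x))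
    nlinarith [sq_nonneg (φ x + 2 * (_root_.pd 0 φ x * x 0))]
  rw [integral_add (i1.const_mul _) (i2.const_mul _), integral_const_mul, integral_const_mul] at key
  simp only [← sq] at key
  linarith

variable (U) in
/-- Triples consisting of an `L²` function and the two components of its gradient. -/
abbrev SobolevTriple : Type := PiLp 2 (fun _ : Fin 3 => L2 U)

variable (U) in
/-- Test functions with their gradients. -/
def testSpace : Submodule ℝ (SobolevTriple U) where
  carrier := {z | ∃ φ, IsTestFun U φ ∧ z 0 =ᵐ[volume.restrict U] φ ∧
    ∀ i : Fin 2, z i.succ =ᵐ[volume.restrict U] pd i φ}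
  zero_mem' := by
    refine ⟨fun _ => 0, ⟨contDiff_const, HasCompactSupport.zero, ?_⟩, L2.coe_zero U, fun i => ?_⟩
    · exact (tsupport_eq_empty_iff.2 rfl).subset.trans (empty_subset _)
    · have : pd i (fun _ => (0 : ℝ)) = fun _ => 0 := by funext x; simp [pd]
      rw [this]; exact L2.coe_zero U
  add_mem' := by
    rintro z w ⟨φ, hφ, h0, h1⟩ ⟨ψ, hψ, k0, k1⟩
    refine ⟨_, hφ.lin 1 hψ, ?_, fun i => ?_⟩
    · filter_upwards [Lp.coeFn_add (z 0) (w 0), h0, k0] with x hx h k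
      rw [PiLp.add_apply, hx, Pi.add_apply, h, k, one_mul]
    · filter_upwards [Lp.coeFn_add (z i.succ) (w i.succ), h1 i, k1 i] with x hx h k
      rw [PiLp.add_apply, hx, Pi.add_apply, h, k, pd_lin i 1 (hφ.1.differentiable (by simp))
        (hψ.1.differentiable (by simp)), one_mul]
  smul_mem' := by
    rintro a z ⟨φ, hφ, h0, h1⟩
    refine ⟨fun x => a * φ x, ?_, ?_, fun i => ?_⟩
    · have := hφ.mul_smooth (contDiff_const (c := a))
      simpa only [mul_comm] using this
    · filter_upwards [Lp.coeFn_smul a (z 0), h0] with x hx h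
      rw [PiLp.smul_apply, hx, Pi.smul_apply, h, smul_eq_mul]
    · filter_upwards [Lp.coeFn_smul a (z i.succ), h1 i] with x hx h
      rw [PiLp.smul_apply, hx, Pi.smul_apply, h, smul_eq_mul, pd, pd,
        fderiv_const_mul (hφ.1.differentiable (by simp) x)]
      simp

lemma IsTestFun.exists_testSpace (hb : Bornology.IsBounded U) {φ : Plane → ℝ}
    (hφ : IsTestFun U φ) : ∃ z ∈ testSpace U, z 0 =ᵐ[volume.restrict U] φ ∧
    ∀ i : Fin 2, z i.succ =ᵐ[volume.restrict U] _root_.pd i φ := by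
  have h0 := memLp_cont hb hφ.1.continuous
  have h1 := fun i => memLp_cont hb (continuous_pd i hφ.1)
  let z : SobolevTriple U := WithLp.toLp 2 (Fin.cons (h0.toLp φ) fun i => (h1 i).toLp _)
  have e0 : z 0 =ᵐ[volume.restrict U] φ := h0.coeFn_toLp
  have e1 : ∀ i : Fin 2, z i.succ =ᵐ[volume.restrict U] _root_.pd i φ := fun i => (h1 i).coeFn_toLp
  exact ⟨z, ⟨φ, hφ, e0, e1⟩, e0, e1⟩

variable (U) in
/-- `H¹₀(U)`: the closure of the test functions in `H¹(U)`. -/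
def sobolevZero : Submodule ℝ (SobolevTriple U) := (testSpace U).topologicalClosure

/-- A closed condition on triples holds on `H¹₀` once it holds for test functions. Integration by
parts, Green's formula and Poincaré's inequality are all transferred in this way. -/
lemma sobolevZero_induction {p : SobolevTriple U → Prop} (hp : IsClosed {z | p z})
    (h : ∀ z ∈ testSpace U, p z) {z : SobolevTriple U} (hz : z ∈ sobolevZero U) : p z :=
  closure_minimal (fun z hz => h z hz) hp hz

lemma continuous_integral_mul (hb : Bornology.IsBounded U) (j : Fin 3) {f : Plane → ℝ}
    (hf : Continuous f) : Continuous fun z : SobolevTriple U => ∫ x in U, z j x * f x := by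
  simp only [fun z : SobolevTriple U => L2.integral_mul_eq_inner (z j) (memLp_cont hb hf)]
  fun_prop

lemma integral_mul_congr {v f g : Plane → ℝ} (h : v =ᵐ[volume.restrict U] g) :
    ∫ x in U, v x * f x = ∫ x in U, g x * f x :=
  integral_congr_ae (by filter_upwards [h] with x hx; rw [hx])

/-- Here `f` need not vanish at the boundary, because the test functions approximating `z` do. This
allows integration by parts against polynomials. -/
lemma sobolevZero_integral_mul_pd (hb : Bornology.IsBounded U) {z : SobolevTriple U}
    (hz : z ∈ sobolevZero U) {f : Plane → ℝ} (hf : ContDiff ℝ (⊤ : ℕ∞) f) (i : Fin 2) :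
    ∫ x in U, z 0 x * pd i f x = - ∫ x in U, z i.succ x * f x := by
  refine sobolevZero_induction (p := fun z : SobolevTriple U =>
    ∫ x in U, z 0 x * pd i f x = - ∫ x in U, z i.succ x * f x) ?_ ?_ hz
  · exact isClosed_eq (continuous_integral_mul hb 0 (continuous_pd i hf))
      (continuous_integral_mul hb _ hf.continuous).neg
  · rintro z ⟨φ, hφ, h0, h1⟩
    rw [integral_mul_congr h0, integral_mul_congr (h1 i), hφ.integral_mul_pd hf]

lemma sobolevZero_hasWeakGrad (hb : Bornology.IsBounded U) {z : SobolevTriple U}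
    (hz : z ∈ sobolevZero U) : HasWeakGrad U (z 0) fun i => z i.succ :=
  fun i _ hφ => sobolevZero_integral_mul_pd hb hz hφ.1 i

/-- For a test function this is the definition of the weak gradient with `∂ᵢφ` as test function,
summed over `i`; both sides are continuous in `z`. -/
lemma sobolevZero_green (ho : IsOpen U) (hb : Bornology.IsBounded U) {z : SobolevTriple U}
    (hz : z ∈ sobolevZero U) {v : L2 U} {F : Fin 2 → L2 U} (hF : HasWeakGrad U v F)
    {p : MvPolynomial (Fin 2) ℝ} (hp : HasLaplacian U v p) :
    ∑ i : Fin 2, inner ℝ (F i) (z i.succ) = - ∫ x in U, z 0 x * pval p x := by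
  refine sobolevZero_induction (p := fun z : SobolevTriple U =>
    ∑ i : Fin 2, inner ℝ (F i) (z i.succ) = - ∫ x in U, z 0 x * pval p x) ?_ ?_ hz
  · refine isClosed_eq ?_ (continuous_integral_mul hb 0 (continuous_pval p)).neg
    exact continuous_finsetSum _ fun i _ => by fun_prop
  · rintro z ⟨φ, hφ, h0, h1⟩
    have e : ∀ i : Fin 2, inner ℝ (F i) (z i.succ) = - ∫ x in U, v x * pd i (pd i φ) x := by
      intro i
      rw [hF i _ (hφ.pd i), neg_neg, L2.inner_eq]
      refine integral_congr_ae ?_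
      filter_upwards [h1 i] with x hx
      rw [hx]
    simp only [e]
    rw [Finset.sum_neg_distrib, ← integral_finsetSum _ fun i _ =>
      L2.integrable_mul ho hb v (continuous_pd i (contDiff_pd i hφ.1))]
    simp only [← Finset.mul_sum]
    rw [hp φ hφ, integral_mul_congr h0]
    simp only [mul_comm]

lemma exists_poincare (ho : IsOpen U) (hb : Bornology.IsBounded U) :
    ∃ C : ℝ, 0 ≤ C ∧ ∀ z ∈ sobolevZero U, ‖z 0‖ ^ 2 ≤ C * ∑ i : Fin 2, ‖z i.succ‖ ^ 2 := by
  obtain ⟨R, hR⟩ := hb.subset_closedBall 0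
  have hR' : ∀ x ∈ U, |x 0| ≤ R := fun x hx => by
    have h1 : ‖x‖ ≤ R := by simpa using hR hx
    exact (PiLp.norm_apply_le x 0).trans h1
  refine ⟨4 * R ^ 2, by positivity, fun z hz => ?_⟩
  refine sobolevZero_induction (p := fun z : SobolevTriple U =>
    ‖z 0‖ ^ 2 ≤ 4 * R ^ 2 * ∑ i : Fin 2, ‖z i.succ‖ ^ 2) ?_ ?_ hz
  · exact isClosed_le (by fun_prop) (by fun_prop)
  · rintro z ⟨φ, hφ, h0, h1⟩
    calc ‖z 0‖ ^ 2 = ∫ x in U, φ x ^ 2 := by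
          rw [L2.norm_sq_eq]
          refine integral_congr_ae ?_
          filter_upwards [h0] with x hx
          rw [hx]
      _ ≤ 4 * R ^ 2 * ∫ x in U, pd 0 φ x ^ 2 := hφ.integral_sq_le hb hR' ho
      _ = 4 * R ^ 2 * ‖z (Fin.succ 0)‖ ^ 2 := by
          rw [L2.norm_sq_eq]
          congr 1
          refine integral_congr_ae ?_
          filter_upwards [h1 0] with x hx
          rw [hx]
      _ ≤ _ := by
          gcongr
          rw [Fin.sum_univ_two]
          exact le_add_of_nonneg_right (by positivity)

/-- Lax–Milgram: Poincaré's inequality makes the gradient form coercive with constant `(C + 1)⁻¹`.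
The right side pairs with all three components of `y`, so it covers both a source term and the
gradient of a lifting of the boundary data. -/
lemma exists_dirichlet_solution (ho : IsOpen U) (hb : Bornology.IsBounded U) (y : SobolevTriple U) :
    ∃ z ∈ sobolevZero U, ∀ w ∈ sobolevZero U,
      ∑ i : Fin 2, inner ℝ (z i.succ) (w i.succ) = inner ℝ y w := by
  obtain ⟨C, hC0, hC⟩ := exists_poincare ho hb
  let H := sobolevZero U
  have : CompleteSpace H := (Submodule.isClosed_topologicalClosure _).completeSpace_coe
  let A : Fin 2 → H →L[ℝ] L2 U := fun i =>
    (PiLp.proj 2 (fun _ : Fin 3 => L2 U) i.succ : SobolevTriple U →L[ℝ] L2 U).comp H.subtypeL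
  let B : H →L[ℝ] H →L[ℝ] ℝ := ∑ i, (innerSL ℝ).bilinearComp (A i) (A i)
  have hB : ∀ u w : H, B u w = ∑ i : Fin 2, inner ℝ ((u : SobolevTriple U) i.succ)
      ((w : SobolevTriple U) i.succ) := fun u w => by
    simp only [B, sum_apply, ContinuousLinearMap.bilinearComp_apply]
    rfl
  have hco : IsCoercive B := by
    refine ⟨(C + 1)⁻¹, by positivity, fun u => ?_⟩
    rw [hB, mul_assoc, ← sq, inv_mul_le_iff₀ (by positivity)]
    have h1 := hC u u.2
    have h2 : ‖u‖ ^ 2 = ‖(u : SobolevTriple U) 0‖ ^ 2 +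
        ∑ i : Fin 2, ‖(u : SobolevTriple U) i.succ‖ ^ 2 := by
      rw [← Fin.sum_univ_succ (fun i => ‖(u : SobolevTriple U) i‖ ^ 2)]
      exact PiLp.norm_sq_eq_of_L2 _ _
    simp only [real_inner_self_eq_norm_sq]
    rw [h2]
    linarith
  let ℓ : StrongDual ℝ H := (innerSL ℝ y).comp H.subtypeL
  let u : H := hco.continuousLinearEquivOfBilin.symm ((InnerProductSpace.toDual ℝ H).symm ℓ)
  refine ⟨u, u.2, fun w hw => ?_⟩
  have h := hco.continuousLinearEquivOfBilin_apply u ⟨w, hw⟩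
  rw [hB] at h
  rw [← h]
  simp only [u, ContinuousLinearEquiv.apply_symm_apply]
  rw [InnerProductSpace.toDual_symm_apply]
  rfl

/-- The fundamental lemma of the calculus of variations. It makes the existentially quantified
gradients in the definitions unique. -/
lemma HasWeakGrad.eq_zero (ho : IsOpen U) {G : Fin 2 → L2 U}
    (h : HasWeakGrad U 0 G) : G = 0 := by
  funext i
  have hloc : LocallyIntegrableOn (G i) U volume := fun x hx => by
    obtain ⟨ε, hε, hball⟩ := Metric.isOpen_iff.1 ho x hx
    refine ⟨Metric.ball x ε, mem_nhdsWithin_of_mem_nhds (Metric.ball_mem_nhds x hε), ?_⟩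
    have hfin : IsFiniteMeasure (volume.restrict (Metric.ball x ε)) :=
      ⟨by simpa using (Metric.isBounded_ball (x := x) (r := ε)).measure_lt_top (μ := volume)⟩
    exact ((Lp.memLp (G i)).mono_measure (Measure.restrict_mono hball le_rfl)).integrable
      (by norm_num)
  have h0 := ho.ae_eq_zero_of_integral_contDiff_smul_eq_zero hloc fun g hg hgc hgs => by
    have h1 := h i g ⟨hg, hgc, hgs⟩
    rw [L2.integral_zero_mul, eq_comm, neg_eq_zero] at h1
    rw [← h1, setIntegral_eq_integral_of_forall_compl_eq_zero]
    · simp only [smul_eq_mul, mul_comm]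
    · intro x hx
      rw [image_eq_zero_of_notMem_tsupport fun h' => hx (hgs h'), mul_zero]
  refine Lp.ext ?_
  have h2 : ∀ᵐ x ∂(volume.restrict U), G i x = 0 := (ae_restrict_iff' ho.measurableSet).2 h0
  filter_upwards [h2, L2.coe_zero U] with x hx hx'
  rw [hx]
  exact hx'.symm

end Sobolev

/-! ### Mollification of Lipschitz functions -/

open scoped Convolution

/-- The mean of `f` with respect to the mollifier `φ`. -/
def mollify (φ : ContDiffBump (0 : Plane)) (f : Plane → ℝ) : Plane → ℝ :=
  φ.normed volume ⋆[ContinuousLinearMap.lsmul ℝ ℝ, volume] f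

/-- The directional derivative along the `i`-th axis. -/
def ld (i : Fin 2) (f : Plane → ℝ) (x : Plane) : ℝ := lineDeriv ℝ f x (EuclideanSpace.single i 1)

section

variable {f : Plane → ℝ} {K : NNReal} (φ : ContDiffBump (0 : Plane))

lemma contDiff_mollify (hf : LocallyIntegrable f) : ContDiff ℝ (⊤ : ℕ∞) (mollify φ f) :=
  φ.hasCompactSupport_normed.contDiff_convolution_left _ φ.contDiff_normed hf

lemma mollify_apply (x : Plane) : mollify φ f x = ∫ y, φ.normed volume (x - y) * f y := by
  simp [mollify, convolution_eq_swap]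

lemma norm_ld_le (hf : LipschitzWith K f) (i : Fin 2) (x : Plane) : ‖ld i f x‖ ≤ K := by
  simpa [ld] using norm_lineDeriv_le_of_lipschitz ℝ hf (x₀ := x) (v := EuclideanSpace.single i 1)

lemma measurable_ld (hf : Continuous f) (i : Fin 2) : Measurable (ld i f) :=
  measurable_lineDeriv hf

lemma locallyIntegrable_ld (hf : LipschitzWith K f) (i : Fin 2) : LocallyIntegrable (ld i f) :=
  hf.locallyIntegrable_lineDeriv _

/-- The derivative first falls on the smooth kernel; integration by parts for Lipschitz functions
moves it onto `f`. -/
lemma pd_mollify (hf : LipschitzWith K f) (i : Fin 2) (x : Plane) :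
    pd i (mollify φ f) x = mollify φ (ld i f) x := by
  set v : Plane := EuclideanSpace.single i 1 with hv
  have hφ : ContDiff ℝ 1 (φ.normed volume) := φ.contDiff_normed (n := 1)
  have hφc : HasCompactSupport (φ.normed volume) := φ.hasCompactSupport_normed
  have hfl : LocallyIntegrable f := hf.continuous.locallyIntegrable
  have h1 := hφc.hasFDerivAt_convolution_left (ContinuousLinearMap.lsmul ℝ ℝ) hφ hfl x
  have hex := (hφc.fderiv ℝ).convolutionExists_left
    ((ContinuousLinearMap.lsmul ℝ ℝ : ℝ →L[ℝ] ℝ →L[ℝ] ℝ).precompL Plane)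
    (hφ.continuous_fderiv (by simp)) hfl x
  obtain ⟨D, hD⟩ := hφ.lipschitzWith_of_hasCompactSupport hφc (by simp)
  have hg : LipschitzWith D fun y => φ.normed volume (x - y) := by
    have := hD.comp (IsometryEquiv.subLeft x).isometry.lipschitz
    rwa [mul_one] at this
  have hgc : HasCompactSupport fun y => φ.normed volume (x - y) :=
    hφc.comp_homeomorph (Homeomorph.subLeft x)
  calc pd i (mollify φ f) x
      = (∫ t, ((ContinuousLinearMap.lsmul ℝ ℝ : ℝ →L[ℝ] ℝ →L[ℝ] ℝ).precompL Plane
          (fderiv ℝ (φ.normed volume) t)) (f (x - t))) v := by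
        rw [pd, mollify, h1.fderiv]; rfl
    _ = ∫ t, fderiv ℝ (φ.normed volume) t v * f (x - t) := by
        rw [ContinuousLinearMap.integral_apply hex]
        simp [ContinuousLinearMap.precompL_apply]
    _ = ∫ y, fderiv ℝ (φ.normed volume) (x - y) v * f y := by
        rw [← integral_sub_left_eq_self _ volume x]
        simp
    _ = ∫ y, lineDeriv ℝ (fun y => φ.normed volume (x - y)) y (-v) * f y := by
        refine integral_congr_ae (Eventually.of_forall fun y => ?_)
        have hd : HasFDerivAt (fun y => φ.normed volume (x - y))
            ((fderiv ℝ (φ.normed volume) (x - y)).comp (-(ContinuousLinearMap.id ℝ Plane))) y :=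
          ((hφ.differentiable (by simp)) (x - y)).hasFDerivAt.comp y ((hasFDerivAt_id y).const_sub x)
        simp only [(hd.hasLineDerivAt (-v)).lineDeriv]
        simp
    _ = ∫ y, lineDeriv ℝ f y v * φ.normed volume (x - y) :=
        (hf.integral_lineDeriv_mul_eq hg hgc v).symm
    _ = mollify φ (ld i f) x := by
        rw [mollify_apply]
        simp only [mul_comm, ld, hv]

lemma norm_mollify_le {g : Plane → ℝ} {C : ℝ} (hg : ∀ x, ‖g x‖ ≤ C) (x : Plane) :
    ‖mollify φ g x‖ ≤ C := by
  have h : mollify φ g x = ∫ t, φ.normed volume t * g (x - t) := rfl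
  rw [h]
  calc _ ≤ ∫ t, φ.normed volume t * C := by
        refine norm_integral_le_of_norm_le (φ.integrable_normed.mul_const C)
          (Eventually.of_forall fun t => ?_)
        rw [norm_mul, Real.norm_of_nonneg (φ.nonneg_normed t)]
        exact mul_le_mul_of_nonneg_left (hg _) (φ.nonneg_normed t)
    _ = C := by rw [integral_mul_const, φ.integral_normed, one_mul]

lemma norm_pd_mollify_le (hf : LipschitzWith K f) (i : Fin 2) (x : Plane) :
    ‖pd i (mollify φ f) x‖ ≤ K := by
  rw [pd_mollify φ hf]
  exact norm_mollify_le φ (norm_ld_le hf i) x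

lemma dist_mollify_le (hf : LipschitzWith K f) (x : Plane) :
    dist (mollify φ f x) (f x) ≤ K * φ.rOut :=
  ContDiffBump.dist_normed_convolution_le hf.continuous.aestronglyMeasurable fun y hy =>
    (hf.dist_le_mul y x).trans (by gcongr; exact (Metric.mem_ball.1 hy).le)

lemma mollify_eq (x : Plane) (h : ∀ y ∈ Metric.ball x φ.rOut, f y = f x) :
    mollify φ f x = f x :=
  ContDiffBump.normed_convolution_eq_right h

end

/-- A bump function of outer radius `ε`. -/
def bumpOfRadius (ε : ℝ) (hε : 0 < ε) : ContDiffBump (0 : Plane) :=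
  ⟨ε / 2, ε, half_pos hε, half_lt_self hε⟩

lemma eLpNorm_two_sq {α : Type*} [MeasurableSpace α] {μ : Measure α} (f : α → ℝ) :
    eLpNorm f 2 μ ^ 2 = ∫⁻ x, ‖f x‖ₑ ^ 2 ∂μ := by
  rw [eLpNorm_eq_lintegral_rpow_enorm_toReal (by simp) (by simp), ← ENNReal.rpow_two,
    ← ENNReal.rpow_mul]
  simp

lemma tendsto_eLpNorm_two_iff {α ι : Type*} [MeasurableSpace α] {μ : Measure α} {l : Filter ι}
    (f : ι → α → ℝ) : Tendsto (fun n => eLpNorm (f n) 2 μ) l (𝓝 0) ↔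
      Tendsto (fun n => ∫⁻ x, ‖f n x‖ₑ ^ 2 ∂μ) l (𝓝 0) := by
  simp only [← eLpNorm_two_sq]
  constructor
  · intro h
    simpa using ENNReal.Tendsto.pow (n := 2) h
  · intro h
    have := h.ennrpow_const (1 / 2 : ℝ)
    simp only [← ENNReal.rpow_two, ← ENNReal.rpow_mul] at this
    simpa using this

lemma tendsto_eLpNorm_of_bounded {α : Type*} [MeasurableSpace α] {μ : Measure α} [IsFiniteMeasure μ]
    {f : ℕ → α → ℝ} (hf : ∀ n, AEStronglyMeasurable (f n) μ) {C : ℝ}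
    (hC : ∀ n, ∀ᵐ x ∂μ, ‖f n x‖ ≤ C) (hlim : ∀ᵐ x ∂μ, Tendsto (fun n => f n x) atTop (𝓝 0)) :
    Tendsto (fun n => eLpNorm (f n) 2 μ) atTop (𝓝 0) := by
  rw [tendsto_eLpNorm_two_iff]
  have h := tendsto_lintegral_of_dominated_convergence' (F := fun n x => ‖f n x‖ₑ ^ 2)
    (f := fun _ => 0) (μ := μ) (fun _ => ENNReal.ofReal C ^ 2)
    (fun n => (hf n).enorm.pow_const 2) (fun n => ?_) ?_ ?_
  · simpa using h
  · filter_upwards [hC n] with x hx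
    gcongr
    rw [← ofReal_norm]
    exact ENNReal.ofReal_le_ofReal hx
  · rw [lintegral_const]; finiteness
  · filter_upwards [hlim] with x hx
    have := ENNReal.Tendsto.pow (n := 2) hx.enorm
    simpa using this

/-- The restriction to `P` of a Lipschitz function is in `H¹(P)` and its trace is its restriction to
the boundary. -/
lemma exists_hasContTrace_of_lipschitz (P : PolygonalElement N) {g : Plane → ℝ} {K : NNReal}
    (hg : LipschitzWith K g) : ∃ v, HasContTrace P v g := by
  have hb := P.isBounded_region
  have hfin : IsFiniteMeasure (volume.restrict P.region) := ⟨by simpa using hb.measure_lt_top⟩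
  have hv := memLp_cont hb hg.continuous
  have hGm : ∀ i, AEStronglyMeasurable (ld i g) (volume.restrict P.region) := fun i =>
    (measurable_ld hg.continuous i).aestronglyMeasurable
  have hG : ∀ i, MemLp (ld i g) 2 (volume.restrict P.region) := fun i =>
    MemLp.of_bound (hGm i) K (Eventually.of_forall (norm_ld_le hg i))
  have hpos : ∀ n : ℕ, (0 : ℝ) < 1 / ((n : ℝ) + 1) := fun n => by positivity
  let φ : ℕ → ContDiffBump (0 : Plane) := fun n => bumpOfRadius (1 / ((n : ℝ) + 1)) (hpos n)
  have hφ : Tendsto (fun n => (φ n).rOut) atTop (𝓝 0) := tendsto_one_div_add_atTop_nhds_zero_nat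
  have hφ1 : ∀ n, (φ n).rOut ≤ 1 := fun n => by
    change 1 / ((n : ℝ) + 1) ≤ 1
    rw [div_le_one (by positivity)]
    linarith [(n.cast_nonneg : (0 : ℝ) ≤ n)]
  -- Inner and outer radii stay comparable, as required for convergence of the means at almost every
  -- point (Lebesgue differentiation).
  have hφ2 : ∀ᶠ n in atTop, (φ n).rOut ≤ 2 * (φ n).rIn := Eventually.of_forall fun n => by
    change 1 / ((n : ℝ) + 1) ≤ 2 * (1 / ((n : ℝ) + 1) / 2)
    linarith
  have hdist : ∀ n x, ‖mollify (φ n) g x - g x‖ ≤ K * (φ n).rOut := fun n x =>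
    dist_mollify_le (φ n) hg x
  have hdist1 : ∀ n x, ‖mollify (φ n) g x - g x‖ ≤ K := fun n x =>
    (hdist n x).trans (mul_le_of_le_one_right K.2 (hφ1 n))
  have hlim0 : ∀ x, Tendsto (fun n => mollify (φ n) g x - g x) atTop (𝓝 0) := fun x => by
    refine squeeze_zero_norm (fun n => hdist n x) ?_
    simpa using hφ.const_mul (K : ℝ)
  have hsm : ∀ n, ContDiff ℝ (⊤ : ℕ∞) (mollify (φ n) g) := fun n =>
    contDiff_mollify (φ n) hg.continuous.locallyIntegrable
  -- The gradient of `g` is only bounded and measurable, so its means converge almost everywhere and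
  -- not uniformly; dominated convergence with the Lipschitz bound gives convergence in `L²`.
  have hlim1 : ∀ i, Tendsto (fun n => eLpNorm (fun x => pd i (mollify (φ n) g) x - ld i g x) 2
      (volume.restrict P.region)) atTop (𝓝 0) := fun i => by
    refine tendsto_eLpNorm_of_bounded
      (fun n => (continuous_pd i (hsm n)).aestronglyMeasurable.sub (hGm i)) (C := K + K)
      (fun n => Eventually.of_forall fun x => (norm_sub_le _ _).trans
        (add_le_add (norm_pd_mollify_le (φ n) hg i x) (norm_ld_le hg i x))) ?_
    have h := ContDiffBump.ae_convolution_tendsto_right_of_locallyIntegrable hφ hφ2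
      (locallyIntegrable_ld hg i)
    refine ae_restrict_of_ae ?_
    filter_upwards [h] with x hx
    simp only [pd_mollify _ hg]
    simpa [mollify] using hx.sub_const (ld i g x)
  have hc0 := hv.coeFn_toLp
  have hc1 := fun i => (hG i).coeFn_toLp
  have e1 : ∀ i n, eLpNorm (fun x => pd i (mollify (φ n) g) x - (hG i).toLp (ld i g) x) 2
      (volume.restrict P.region) = eLpNorm (fun x => pd i (mollify (φ n) g) x - ld i g x) 2
      (volume.restrict P.region) := fun i n => eLpNorm_congr_ae (by
    filter_upwards [hc1 i] with x hx
    rw [hx])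
  refine ⟨hv.toLp g, hg.continuous.continuousOn, fun i => (hG i).toLp _, ?_,
    fun n => mollify (φ n) g, hsm, ?_, fun i => ?_, fun e => ?_⟩
  -- The almost everywhere derivative of a Lipschitz function is its weak derivative: integration by
  -- parts against `ψ`, which is itself Lipschitz with compact support.
  · intro i ψ hψ
    obtain ⟨D, hD⟩ := (hψ.1.of_le (by simp) : ContDiff ℝ 1 ψ).lipschitzWith_of_hasCompactSupport
      hψ.2.1 (by simp)
    rw [integral_mul_congr hc0, integral_mul_congr (hc1 i),
      setIntegral_eq_integral_of_forall_compl_eq_zero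
        fun x hx => by rw [(hψ.pd i).eq_zero hx, mul_zero],
      setIntegral_eq_integral_of_forall_compl_eq_zero
        fun x hx => by rw [hψ.eq_zero hx, mul_zero]]
    have h := hg.integral_lineDeriv_mul_eq hD hψ.2.1 (EuclideanSpace.single i 1) (μ := volume)
    simp only [ld]
    rw [h, ← integral_neg]
    refine integral_congr_ae (Eventually.of_forall fun x => ?_)
    have hd := (hψ.1.differentiable (by simp) x).hasFDerivAt.hasLineDerivAt
      (-(EuclideanSpace.single i 1))
    simp only [hd.lineDeriv, pd, map_neg]
    ring
  · have e0 : ∀ n, eLpNorm (fun x => mollify (φ n) g x - hv.toLp g x) 2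
        (volume.restrict P.region) = eLpNorm (fun x => mollify (φ n) g x - g x) 2
        (volume.restrict P.region) := fun n => eLpNorm_congr_ae (by
      filter_upwards [hc0] with x hx
      rw [hx])
    simp only [e0]
    exact tendsto_eLpNorm_of_bounded (fun n => (hsm n).continuous.aestronglyMeasurable.sub
      hg.continuous.aestronglyMeasurable) (fun n => Eventually.of_forall (hdist1 n))
      (Eventually.of_forall hlim0)
  · simp only [e1]
    exact hlim1 i
  · have hfin' : IsFiniteMeasure (volume.restrict (Icc (0 : ℝ) 1)) := ⟨by simp⟩
    exact tendsto_eLpNorm_of_bounded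
      (fun n => (((hsm n).continuous.comp (continuous_edgePath P e)).sub
        (hg.continuous.comp (continuous_edgePath P e))).aestronglyMeasurable)
      (fun n => Eventually.of_forall fun t => hdist1 n _) (Eventually.of_forall fun t => hlim0 _)

/-! ### Traces and `H¹₀` -/

section

variable {U : Set Plane}

lemma enorm_sub_eq_eLpNorm (v w : L2 U) {f : Plane → ℝ} (h : w =ᵐ[volume.restrict U] f) :
    ‖w - v‖ₑ = eLpNorm (fun x => f x - v x) 2 (volume.restrict U) := by
  rw [← edist_eq_enorm_sub, Lp.edist_def]
  refine eLpNorm_congr_ae ?_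
  filter_upwards [h] with x hx
  rw [Pi.sub_apply, hx]

lemma tendsto_L2_iff {w : ℕ → L2 U} {v : L2 U} {f : ℕ → Plane → ℝ}
    (h : ∀ n, w n =ᵐ[volume.restrict U] f n) : Tendsto w atTop (𝓝 v) ↔
      Tendsto (fun n => eLpNorm (fun x => f n x - v x) 2 (volume.restrict U)) atTop (𝓝 0) := by
  simp only [← enorm_sub_eq_eLpNorm v _ (h _), ← edist_eq_enorm_sub]
  exact tendsto_iff_edist_tendsto_0

lemma mem_sobolevZero_iff (hb : Bornology.IsBounded U) (z : SobolevTriple U) :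
    z ∈ sobolevZero U ↔ ∃ φ : ℕ → Plane → ℝ, (∀ n, IsTestFun U (φ n)) ∧
      Tendsto (fun n => eLpNorm (fun x => φ n x - z 0 x) 2 (volume.restrict U)) atTop (𝓝 0) ∧
      ∀ i : Fin 2, Tendsto (fun n => eLpNorm (fun x => pd i (φ n) x - z i.succ x) 2
        (volume.restrict U)) atTop (𝓝 0) := by
  constructor
  · intro hz
    obtain ⟨w, hw, hlim⟩ := mem_closure_iff_seq_limit.1 hz
    choose φ hφ h0 h1 using hw
    have hj : ∀ j : Fin 3, Tendsto (fun n => w n j) atTop (𝓝 (z j)) := fun j =>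
      ((PiLp.continuous_apply 2 (fun _ : Fin 3 => L2 U) j).tendsto z).comp hlim
    exact ⟨φ, hφ, (tendsto_L2_iff h0).1 (hj 0), fun i =>
      (tendsto_L2_iff fun n => h1 n i).1 (hj i.succ)⟩
  · rintro ⟨φ, hφ, h0, h1⟩
    choose w hw k0 k1 using fun n => (hφ n).exists_testSpace hb
    refine mem_closure_iff_seq_limit.2 ⟨w, hw, ?_⟩
    have hj : ∀ j : Fin 3, Tendsto (fun n => w n j) atTop (𝓝 (z j)) := by
      refine Fin.cases ((tendsto_L2_iff k0).2 h0) fun i => ?_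
      exact (tendsto_L2_iff fun n => k1 n i).2 (h1 i)
    exact ((PiLp.continuous_toLp 2 (fun _ : Fin 3 => L2 U)).tendsto _).comp (tendsto_pi_nhds.2 hj)

end

lemma sobolevZero_hasContTrace (P : PolygonalElement N) {z : SobolevTriple P.region}
    (hz : z ∈ sobolevZero P.region) : HasContTrace P (z 0) fun _ => 0 := by
  obtain ⟨φ, hφ, h0, h1⟩ := (mem_sobolevZero_iff P.isBounded_region z).1 hz
  refine ⟨continuousOn_const, _, sobolevZero_hasWeakGrad P.isBounded_region hz, φ,
    fun n => (hφ n).1, h0, h1, fun e => ?_⟩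
  have h : ∀ n, eLpNorm (fun t => φ n (P.edgePath ℝ e t) - 0) 2
      (volume.restrict (Icc (0 : ℝ) 1)) = 0 := fun n => by
    have : (fun t => φ n (P.edgePath ℝ e t) - 0) =ᵐ[volume.restrict (Icc (0 : ℝ) 1)] 0 :=
      ae_restrict_of_forall_mem measurableSet_Icc fun t ht => by
        simp [(hφ n).eq_zero (P.edgePath_notMem_region e ht)]
    rw [eLpNorm_congr_ae this, eLpNorm_zero]
  simp only [h, tendsto_const_nhds]

namespace PolygonalElement

variable {P : PolygonalElement N} {c : Plane} {r : ℝ}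

/-- The approximating functions and their gradients tend to `0` in `L²(P)`, so the trace inequality
sends their edge values to `0` in `L²`. Their limit `g` thus vanishes almost everywhere on the edge,
and everywhere by continuity. -/
lemma trace_eq_zero {g : Plane → ℝ} (h : HasContTrace P 0 g) (e : Fin N) {t : ℝ}
    (ht : t ∈ Icc (0 : ℝ) 1) : g (P.edgePath ℝ e t) = 0 := by
  obtain ⟨c, r, hr, hs⟩ := P.starShaped
  obtain ⟨hg, G, hG, u, hu, hu0, hu1, hu2⟩ := h
  obtain rfl := hG.eq_zero P.isOpen_region
  obtain ⟨C, hC, hest⟩ := exists_trace_estimate hr hs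
  have k0 : Tendsto (fun n => ∫⁻ x in P.region, ‖u n x‖ₑ ^ 2) atTop (𝓝 0) := by
    rw [tendsto_eLpNorm_two_iff] at hu0
    refine hu0.congr fun n => lintegral_congr_ae ?_
    filter_upwards [L2.coe_zero P.region] with x hx
    rw [hx, sub_zero]
  have k1 : Tendsto (fun n => ∫⁻ x in P.region, gradSq (u n) x) atTop (𝓝 0) := by
    have : ∀ i, Tendsto (fun n => ∫⁻ x in P.region, ‖pd i (u n) x‖ₑ ^ 2) atTop (𝓝 0) := fun i => by
      have hi := hu1 i
      rw [tendsto_eLpNorm_two_iff] at hi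
      refine hi.congr fun n => lintegral_congr_ae ?_
      filter_upwards [L2.coe_zero P.region] with x hx
      rw [Pi.zero_apply, hx, sub_zero]
    have h2 := tendsto_finsetSum Finset.univ fun i _ => this i
    simp only [Finset.sum_const_zero] at h2
    refine h2.congr fun n => ?_
    rw [← lintegral_finsetSum _ fun i _ => (continuous_pd i (hu n)).measurable.enorm.pow_const 2]
    rfl
  have k2 : Tendsto (fun n => C * ((∫⁻ x in P.region, ‖u n x‖ₑ ^ 2) +
      ∫⁻ x in P.region, gradSq (u n) x)) atTop (𝓝 0) := by
    simpa using ENNReal.Tendsto.const_mul (k0.add k1) (Or.inr hC)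
  have k3 : Tendsto (fun n => ∫⁻ t in Icc (0 : ℝ) 1, ‖u n (P.edgePath ℝ e t)‖ₑ ^ 2) atTop (𝓝 0) :=
    tendsto_of_tendsto_of_tendsto_of_le_of_le tendsto_const_nhds k2 (fun _ => zero_le)
      fun n => hest (u n) (hu n) e
  rw [← tendsto_eLpNorm_two_iff] at k3
  have hum : ∀ n, AEStronglyMeasurable (fun t => u n (P.edgePath ℝ e t))
      (volume.restrict (Icc (0 : ℝ) 1)) := fun n =>
    ((hu n).continuous.comp (continuous_edgePath P e)).aestronglyMeasurable
  have hgm : AEStronglyMeasurable (fun t => g (P.edgePath ℝ e t))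
      (volume.restrict (Icc (0 : ℝ) 1)) :=
    (continuousOn_edge hg e).aestronglyMeasurable measurableSet_Icc
  -- The constant sequence `g` is written as `-(u n - g) + u n`, a sum of two null sequences.
  have k4 := tendsto_eLpNorm_lin (-1) (fun n => (hum n).sub hgm) hum
    (h := fun _ t => g (P.edgePath ℝ e t)) (fun n => Eventually.of_forall fun t => by
      simp only [Pi.sub_apply]; ring) (hu2 e) k3
  have k5 := (eLpNorm_eq_zero_iff hgm (by simp)).1 (tendsto_nhds_unique tendsto_const_nhds k4)
  exact Measure.eqOn_Icc_of_ae_eq volume (zero_ne_one) k5 (continuousOn_edge hg e)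
    continuousOn_const ht

lemma trace_unique {v : L2 P.region} {g h : Plane → ℝ} (hg : HasContTrace P v g)
    (hh : HasContTrace P v h) (e : Fin N) {t : ℝ} (ht : t ∈ Icc (0 : ℝ) 1) :
    g (P.edgePath ℝ e t) = h (P.edgePath ℝ e t) := by
  have k := hg.lin (-1) hh
  rw [show (-1 : ℝ) • v + v = 0 by module] at k
  have := trace_eq_zero k e ht
  linarith

/-! ### Cutoff functions, collars, and functions with zero trace. -/

lemma volume_strip_le (hr : 0 < r) (hs : ∀ y ∈ Metric.ball c r, StarConvex ℝ y P.region)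
    (e : Fin N) {l : ℝ} (hl : 0 < l) :
    volume (P.strip c e l) ≤ ENNReal.ofReal |P.edgeDet c e| * ENNReal.ofReal (1 - l) := by
  have h := lintegral_strip_le hr hs e hl (F := fun _ => 1) measurable_const
  simpa using h

/-- A cutoff function for the complement of the strips along the boundary. -/
lemma exists_cutoff (hr : 0 < r) (hs : ∀ y ∈ Metric.ball c r, StarConvex ℝ y P.region)
    {l : ℝ} (hl : 0 < l) (hl1 : l < 1) :
    ∃ η : Plane → ℝ, IsTestFun P.region η ∧ (∀ x, ‖η x‖ₑ ≤ 1) ∧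
      (∀ x i, ‖pd i η x‖ₑ ≤ ENNReal.ofReal (4 / r) * (ENNReal.ofReal (1 - l))⁻¹) ∧
      ∀ x ∈ P.region, x ∉ ⋃ e, P.strip c e l → η x = 1 ∧ ∀ i, pd i η x = 0 := by
  -- A lower bound for the distance to the complement from any interior point outside the strips.
  set δ : ℝ := (1 - l) * r with hδ
  have hδ0 : 0 < δ := mul_pos (by linarith) hr
  -- `Metric.infDist` to the empty set is `0`, so lower bounds for `d` need the complement to be
  -- nonempty.
  have hne : (P.regionᶜ).Nonempty := by
    by_contra h
    rw [not_nonempty_iff_eq_empty, compl_empty_iff] at h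
    exact NormedSpace.unbounded_univ ℝ Plane (h ▸ P.isBounded_region)
  set d : Plane → ℝ := fun x => Metric.infDist x P.regionᶜ with hd
  have hdl : LipschitzWith 1 d := Metric.lipschitz_infDist_pt _
  -- A ramp in the distance `d`, equal to `0` for `d ≤ δ/4` and to `1` for `d ≥ δ/2`. Its slope `4/δ
  -- = (4/r) / (1 - l)` is the gradient bound claimed for the cutoff.
  set f : Plane → ℝ := fun x => max 0 (min 1 (4 / δ * d x - 1)) with hf
  have h4 : (0 : ℝ) ≤ 4 / δ := by positivity
  have hfl : LipschitzWith (4 / δ).toNNReal f := by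
    refine LipschitzWith.const_max (LipschitzWith.const_min ?_ 1) 0
    refine LipschitzWith.of_dist_le_mul fun x y => ?_
    rw [Real.coe_toNNReal _ h4, Real.dist_eq,
      show 4 / δ * d x - 1 - (4 / δ * d y - 1) = 4 / δ * (d x - d y) by ring, abs_mul, abs_of_nonneg h4]
    gcongr
    simpa [Real.dist_eq] using hdl.dist_le_mul x y
  have hf1 : ∀ x, δ / 2 ≤ d x → f x = 1 := fun x hx => by
    have : 1 ≤ 4 / δ * d x - 1 := by
      have : 4 / δ * (δ / 2) ≤ 4 / δ * d x := by gcongr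
      rw [show 4 / δ * (δ / 2) = 2 by field_simp; norm_num] at this
      linarith
    simp [hf, min_eq_left this]
  have hf0 : ∀ x, d x ≤ δ / 4 → f x = 0 := fun x hx => by
    have : 4 / δ * d x - 1 ≤ 0 := by
      have : 4 / δ * d x ≤ 4 / δ * (δ / 4) := by gcongr
      rw [show 4 / δ * (δ / 4) = 1 by field_simp] at this
      linarith
    exact max_eq_left ((min_le_right _ _).trans this)
  have hfn : ∀ x, ‖f x‖ ≤ 1 := fun x => by
    rw [Real.norm_of_nonneg (le_max_left _ _)]
    exact max_le zero_le_one (min_le_left _ _)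
  have hδ8 : 0 < δ / 8 := by positivity
  let φ := bumpOfRadius (δ / 8) hδ8
  have hdd : ∀ x y, d x - dist x y ≤ d y := fun x y => by
    have := hdl.dist_le_mul x y
    rw [Real.dist_eq] at this
    have := (abs_le.1 this).2
    simp only [NNReal.coe_one, one_mul] at this
    linarith
  -- Mollification at radius `δ/8` shifts the thresholds by `δ/8`: the result is `1` for `d ≥ 5δ/8`,
  -- and below it is `0` for `d ≤ δ/8`, which leaves a margin to the complement.
  have hη1 : ∀ x, 5 * δ / 8 ≤ d x → mollify φ f x = 1 := fun x hx => by
    rw [mollify_eq φ x, hf1 x (by linarith)]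
    intro y hy
    have hy' : dist y x < δ / 8 := hy
    rw [hf1 x (by linarith), hf1 y]
    have := hdd x y
    rw [dist_comm] at this
    linarith
  have hη0 : ∀ x, d x ≤ δ / 8 → mollify φ f x = 0 := fun x hx => by
    rw [mollify_eq φ x, hf0 x (by linarith)]
    intro y hy
    have hy' : dist y x < δ / 8 := hy
    rw [hf0 x (by linarith), hf0 y]
    have := hdd y x
    linarith
  have hts : tsupport (mollify φ f) ⊆ {x | δ / 8 ≤ d x} := by
    refine closure_minimal (fun x hx => ?_) (isClosed_le continuous_const hdl.continuous)
    by_contra hlt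
    exact hx (hη0 x (le_of_lt (not_le.1 hlt)))
  have htr : tsupport (mollify φ f) ⊆ P.region := fun x hx => by
    by_contra hxn
    have h1 : δ / 8 ≤ d x := hts hx
    have h2 : d x = 0 := Metric.infDist_zero_of_mem hxn
    linarith
  refine ⟨mollify φ f, ⟨contDiff_mollify φ hfl.continuous.locallyIntegrable, ?_, htr⟩,
    fun x => ?_, fun x i => ?_, fun x hx hxA => ?_⟩
  · exact Metric.isCompact_of_isClosed_isBounded (isClosed_tsupport _)
      (P.isBounded_region.subset htr)
  · rw [← ofReal_norm, ← ENNReal.ofReal_one]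
    exact ENNReal.ofReal_le_ofReal (norm_mollify_le φ hfn x)
  · have := norm_pd_mollify_le φ hfl i x
    rw [Real.coe_toNNReal _ h4] at this
    rw [← ofReal_norm, ← ENNReal.ofReal_inv_of_pos (by linarith),
      ← ENNReal.ofReal_mul (by positivity)]
    refine ENNReal.ofReal_le_ofReal (this.trans_eq ?_)
    rw [hδ]
    have : 1 - l ≠ 0 := by linarith
    field_simp
  · have hdx : δ ≤ d x := by
      have : ∃ z ∈ P.region, x = c + l • (z - c) := by
        by_contra! hz
        obtain ⟨e, he⟩ := exists_mem_strip hr hs hl hx hz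
        exact hxA (mem_iUnion.2 ⟨e, he⟩)
      obtain ⟨z, hz, rfl⟩ := this
      rw [hd, Metric.le_infDist hne]
      intro y hy
      by_contra! hlt
      refine hy (ball_subset_region hs (subset_closure hz) hl.le hl1 ?_)
      rw [Metric.mem_ball, dist_comm]
      exact hlt
    refine ⟨hη1 x (by linarith), fun i => ?_⟩
    have hev : mollify φ f =ᶠ[𝓝 x] fun _ => 1 := by
      filter_upwards [Metric.ball_mem_nhds x hδ8] with y hy
      refine hη1 y ?_
      have := hdd x y
      rw [Metric.mem_ball, dist_comm] at hy
      linarith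
    rw [pd, hev.fderiv_eq]
    simp

end PolygonalElement

namespace PolygonalElement

variable {P : PolygonalElement N} {c : Plane} {r : ℝ}

variable (P) in
/-- The part of the element close to its boundary. -/
def collar (c : Plane) (l : ℝ) : Set Plane := ⋃ e, P.strip c e l

lemma measurableSet_collar (hr : 0 < r) (hs : ∀ y ∈ Metric.ball c r, StarConvex ℝ y P.region)
    {l : ℝ} (hl : 0 < l) : MeasurableSet (P.collar c l) :=
  MeasurableSet.iUnion fun e => measurableSet_strip hr hs e hl

lemma collar_subset (hr : 0 < r) (hs : ∀ y ∈ Metric.ball c r, StarConvex ℝ y P.region)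
    {l : ℝ} (hl : 0 < l) : P.collar c l ⊆ P.region :=
  iUnion_subset fun e => strip_subset hr hs e hl

/-- Integrals over thin collars are small. -/
lemma exists_lintegral_collar_le (hr : 0 < r)
    (hs : ∀ y ∈ Metric.ball c r, StarConvex ℝ y P.region) {F : Plane → ENNReal}
    (hF : ∫⁻ x in P.region, F x ≠ ⊤) {ε : ENNReal} (hε : ε ≠ 0) :
    ∃ l : ℝ, 1 / 2 ≤ l ∧ l < 1 ∧ ∫⁻ x in P.collar c l, F x ≤ ε := by
  obtain ⟨δ, hδ, hsmall⟩ := exists_pos_setLIntegral_lt_of_measure_lt hF hε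
  set D : ENNReal := ∑ e, ENNReal.ofReal |P.edgeDet c e| with hDdef
  have hD : D ≠ ⊤ := by simp [hDdef]
  have hlim : Tendsto (fun l : ℝ => D * ENNReal.ofReal (1 - l)) (𝓝[<] 1) (𝓝 0) := by
    have h1 : Tendsto (fun l : ℝ => ENNReal.ofReal (1 - l)) (𝓝 1) (𝓝 0) := by
      have : Continuous fun l : ℝ => ENNReal.ofReal (1 - l) :=
        ENNReal.continuous_ofReal.comp (by fun_prop)
      simpa using this.tendsto 1
    simpa using ENNReal.Tendsto.const_mul (h1.mono_left nhdsWithin_le_nhds) (Or.inr hD)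
  have hev : ∀ᶠ l : ℝ in 𝓝[<] 1, D * ENNReal.ofReal (1 - l) < δ := hlim (Iio_mem_nhds hδ)
  obtain ⟨l, hlδ, hl⟩ := (hev.and (Ico_mem_nhdsLT (show (1 / 2 : ℝ) < 1 by norm_num))).exists
  have hl0 : 0 < l := by linarith [hl.1]
  refine ⟨l, hl.1, hl.2, ?_⟩
  have hms := measurableSet_collar hr hs hl0
  have hvol : volume.restrict P.region (P.collar c l) < δ := by
    refine lt_of_le_of_lt ?_ hlδ
    rw [Measure.restrict_apply hms, hDdef, Finset.sum_mul]
    calc _ ≤ volume (P.collar c l) := measure_mono inter_subset_left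
      _ ≤ ∑ e, volume (P.strip c e l) := measure_iUnion_fintype_le _ _
      _ ≤ _ := Finset.sum_le_sum fun e _ => volume_strip_le hr hs e hl0
  have h := hsmall (P.collar c l) hvol
  rw [Measure.restrict_restrict_of_subset (collar_subset hr hs hl0)] at h
  exact h.le

lemma lintegral_collar_le (hr : 0 < r)
    (hs : ∀ y ∈ Metric.ball c r, StarConvex ℝ y P.region) :
    ∃ C : ENNReal, C ≠ ⊤ ∧ ∀ l, 1 / 2 ≤ l → ∀ u : Plane → ℝ, ContDiff ℝ (⊤ : ℕ∞) u →
      ∫⁻ x in P.collar c l, ‖u x‖ₑ ^ 2 ≤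
        C * (∑ e, ∫⁻ t in Icc (0 : ℝ) 1, ‖u (P.edgePath ℝ e t)‖ₑ ^ 2) +
        C * ENNReal.ofReal (1 - l) ^ 2 * ∫⁻ x in P.collar c l, gradSq u x := by
  obtain ⟨C, hC, hest⟩ := exists_strip_estimate hr hs
  refine ⟨C + N * C, by finiteness, fun l hl u hu => ?_⟩
  calc ∫⁻ x in P.collar c l, ‖u x‖ₑ ^ 2
      ≤ ∑ e, ∫⁻ x in P.strip c e l, ‖u x‖ₑ ^ 2 := by
        refine (lintegral_iUnion_le _ _).trans_eq ?_
        rw [tsum_fintype]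
    _ ≤ ∑ e, (C * (∫⁻ t in Icc (0 : ℝ) 1, ‖u (P.edgePath ℝ e t)‖ₑ ^ 2) +
        C * ENNReal.ofReal (1 - l) ^ 2 * ∫⁻ x in P.collar c l, gradSq u x) := by
        refine Finset.sum_le_sum fun e _ => (hest l hl u hu e).trans ?_
        gcongr
        exact subset_iUnion (fun e => P.strip c e l) e
    _ = C * (∑ e, ∫⁻ t in Icc (0 : ℝ) 1, ‖u (P.edgePath ℝ e t)‖ₑ ^ 2) +
        N * C * ENNReal.ofReal (1 - l) ^ 2 * ∫⁻ x in P.collar c l, gradSq u x := by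
        rw [Finset.sum_add_distrib, ← Finset.mul_sum, Finset.sum_const, Finset.card_univ,
          Fintype.card_fin, nsmul_eq_mul]
        ring
    _ ≤ _ := by
        gcongr
        · exact le_self_add
        · exact le_add_self

/-- A smooth function is close to its product with a cutoff function if it is close to a function
with zero trace. -/
lemma exists_cutoff_estimate (hr : 0 < r)
    (hs : ∀ y ∈ Metric.ball c r, StarConvex ℝ y P.region) :
    ∃ C : ENNReal, C ≠ ⊤ ∧ ∀ l : ℝ, 1 / 2 ≤ l → l < 1 → ∃ B : ENNReal, B ≠ ⊤ ∧
      ∀ u : Plane → ℝ, ContDiff ℝ (⊤ : ℕ∞) u →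
      ∀ (v : L2 P.region) (G : Fin 2 → L2 P.region), ∃ ψ, IsTestFun P.region ψ ∧
        (∫⁻ x in P.region, ‖ψ x - v x‖ₑ ^ 2) +
          ∑ i, ∫⁻ x in P.region, ‖pd i ψ x - G i x‖ₑ ^ 2 ≤
        B * ((∫⁻ x in P.region, ‖u x - v x‖ₑ ^ 2) +
          (∑ i, ∫⁻ x in P.region, ‖pd i u x - G i x‖ₑ ^ 2) +
          ∑ e, ∫⁻ t in Icc (0 : ℝ) 1, ‖u (P.edgePath ℝ e t)‖ₑ ^ 2) +
        C * ∫⁻ x in P.collar c l, (‖v x‖ₑ ^ 2 + ∑ i, ‖G i x‖ₑ ^ 2) := by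
  obtain ⟨C, hC, hcol⟩ := lintegral_collar_le hr hs
  set K : ENNReal := ENNReal.ofReal (4 / r) with hK
  have hKt : K ≠ ⊤ := ENNReal.ofReal_ne_top
  -- This constant multiplies the integral over the collar and must not depend on `l`, which is
  -- later chosen to make that integral small.
  refine ⟨16 + 8 * K ^ 2 * C, by finiteness, fun l hl hl1 => ?_⟩
  set L : ENNReal := ENNReal.ofReal (1 - l) with hL
  have hL0 : L ≠ 0 := by simp [hL, hl1]
  have hLt : L ≠ ⊤ := ENNReal.ofReal_ne_top
  have hLi : L⁻¹ ≠ ⊤ := ENNReal.inv_ne_top.2 hL0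
  have hLL : L⁻¹ ^ 2 * L ^ 2 = 1 := by
    rw [← mul_pow, ENNReal.inv_mul_cancel hL0 hLt, one_pow]
  have hl0 : 0 < l := by linarith
  -- This constant may blow up as `l → 1`: it multiplies the approximation error, which tends to `0`
  -- for fixed `l`.
  refine ⟨4 + 4 * (K * L⁻¹) ^ 2 * C + 8 * K ^ 2 * C, by finiteness, fun u hu v G => ?_⟩
  obtain ⟨η, hη, hη1, hη2, hη3⟩ := exists_cutoff hr hs hl0 hl1
  have hms := measurableSet_collar hr hs hl0 (P := P)
  have hsub := collar_subset hr hs hl0 (P := P)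
  have hud := hu.differentiable (by simp)
  have hηd := hη.1.differentiable (by simp)
  set A := P.collar c l with hA
  set μ := volume.restrict P.region with hμ
  have hAμ : ∀ F : Plane → ENNReal, ∫⁻ x, A.indicator F x ∂μ = ∫⁻ x in A, F x := fun F => by
    rw [lintegral_indicator hms, hμ, Measure.restrict_restrict_of_subset hsub]
  have hvm : AEMeasurable (fun x => ‖v x‖ₑ ^ 2) μ := (Lp.aestronglyMeasurable v).enorm.pow_const 2
  have hGm : ∀ i, AEMeasurable (fun x => ‖G i x‖ₑ ^ 2) μ := fun i =>
    (Lp.aestronglyMeasurable (G i)).enorm.pow_const 2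
  have hμA : volume.restrict A ≤ μ := Measure.restrict_mono hsub le_rfl
  have hum : Measurable fun x => ‖u x‖ₑ ^ 2 := hu.continuous.measurable.enorm.pow_const 2
  have hdm0 : AEMeasurable (fun x => ‖u x - v x‖ₑ ^ 2) μ :=
    (hu.continuous.aestronglyMeasurable.sub (Lp.aestronglyMeasurable v)).enorm.pow_const 2
  have hdm : ∀ i, AEMeasurable (fun x => ‖pd i u x - G i x‖ₑ ^ 2) μ := fun i =>
    ((continuous_pd i hu).aestronglyMeasurable.sub (Lp.aestronglyMeasurable (G i))).enorm.pow_const 2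
  -- the two pointwise bounds
  have hη4 : ∀ x, ‖η x - 1‖ₑ ^ 2 ≤ 4 := fun x => by
    calc ‖η x - 1‖ₑ ^ 2 ≤ (1 + 1) ^ 2 := by
          gcongr
          refine enorm_sub_le.trans (add_le_add (hη1 x) (by simp))
      _ = 4 := by norm_num
  have hpt : ∀ x ∈ P.region, ∀ a b : ℝ, ‖η x * a - b‖ₑ ^ 2 ≤
      2 * ‖a - b‖ₑ ^ 2 + A.indicator (fun _ => 8 * ‖b‖ₑ ^ 2) x := by
    intro x hx a b
    -- The splitting `η a - b = η (a - b) + (η - 1) b`; the second term lives on the collar.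
    have h1 : ‖η x * a - b‖ₑ ^ 2 ≤ 2 * ‖η x * (a - b)‖ₑ ^ 2 + 2 * ‖(η x - 1) * b‖ₑ ^ 2 := by
      have := enorm_sq_le_sub (η x * a - b) (η x * (a - b))
      rwa [show η x * a - b - η x * (a - b) = (η x - 1) * b by ring] at this
    refine h1.trans (add_le_add ?_ ?_)
    · rw [enorm_mul]
      gcongr
      exact mul_le_of_le_one_left zero_le (hη1 x)
    · by_cases hxA : x ∈ A
      · rw [indicator_of_mem hxA, enorm_mul, mul_pow]
        calc 2 * (‖η x - 1‖ₑ ^ 2 * ‖b‖ₑ ^ 2) ≤ 2 * (4 * ‖b‖ₑ ^ 2) := by gcongr; exact hη4 x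
          _ = 8 * ‖b‖ₑ ^ 2 := by ring
      · rw [(hη3 x hx hxA).1]
        simp
  have hptd : ∀ x ∈ P.region, ∀ i, ‖η x * pd i u x + pd i η x * u x - G i x‖ₑ ^ 2 ≤
      2 * ‖pd i u x - G i x‖ₑ ^ 2 * 2 + A.indicator (fun x => 16 * ‖G i x‖ₑ ^ 2) x +
        A.indicator (fun x => 2 * (K * L⁻¹) ^ 2 * ‖u x‖ₑ ^ 2) x := by
    intro x hx i
    have h1 := enorm_sq_le_sub (η x * pd i u x + pd i η x * u x - G i x) (η x * pd i u x - G i x)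
    rw [show η x * pd i u x + pd i η x * u x - G i x - (η x * pd i u x - G i x)
      = pd i η x * u x by ring] at h1
    refine h1.trans (add_le_add ?_ ?_)
    · calc 2 * ‖η x * pd i u x - G i x‖ₑ ^ 2 ≤ 2 * (2 * ‖pd i u x - G i x‖ₑ ^ 2 +
            A.indicator (fun _ => 8 * ‖G i x‖ₑ ^ 2) x) := by gcongr; exact hpt x hx _ _
        _ = _ := by
            by_cases hxA : x ∈ A
            · rw [indicator_of_mem hxA, indicator_of_mem hxA]; ring
            · rw [indicator_of_notMem hxA, indicator_of_notMem hxA]; ring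
    · by_cases hxA : x ∈ A
      · rw [indicator_of_mem hxA, enorm_mul, mul_pow, mul_assoc]
        gcongr
        exact hη2 x i
      · rw [(hη3 x hx hxA).2 i]
        simp
  have hreg : MeasurableSet P.region := P.isOpen_region.measurableSet
  have hI0 : ∫⁻ x, ‖η x * u x - v x‖ₑ ^ 2 ∂μ ≤
      2 * (∫⁻ x, ‖u x - v x‖ₑ ^ 2 ∂μ) + 8 * ∫⁻ x in A, ‖v x‖ₑ ^ 2 := by
    calc _ ≤ ∫⁻ x, (2 * ‖u x - v x‖ₑ ^ 2 + A.indicator (fun x => 8 * ‖v x‖ₑ ^ 2) x) ∂μ :=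
          setLIntegral_mono' hreg fun x hx => hpt x hx _ _
      _ = _ := by
          rw [lintegral_add_left' (hdm0.const_mul 2), hAμ, lintegral_const_mul' _ _ (by simp),
            lintegral_const_mul' _ _ (by simp)]
  have hI1 : ∀ i, ∫⁻ x, ‖η x * pd i u x + pd i η x * u x - G i x‖ₑ ^ 2 ∂μ ≤
      4 * (∫⁻ x, ‖pd i u x - G i x‖ₑ ^ 2 ∂μ) + 16 * (∫⁻ x in A, ‖G i x‖ₑ ^ 2) +
        2 * (K * L⁻¹) ^ 2 * ∫⁻ x in A, ‖u x‖ₑ ^ 2 := fun i => by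
    calc _ ≤ ∫⁻ x, (2 * ‖pd i u x - G i x‖ₑ ^ 2 * 2 + A.indicator (fun x => 16 * ‖G i x‖ₑ ^ 2) x +
          A.indicator (fun x => 2 * (K * L⁻¹) ^ 2 * ‖u x‖ₑ ^ 2) x) ∂μ :=
          setLIntegral_mono' hreg fun x hx => hptd x hx i
      _ = _ := by
          rw [lintegral_add_right' _ ((hum.const_mul _).indicator hms).aemeasurable,
            lintegral_add_left' (((hdm i).const_mul 2).mul_const 2), hAμ, hAμ,
            lintegral_mul_const' _ _ (by simp), lintegral_const_mul' _ _ (by simp),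
            lintegral_const_mul' _ _ (by simp), lintegral_const_mul' _ _ (by finiteness)]
          ring
  have hgrad : ∫⁻ x in A, gradSq u x ≤ 2 * (∑ i, ∫⁻ x, ‖pd i u x - G i x‖ₑ ^ 2 ∂μ) +
      2 * ∑ i, ∫⁻ x in A, ‖G i x‖ₑ ^ 2 := by
    calc ∫⁻ x in A, gradSq u x = ∑ i, ∫⁻ x in A, ‖pd i u x‖ₑ ^ 2 := by
          rw [← lintegral_finsetSum _ fun i _ => (continuous_pd i hu).measurable.enorm.pow_const 2]
          rfl
      _ ≤ ∑ i, (2 * (∫⁻ x in A, ‖G i x‖ₑ ^ 2) + 2 * ∫⁻ x, ‖pd i u x - G i x‖ₑ ^ 2 ∂μ) := by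
          refine Finset.sum_le_sum fun i _ => ?_
          calc _ ≤ ∫⁻ x in A, (2 * ‖G i x‖ₑ ^ 2 + 2 * ‖pd i u x - G i x‖ₑ ^ 2) :=
                lintegral_mono fun x => enorm_sq_le_sub _ _
            _ = 2 * (∫⁻ x in A, ‖G i x‖ₑ ^ 2) + 2 * ∫⁻ x in A, ‖pd i u x - G i x‖ₑ ^ 2 := by
                rw [lintegral_add_left' (((hGm i).mono_measure hμA).const_mul 2),
                  lintegral_const_mul' _ _ (by simp), lintegral_const_mul' _ _ (by simp)]
            _ ≤ _ := by gcongr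
      _ = _ := by
          rw [Finset.sum_add_distrib, ← Finset.mul_sum, ← Finset.mul_sum, add_comm]
  have hsplit : ∫⁻ x in A, (‖v x‖ₑ ^ 2 + ∑ i, ‖G i x‖ₑ ^ 2) =
      (∫⁻ x in A, ‖v x‖ₑ ^ 2) + ∑ i, ∫⁻ x in A, ‖G i x‖ₑ ^ 2 := by
    rw [lintegral_add_left' (hvm.mono_measure hμA), lintegral_finsetSum' _ fun i _ =>
      (hGm i).mono_measure hμA]
  refine ⟨fun x => η x * u x, hη.mul_smooth hu, ?_⟩
  simp only [pd_mul _ hηd hud]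
  rw [hsplit]
  have hcol' := hcol l hl u hu
  set a := ∫⁻ x, ‖u x - v x‖ₑ ^ 2 ∂μ
  set b := ∑ i, ∫⁻ x, ‖pd i u x - G i x‖ₑ ^ 2 ∂μ with hb
  set τ := ∑ e, ∫⁻ t in Icc (0 : ℝ) 1, ‖u (P.edgePath ℝ e t)‖ₑ ^ 2
  set p := ∫⁻ x in A, ‖v x‖ₑ ^ 2
  set q := ∑ i, ∫⁻ x in A, ‖G i x‖ₑ ^ 2 with hq
  -- In the bound of `∂η · u` this is multiplied by `(K L⁻¹)²`. The factor `L²` then cancels `L⁻²`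
  -- in front of the energy, so the collar term keeps a constant free of `l`.
  have hU : ∫⁻ x in A, ‖u x‖ₑ ^ 2 ≤ C * τ + C * L ^ 2 * (2 * b + 2 * q) :=
    hcol'.trans (by gcongr)
  calc _ ≤ (2 * a + 8 * p) + ∑ i : Fin 2, (4 * (∫⁻ x, ‖pd i u x - G i x‖ₑ ^ 2 ∂μ) +
        16 * (∫⁻ x in A, ‖G i x‖ₑ ^ 2) +
        2 * (K * L⁻¹) ^ 2 * (C * τ + C * L ^ 2 * (2 * b + 2 * q))) := by
        refine add_le_add hI0 (Finset.sum_le_sum fun i _ => (hI1 i).trans ?_)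
        gcongr
    _ = 2 * a + 8 * p + (4 * b + 16 * q + 4 * (K * L⁻¹) ^ 2 * C * τ +
          8 * K ^ 2 * C * (L⁻¹ ^ 2 * L ^ 2) * b + 8 * K ^ 2 * C * (L⁻¹ ^ 2 * L ^ 2) * q) := by
        rw [hb, hq]
        simp only [Fin.sum_univ_two]
        ring
    _ ≤ _ := by
        rw [hLL]
        refine (le_self_add (b := (2 + 4 * (K * L⁻¹) ^ 2 * C + 8 * K ^ 2 * C) * a +
          4 * (K * L⁻¹) ^ 2 * C * b + (4 + 8 * K ^ 2 * C) * τ + (8 + 8 * K ^ 2 * C) * p)).trans_eq ?_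
        ring

/-- Functions in `H¹(P)` with zero trace are in `H¹₀(P)`. -/
lemma mem_sobolevZero_of_trace_eq_zero {v : L2 P.region} {g : Plane → ℝ} (h : HasContTrace P v g)
    (hg0 : ∀ e, ∀ t ∈ Icc (0 : ℝ) 1, g (P.edgePath ℝ e t) = 0) :
    ∃ z ∈ sobolevZero P.region, z 0 = v := by
  obtain ⟨c, r, hr, hs⟩ := P.starShaped
  obtain ⟨-, G, hG, u, hu, hu0, hu1, hu2⟩ := h
  obtain ⟨C, hC, hcut⟩ := exists_cutoff_estimate hr hs
  have hF : ∫⁻ x in P.region, (‖v x‖ₑ ^ 2 + ∑ i, ‖G i x‖ₑ ^ 2) ≠ ⊤ := by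
    have hsq : ∀ w : L2 P.region, ∫⁻ x in P.region, ‖w x‖ₑ ^ 2 ≠ ⊤ := fun w => by
      rw [← eLpNorm_two_sq]
      exact ENNReal.pow_ne_top (Lp.eLpNorm_ne_top w)
    rw [lintegral_add_left' ((Lp.aestronglyMeasurable v).enorm.pow_const 2),
      lintegral_finsetSum' _ fun i _ => (Lp.aestronglyMeasurable (G i)).enorm.pow_const 2]
    exact ENNReal.add_ne_top.2 ⟨hsq v, ENNReal.sum_ne_top.2 fun i _ => hsq (G i)⟩
  simp only [tendsto_eLpNorm_two_iff] at hu0 hu1 hu2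
  have hu3 : ∀ e, Tendsto (fun n => ∫⁻ t in Icc (0 : ℝ) 1, ‖u n (P.edgePath ℝ e t)‖ₑ ^ 2)
      atTop (𝓝 0) := fun e => by
    refine (hu2 e).congr fun n => setLIntegral_congr_fun measurableSet_Icc fun t ht => ?_
    simp only [hg0 e t ht, sub_zero]
  have hsum : Tendsto (fun n => (∫⁻ x in P.region, ‖u n x - v x‖ₑ ^ 2) +
      (∑ i, ∫⁻ x in P.region, ‖pd i (u n) x - G i x‖ₑ ^ 2) +
      ∑ e, ∫⁻ t in Icc (0 : ℝ) 1, ‖u n (P.edgePath ℝ e t)‖ₑ ^ 2) atTop (𝓝 0) := by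
    have := (hu0.add (tendsto_finsetSum Finset.univ fun i _ => hu1 i)).add
      (tendsto_finsetSum Finset.univ fun e _ => hu3 e)
    simpa using this
  have key : ∀ ε : ENNReal, ε ≠ 0 → ∃ ψ, IsTestFun P.region ψ ∧
      (∫⁻ x in P.region, ‖ψ x - v x‖ₑ ^ 2) +
        ∑ i, ∫⁻ x in P.region, ‖pd i ψ x - G i x‖ₑ ^ 2 ≤ ε := by
    intro ε hε
    have hε2 : ε / 2 ≠ 0 := (ENNReal.half_pos hε).ne'
    -- The order of choices matters: first a collar so thin that `v` and `G` are negligible on it,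
    -- then, with `l` and thus `B` fixed, an index `n`.
    obtain ⟨l, hl, hl1, hlε⟩ := exists_lintegral_collar_le hr hs hF
      (ε := ε / 2 / (C + 1)) (ENNReal.div_ne_zero.2 ⟨hε2, by finiteness⟩)
    obtain ⟨B, hB, hest⟩ := hcut l hl hl1
    have hlim := ENNReal.Tendsto.const_mul hsum (Or.inr hB)
    rw [mul_zero] at hlim
    obtain ⟨n, hn⟩ := (hlim.eventually (Iic_mem_nhds (pos_iff_ne_zero.2 hε2))).exists
    obtain ⟨ψ, hψ, hle⟩ := hest (u n) (hu n) v G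
    refine ⟨ψ, hψ, hle.trans ?_⟩
    calc _ ≤ ε / 2 + (C + 1) * (ε / 2 / (C + 1)) :=
          add_le_add hn (mul_le_mul' le_self_add hlε)
      _ = ε := by
          rw [ENNReal.mul_div_cancel (by simp) (by finiteness), ENNReal.add_halves]
  choose ψ hψ hψε using fun n : ℕ => key ((n : ENNReal) + 1)⁻¹ (by simp)
  have hlim : Tendsto (fun n : ℕ => ((n : ENNReal) + 1)⁻¹) atTop (𝓝 0) := by
    have := (tendsto_add_atTop_iff_nat 1).2 ENNReal.tendsto_inv_nat_nhds_zero
    simpa using this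
  let z : SobolevTriple P.region := WithLp.toLp 2 (Fin.cons v G)
  refine ⟨z, (mem_sobolevZero_iff P.isBounded_region z).2 ⟨ψ, hψ, ?_, fun i => ?_⟩, rfl⟩
  · rw [tendsto_eLpNorm_two_iff]
    exact tendsto_of_tendsto_of_tendsto_of_le_of_le tendsto_const_nhds hlim (fun _ => zero_le)
      fun n => le_self_add.trans (hψε n)
  · rw [tendsto_eLpNorm_two_iff]
    refine tendsto_of_tendsto_of_tendsto_of_le_of_le tendsto_const_nhds hlim (fun _ => zero_le)
      fun n => le_trans ?_ (hψε n)
    exact (Finset.single_le_sum (f := fun i => ∫⁻ x in P.region, ‖pd i (ψ n) x - G i x‖ₑ ^ 2)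
      (fun _ _ => zero_le) (Finset.mem_univ i)).trans le_add_self

end PolygonalElement

/-! ### Bivariate polynomials -/

lemma mem_polyLT {m : ℕ} {p : MvPolynomial (Fin 2) ℝ} :
    p ∈ polyLT m ↔ ∀ s, MvPolynomial.coeff s p ≠ 0 → s.degree < m := by
  rw [polyLT, MvPolynomial.mem_restrictSupport_iff]
  exact ⟨fun h s hs => h (MvPolynomial.mem_support_iff.2 hs),
    fun h s hs => h s (MvPolynomial.mem_support_iff.1 hs)⟩

lemma polyLT_mono {m n : ℕ} (h : m ≤ n) : polyLT m ≤ polyLT n := fun _ hp =>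
  mem_polyLT.2 fun s hs => (mem_polyLT.1 hp s hs).trans_le h

lemma pderiv_mem_polyLT {m : ℕ} {p : MvPolynomial (Fin 2) ℝ} (hp : p ∈ polyLT m) (i : Fin 2) :
    MvPolynomial.pderiv i p ∈ polyLT (m - 1) := by
  refine mem_polyLT.2 fun s hs => ?_
  rw [MvPolynomial.coeff_pderiv] at hs
  have h := mem_polyLT.1 hp _ (left_ne_zero_of_mul hs)
  rw [map_add, Finsupp.degree_single] at h
  omega

lemma C_mem_polyLT {m : ℕ} (hm : 0 < m) (a : ℝ) :
    (MvPolynomial.C a : MvPolynomial (Fin 2) ℝ) ∈ polyLT m := by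
  refine mem_polyLT.2 fun s hs => ?_
  rw [MvPolynomial.coeff_C] at hs
  obtain rfl : 0 = s := by by_contra h; simp [h] at hs
  simpa using hm

lemma eq_C_of_pderiv_eq_zero {p : MvPolynomial (Fin 2) ℝ}
    (h : ∀ i, MvPolynomial.pderiv i p = 0) : ∃ a, p = MvPolynomial.C a := by
  refine ⟨MvPolynomial.coeff 0 p, ?_⟩
  ext s
  rw [MvPolynomial.coeff_C]
  split_ifs with hs
  · rw [hs]
  · obtain ⟨i, hi⟩ : ∃ i, s i ≠ 0 := by
      by_contra! h0
      exact hs (Finsupp.ext fun i => (h0 i).symm)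
    have h1 := MvPolynomial.coeff_pderiv p (s - Finsupp.single i 1) (i := i)
    rw [h i, MvPolynomial.coeff_zero, tsub_add_cancel_of_le
      (Finsupp.single_le_iff.2 (Nat.one_le_iff_ne_zero.2 hi)), eq_comm, mul_eq_zero] at h1
    exact h1.resolve_right (by positivity)

instance finiteDimensional_polyLT (m : ℕ) : FiniteDimensional ℝ (polyLT m) := by
  have hfin : Finite {s : Fin 2 →₀ ℕ | s.degree < m} := by
    refine Set.Finite.subset (Set.finite_Iic (Finsupp.equivFunOnFinite.symm fun _ => m)) ?_
    intro s hs i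
    exact (Finsupp.le_degree i s).trans (le_of_lt hs)
  exact Module.Basis.finiteDimensional_of_finite
    (MvPolynomial.basisRestrictSupport ℝ {s : Fin 2 →₀ ℕ | s.degree < m})

lemma pval_C (a : ℝ) (x : Plane) : pval (MvPolynomial.C a) x = a := by simp [pval]

lemma contDiff_pval (p : MvPolynomial (Fin 2) ℝ) : ContDiff ℝ (⊤ : ℕ∞) (pval p) := by
  induction p using MvPolynomial.induction_on with
  | C a =>
    have : pval (MvPolynomial.C a) = fun _ => a := funext (pval_C a)
    rw [this]; exact contDiff_const
  | add p q hp hq =>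
    have : pval (p + q) = fun x => pval p x + pval q x := by funext x; simp [pval]
    rw [this]; exact hp.add hq
  | mul_X p i hp =>
    have : pval (p * MvPolynomial.X i) = fun x => pval p x * x i := by funext x; simp [pval]
    rw [this]; exact hp.mul (by fun_prop)

lemma pd_pval (i : Fin 2) (p : MvPolynomial (Fin 2) ℝ) (x : Plane) :
    pd i (pval p) x = pval (MvPolynomial.pderiv i p) x := by
  induction p using MvPolynomial.induction_on with
  | C a =>
    have : pval (MvPolynomial.C a) = fun _ => a := funext (pval_C a)
    rw [this, MvPolynomial.pderiv_C, pval_zero]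
    simp [pd]
  | add p q hp hq =>
    have : pval (p + q) = fun x => 1 * pval p x + pval q x := by funext x; simp [pval]
    rw [this, pd_lin i 1 ((contDiff_pval p).differentiable (by simp))
      ((contDiff_pval q).differentiable (by simp)), hp, hq]
    simp [pval]
  | mul_X p j hp =>
    have : pval (p * MvPolynomial.X j) = fun x => pval p x * x j := by funext x; simp [pval]
    have hj : HasFDerivAt (fun p : Plane => p j) (EuclideanSpace.proj j : Plane →L[ℝ] ℝ) x :=
      (EuclideanSpace.proj j : Plane →L[ℝ] ℝ).hasFDerivAt
    have hpj : pd i (fun y : Plane => y j) x = if i = j then 1 else 0 := by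
      rw [pd, hj.fderiv]
      simp [eq_comm]
    rw [this, pd_mul i ((contDiff_pval p).differentiable (by simp)) (by fun_prop), hp, hpj,
      MvPolynomial.pderiv_mul, MvPolynomial.pderiv_X]
    by_cases hij : i = j <;> simp [pval, add_comm, eq_comm, hij]

/-- An open set contains a product of intervals, and a polynomial vanishing on a product of infinite
sets is zero. -/
lemma eq_zero_of_pval_eq_zero {U : Set Plane} (ho : IsOpen U) (hne : U.Nonempty)
    {p : MvPolynomial (Fin 2) ℝ} (h : ∀ x ∈ U, pval p x = 0) : p = 0 := by
  obtain ⟨x, hx⟩ := hne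
  have ho' : IsOpen ((WithLp.toLp 2 : (Fin 2 → ℝ) → Plane) ⁻¹' U) :=
    ho.preimage (PiLp.continuous_toLp 2 _)
  obtain ⟨I, s, hs, hsub⟩ := isOpen_pi_iff.1 ho' x.ofLp hx
  obtain ⟨ε, hε, hball⟩ := Metric.isOpen_iff.1 ho' x.ofLp hx
  refine MvPolynomial.funext_set (fun i => Metric.ball (x i) ε) (fun i => ?_) fun y hy => ?_
  · rw [Real.ball_eq_Ioo]
    exact Set.Ioo_infinite (by linarith)
  · have hy' : y ∈ Metric.ball x.ofLp ε := by
      rw [ball_pi _ hε]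
      exact hy
    simpa [pval] using h (WithLp.toLp 2 y) (hball hy')

lemma eq_zero_of_pval_ae_eq_zero {U : Set Plane} (ho : IsOpen U) (hne : U.Nonempty)
    {p : MvPolynomial (Fin 2) ℝ} (h : pval p =ᵐ[volume.restrict U] 0) : p = 0 :=
  eq_zero_of_pval_eq_zero ho hne fun _ hx =>
    Measure.eqOn_open_of_ae_eq h ho (continuous_pval p).continuousOn continuousOn_const hx

lemma HasLaplacian.eq_zero {U : Set Plane} (ho : IsOpen U) (hne : U.Nonempty)
    {p : MvPolynomial (Fin 2) ℝ} (h : HasLaplacian U 0 p) : p = 0 := by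
  refine eq_zero_of_pval_ae_eq_zero ho hne ?_
  refine (ae_restrict_iff' ho.measurableSet).2 ?_
  refine ho.ae_eq_zero_of_integral_contDiff_smul_eq_zero
    ((continuous_pval p).locallyIntegrable.locallyIntegrableOn _) fun g hg hgc hgs => ?_
  have h1 := h g ⟨hg, hgc, hgs⟩
  rw [L2.integral_zero_mul] at h1
  rw [h1, setIntegral_eq_integral_of_forall_compl_eq_zero]
  · simp only [smul_eq_mul, mul_comm]
  · intro x hx
    rw [image_eq_zero_of_notMem_tsupport fun h' => hx (hgs h'), mul_zero]

/-! ### The Dirichlet problem with prescribed moments -/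

namespace PolygonalElement

variable {P : PolygonalElement N}

variable (P) in
/-- Moments of a function against polynomials. -/
def moment (v : L2 P.region) : MvPolynomial (Fin 2) ℝ →ₗ[ℝ] ℝ where
  toFun q := ∫ x in P.region, v x * pval q x
  map_add' p q := by
    rw [← integral_add
      (L2.integrable_mul P.isOpen_region P.isBounded_region v (continuous_pval p))
      (L2.integrable_mul P.isOpen_region P.isBounded_region v (continuous_pval q))]
    simp only [pval, map_add, mul_add]
  map_smul' a p := by
    rw [RingHom.id_apply, smul_eq_mul, ← integral_const_mul]
    refine integral_congr_ae (Eventually.of_forall fun x => ?_)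
    simp only [pval, MvPolynomial.smul_eval]
    ring

lemma moment_apply (v : L2 P.region) (q : MvPolynomial (Fin 2) ℝ) :
    P.moment v q = ∫ x in P.region, v x * pval q x := rfl

lemma moment_lin (a : ℝ) (v w : L2 P.region) :
    P.moment (a • v + w) = a • P.moment v + P.moment w := by
  refine LinearMap.ext fun q => ?_
  exact L2.integral_lin P.isOpen_region P.isBounded_region a v w (continuous_pval q)

/-- The central uniqueness argument: `v` lies in `H¹₀`, so Green's formula may be tested with `v`
itself. It gives `∫ |∇v|² = - ∫ v p`, where `p` is one of the polynomials orthogonal to `v`;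
Poincaré's inequality concludes. -/
lemma eq_zero_of_moment_eq_zero {v : L2 P.region} {g : Plane → ℝ} {p : MvPolynomial (Fin 2) ℝ}
    {n : ℕ} (hv : HasContTrace P v g)
    (hg : ∀ e, ∀ t ∈ Icc (0 : ℝ) 1, g (P.edgePath ℝ e t) = 0) (hp : HasLaplacian P.region v p)
    (hpn : p ∈ polyLT n) (hm : ∀ q ∈ polyLT n, P.moment v q = 0) : v = 0 := by
  obtain ⟨z, hz, rfl⟩ := mem_sobolevZero_of_trace_eq_zero hv hg
  have h := sobolevZero_green P.isOpen_region P.isBounded_region hz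
    (sobolevZero_hasWeakGrad P.isBounded_region hz) hp
  rw [← moment_apply, hm p hpn, neg_zero] at h
  obtain ⟨C, -, hC⟩ := exists_poincare P.isOpen_region P.isBounded_region
  have h2 := hC z hz
  simp only [real_inner_self_eq_norm_sq] at h
  rw [h, mul_zero] at h2
  have := pow_eq_zero_iff (two_ne_zero) |>.1 (le_antisymm h2 (sq_nonneg ‖z 0‖))
  exact norm_eq_zero.1 this

/-- A lifting of `g` is corrected in `H¹₀`, which leaves the trace unchanged. -/
lemma exists_hasLaplacian {g : Plane → ℝ} {K : NNReal} (hg : LipschitzWith K g)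
    (p : MvPolynomial (Fin 2) ℝ) : ∃ v, HasContTrace P v g ∧ HasLaplacian P.region v p := by
  have ho := P.isOpen_region
  have hb := P.isBounded_region
  obtain ⟨v, hv⟩ := exists_hasContTrace_of_lipschitz P hg
  obtain ⟨F, hF⟩ : ∃ F, HasWeakGrad P.region v F := let ⟨_, F, hF, _⟩ := hv; ⟨F, hF⟩
  have hpl := memLp_cont hb (continuous_pval p)
  -- With data `-y` the correction satisfies `∫ ∇z·∇w = - ∫ p w - ∫ F·∇w`, the weak form of `Δ(v +
  -- z) = p`.
  let y : SobolevTriple P.region := WithLp.toLp 2 (Fin.cons (hpl.toLp _) F)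
  obtain ⟨z, hz, hzw⟩ := exists_dirichlet_solution ho hb (-y)
  have hsum : HasWeakGrad P.region ((1 : ℝ) • v + z 0) ((1 : ℝ) • F + fun i => z i.succ) :=
    hF.lin ho hb 1 (sobolevZero_hasWeakGrad hb hz)
  refine ⟨(1 : ℝ) • v + z 0, ?_, fun φ hφ => ?_⟩
  · have := hv.lin 1 (sobolevZero_hasContTrace P hz)
    simpa using this
  · obtain ⟨w, hw, h0, h1⟩ := hφ.exists_testSpace hb
    have e : ∀ i : Fin 2, ∫ x in P.region, ((1 : ℝ) • v + z 0 : L2 P.region) x * pd i (pd i φ) x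
        = - (inner ℝ (F i) (w i.succ) + inner ℝ (z i.succ) (w i.succ)) := by
      intro i
      rw [hsum i _ (hφ.pd i), ← inner_add_left, L2.inner_eq]
      simp only [Pi.add_apply, one_smul]
      congr 1
      refine integral_congr_ae ?_
      filter_upwards [h1 i] with x hx
      rw [hx]
    have hy : inner ℝ y w = (∫ x in P.region, pval p x * φ x) +
        ∑ i : Fin 2, inner ℝ (F i) (w i.succ) := by
      rw [PiLp.inner_apply, Fin.sum_univ_succ]
      congr 1
      change inner ℝ (hpl.toLp _) (w 0) = _
      rw [L2.inner_eq]
      refine integral_congr_ae ?_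
      filter_upwards [h0, hpl.coeFn_toLp] with x hx hx'
      rw [hx, hx']
    have hz' := hzw w (Submodule.le_topologicalClosure _ hw)
    rw [inner_neg_left, hy] at hz'
    simp only [Finset.mul_sum]
    rw [integral_finsetSum _ fun i _ =>
      L2.integrable_mul ho hb _ (continuous_pd i (contDiff_pd i hφ.1))]
    simp only [e]
    rw [Finset.sum_neg_distrib, Finset.sum_add_distrib, hz']
    ring

lemma lipschitzWith_zero_fun : LipschitzWith 0 fun _ : Plane => (0 : ℝ) := LipschitzWith.const 0

/-- The Laplacian is free to vary in the space against which the moments are taken. The map from a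
polynomial to the moments of the zero-trace solution is injective by uniqueness, hence onto by
dimension. Adding a suitable zero-trace solution to the harmonic function with trace `g` then
adjusts its moments. -/
lemma exists_laplacian_moment {g : Plane → ℝ} {K : NNReal} (hg : LipschitzWith K g) (n : ℕ)
    (m : Module.Dual ℝ (polyLT n)) : ∃ v, ∃ p ∈ polyLT n, HasContTrace P v g ∧
      HasLaplacian P.region v p ∧ ∀ q : polyLT n, P.moment v q = m q := by
  have ho := P.isOpen_region
  have hb := P.isBounded_region
  choose w hw hwl using fun p : MvPolynomial (Fin 2) ℝ =>
    exists_hasLaplacian (P := P) lipschitzWith_zero_fun p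
  -- The solutions are chosen one by one; their linearity follows from uniqueness. The difference is
  -- harmonic with zero trace, so `n := 0` applies, where `polyLT 0` is `{0}` and no moment has to
  -- be checked.
  have hlin : ∀ (a : ℝ) (p q : MvPolynomial (Fin 2) ℝ), w (a • p + q) = a • w p + w q := by
    intro a p q
    have h1 := (hw (a • p + q)).lin (-1) ((hw p).lin a (hw q))
    have h2 := (hwl (a • p + q)).lin ho hb (-1) ((hwl p).lin ho hb a (hwl q))
    rw [show (-1 : ℝ) • (a • p + q) + (a • p + q) = 0 by module] at h2
    have := eq_zero_of_moment_eq_zero (n := 0) h1 (fun _ _ _ => by simp) h2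
      (Submodule.zero_mem _) fun r hr => by
        obtain rfl : r = 0 := by
          ext s
          by_contra hs
          exact absurd (mem_polyLT.1 hr s hs) (Nat.not_lt_zero _)
        exact map_zero _
    rw [neg_one_smul, neg_add_eq_zero] at this
    exact this
  let T : polyLT n →ₗ[ℝ] Module.Dual ℝ (polyLT n) :=
    { toFun := fun p => (P.moment (w p)).domRestrict (polyLT n)
      map_add' := fun p q => by
        have h := hlin 1 (p : MvPolynomial (Fin 2) ℝ) q
        rw [one_smul, one_smul] at h
        ext r
        simp only [Submodule.coe_add, h, LinearMap.domRestrict_apply, LinearMap.add_apply]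
        have := moment_lin 1 (w p) (w q)
        rw [one_smul, one_smul] at this
        rw [this, LinearMap.add_apply]
      map_smul' := fun a p => by
        have hw0 : w 0 = 0 := by
          have := hlin (-1) 0 0
          simpa using this
        have h := hlin a (p : MvPolynomial (Fin 2) ℝ) 0
        rw [add_zero, hw0, add_zero] at h
        have h0 : P.moment 0 = 0 := by
          have := moment_lin (P := P) (-1) 0 0
          simpa using this
        ext r
        have := moment_lin a (w p) 0
        rw [h0, add_zero, add_zero] at this
        simp only [Submodule.coe_smul, h, LinearMap.domRestrict_apply, this, RingHom.id_apply,
          LinearMap.smul_apply] }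
  have hinj : Function.Injective T := by
    rw [← LinearMap.ker_eq_bot, LinearMap.ker_eq_bot']
    intro p hp
    have h0 : w p = 0 := eq_zero_of_moment_eq_zero (hw p) (fun _ _ _ => rfl) (hwl p) p.2
      fun q hq => LinearMap.congr_fun hp ⟨q, hq⟩
    have h1 := hwl p
    rw [h0] at h1
    exact Subtype.ext (h1.eq_zero ho P.isConnected_region.nonempty)
  have hsurj : Function.Surjective T :=
    (LinearMap.injective_iff_surjective_of_finrank_eq_finrank Subspace.dual_finrank_eq.symm).1 hinj
  obtain ⟨v, hv, hvl⟩ := exists_hasLaplacian (P := P) hg 0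
  obtain ⟨p, hp⟩ := hsurj (m - (P.moment v).domRestrict (polyLT n))
  refine ⟨(1 : ℝ) • v + w p, p, p.2, ?_, ?_, fun q => ?_⟩
  · simpa using hv.lin 1 (hw p)
  · simpa using hvl.lin ho hb 1 (hwl p)
  · have := LinearMap.congr_fun hp q
    simp only [T, LinearMap.coe_mk, AddHom.coe_mk, LinearMap.domRestrict_apply,
      LinearMap.sub_apply] at this
    rw [moment_lin, one_smul, LinearMap.add_apply, this]
    ring

end PolygonalElement

/-! ### The elliptic projection -/

namespace PolygonalElement

variable {P : PolygonalElement N}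

variable (P) in
/-- The integral over the boundary. -/
def bdryInt (g : Plane → ℝ) : ℝ :=
  ∑ e, dist (P.vertices e) (P.vertices (finRotate N e)) *
    ∫ t in Icc (0 : ℝ) 1, g (P.edgePath ℝ e t)

lemma bdryInt_lin (a : ℝ) {g h : Plane → ℝ} (hg : ContinuousOn g (P.boundary ℝ))
    (hh : ContinuousOn h (P.boundary ℝ)) :
    P.bdryInt (fun x => a * g x + h x) = a * P.bdryInt g + P.bdryInt h := by
  have hi : ∀ {f : Plane → ℝ} (e : Fin N), ContinuousOn f (P.boundary ℝ) →
      Integrable (fun t : ℝ => f (P.edgePath ℝ e t)) (volume.restrict (Icc 0 1)) := fun e hf =>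
    (continuousOn_edge hf e).integrableOn_compact isCompact_Icc
  rw [bdryInt, bdryInt, bdryInt, Finset.mul_sum, ← Finset.sum_add_distrib]
  refine Finset.sum_congr rfl fun e _ => ?_
  rw [integral_add ((hi e hg).const_mul a) (hi e hh), integral_const_mul]
  ring

lemma bdryInt_const_pos {a : ℝ} (h : P.bdryInt (fun _ => a) = 0) : a = 0 := by
  simp only [bdryInt, integral_const, measureReal_restrict_apply_univ, Real.volume_real_Icc,
    sub_zero, max_eq_left zero_le_one, one_smul, ← Finset.sum_mul] at h
  refine (mul_eq_zero.1 h).resolve_left (ne_of_gt (Finset.sum_pos (fun e _ => ?_) ?_))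
  · rw [dist_comm, dist_pos]
    exact sub_ne_zero.1 (P.edge_ne_zero e)
  · have := P.three_le
    exact ⟨⟨0, by omega⟩, Finset.mem_univ _⟩

variable (P) in
/-- The integral over the boundary of a polynomial. -/
def bdryIntPoly : MvPolynomial (Fin 2) ℝ →ₗ[ℝ] ℝ where
  toFun p := P.bdryInt (pval p)
  map_add' p q := by
    have h := bdryInt_lin (P := P) 1 (continuous_pval p).continuousOn (continuous_pval q).continuousOn
    simp only [one_mul] at h
    rw [← h]
    congr 1
    funext x
    simp [pval]
  map_smul' a p := by
    have h := bdryInt_lin (P := P) a (continuous_pval p).continuousOn (continuous_pval 0).continuousOn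
    simp only [← pval_lin] at h
    rw [add_zero, show P.bdryInt (pval 0) = 0 by simp [bdryInt, pval_zero], add_zero] at h
    exact h

variable (P) in
/-- Integrals of the scalar product of a gradient and the gradient of a polynomial. -/
def gradMoment (G : Fin 2 → L2 P.region) : MvPolynomial (Fin 2) ℝ →ₗ[ℝ] ℝ :=
  ∑ i, (P.moment (G i)).comp (MvPolynomial.pderiv i : Derivation ℝ _ _).toLinearMap

lemma gradMoment_apply (G : Fin 2 → L2 P.region) (q : MvPolynomial (Fin 2) ℝ) :
    P.gradMoment G q = ∑ i, P.moment (G i) (MvPolynomial.pderiv i q) := by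
  simp [gradMoment]

variable (P) in
/-- The element of `L²(P)` given by a polynomial. -/
def polyL2 : MvPolynomial (Fin 2) ℝ →ₗ[ℝ] L2 P.region where
  toFun p := (memLp_cont P.isBounded_region (continuous_pval p)).toLp (pval p)
  map_add' p q := by
    rw [← MemLp.toLp_add]
    congr 1
    funext x
    simp [pval]
  map_smul' a p := by
    rw [RingHom.id_apply, ← MemLp.toLp_const_smul]
    congr 1
    funext x
    simp [pval, MvPolynomial.smul_eval]

lemma coeFn_polyL2 (p : MvPolynomial (Fin 2) ℝ) :
    P.polyL2 p =ᵐ[volume.restrict P.region] pval p :=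
  (memLp_cont P.isBounded_region (continuous_pval p)).coeFn_toLp

lemma integral_grad_sub (G : Fin 2 → L2 P.region) (p q : MvPolynomial (Fin 2) ℝ) :
    ∫ x in P.region, ∑ i, (G i x - pval (MvPolynomial.pderiv i p) x) *
      pval (MvPolynomial.pderiv i q) x =
    P.gradMoment G q - P.gradMoment (fun i => P.polyL2 (MvPolynomial.pderiv i p)) q := by
  have ho := P.isOpen_region
  have hb := P.isBounded_region
  have hint : ∀ (v : L2 P.region) (q : MvPolynomial (Fin 2) ℝ),
      Integrable (fun x => v x * pval q x) (volume.restrict P.region) := fun v q =>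
    L2.integrable_mul ho hb v (continuous_pval q)
  rw [gradMoment_apply, gradMoment_apply, ← Finset.sum_sub_distrib]
  simp only [moment_apply]
  have hd : ∀ i : Fin 2, Integrable (fun x => G i x * pval (MvPolynomial.pderiv i q) x -
      P.polyL2 (MvPolynomial.pderiv i p) x * pval (MvPolynomial.pderiv i q) x)
      (volume.restrict P.region) := fun i => (hint (G i) _).sub (hint _ _)
  rw [Finset.sum_congr rfl fun i _ => (integral_sub (hint (G i) _) (hint _ _)).symm,
    ← integral_finsetSum _ fun i _ => hd i]
  refine integral_congr_ae ?_
  filter_upwards [ae_all_iff.2 fun i => coeFn_polyL2 (P := P) (MvPolynomial.pderiv i p)] with x hx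
  refine Finset.sum_congr rfl fun i _ => ?_
  rw [hx i]
  ring

/-- Zero energy makes the polynomial constant, and zero mean over a boundary of positive length
makes the constant zero. -/
lemma eq_zero_of_gradMoment_self {p : MvPolynomial (Fin 2) ℝ}
    (h : P.gradMoment (fun i => P.polyL2 (MvPolynomial.pderiv i p)) p = 0)
    (hb : P.bdryInt (pval p) = 0) : p = 0 := by
  have hs : ∀ q, P.moment (P.polyL2 q) q = ‖P.polyL2 q‖ ^ 2 := fun q => by
    rw [← real_inner_self_eq_norm_sq, L2.inner_eq, moment_apply]
    refine integral_congr_ae ?_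
    filter_upwards [coeFn_polyL2 (P := P) q] with x hx
    rw [hx]
  rw [gradMoment_apply] at h
  simp only [hs] at h
  rw [Finset.sum_eq_zero_iff_of_nonneg fun i _ => sq_nonneg _] at h
  have hd : ∀ i, MvPolynomial.pderiv i p = 0 := fun i => by
    have h0 : P.polyL2 (MvPolynomial.pderiv i p) = 0 := by
      simpa using h i (Finset.mem_univ i)
    refine eq_zero_of_pval_ae_eq_zero P.isOpen_region P.isConnected_region.nonempty ?_
    have h1 := coeFn_polyL2 (P := P) (MvPolynomial.pderiv i p)
    rw [h0] at h1
    exact h1.symm.trans (L2.coe_zero _)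
  obtain ⟨a, rfl⟩ := eq_C_of_pderiv_eq_zero hd
  have ha : pval (MvPolynomial.C a) = fun _ => a := funext (pval_C a)
  rw [ha] at hb
  rw [bdryInt_const_pos hb, map_zero]

lemma bdryInt_sub {g : Plane → ℝ} (hg : ContinuousOn g (P.boundary ℝ))
    (p : MvPolynomial (Fin 2) ℝ) :
    ∑ e, dist (P.vertices e) (P.vertices (finRotate N e)) *
      ∫ t in Icc (0 : ℝ) 1, (g (P.edgePath ℝ e t) - pval p (P.edgePath ℝ e t)) =
    P.bdryInt g - P.bdryInt (pval p) := by
  have h := bdryInt_lin (P := P) (-1) (continuous_pval p).continuousOn hg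
  have e : ∀ x, -1 * pval p x + g x = g x - pval p x := fun x => by ring
  simp only [e] at h
  rw [sub_eq_neg_add, ← neg_one_mul, ← h]
  rfl

/-- Both defining conditions are encoded in the form `∫ ∇p·∇q + (∫_{∂P} p)(∫_{∂P} q)`, which is
positive definite on `ℙ_k`, so that every functional is represented. -/
lemma exists_isEllipticProj {v : L2 P.region} {g : Plane → ℝ} (hv : HasContTrace P v g) (k : ℕ) :
    ∃ p, IsEllipticProj P k v p := by
  obtain ⟨G, hG⟩ : ∃ G, HasWeakGrad P.region v G := let ⟨_, G, hG, _⟩ := hv; ⟨G, hG⟩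
  let W := polyLT (k + 1)
  let T : W →ₗ[ℝ] Module.Dual ℝ W :=
    { toFun := fun p => (P.gradMoment (fun i => P.polyL2 (MvPolynomial.pderiv i p)) +
        P.bdryIntPoly p • P.bdryIntPoly).domRestrict W
      map_add' := fun p q => by
        ext r
        simp only [LinearMap.domRestrict_apply, LinearMap.add_apply, gradMoment_apply,
          Submodule.coe_add, map_add, LinearMap.smul_apply, smul_eq_mul]
        simp only [fun v w : L2 P.region => by simpa using moment_lin 1 v w, LinearMap.add_apply,
          Finset.sum_add_distrib]
        ring
      map_smul' := fun a p => by
        have h0 : P.moment 0 = 0 := by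
          have := moment_lin (P := P) (-1) 0 0
          simpa using this
        ext r
        simp only [LinearMap.domRestrict_apply, LinearMap.add_apply, gradMoment_apply,
          Submodule.coe_smul, map_smul, Derivation.map_smul, LinearMap.smul_apply, smul_eq_mul,
          RingHom.id_apply]
        simp only [fun v : L2 P.region => by simpa [h0] using moment_lin a v 0,
          LinearMap.smul_apply, smul_eq_mul, ← Finset.mul_sum]
        ring }
  have hTa : ∀ p q : W, T p q = P.gradMoment (fun i => P.polyL2 (MvPolynomial.pderiv i p)) q +
      P.bdryInt (pval p) * P.bdryInt (pval q) := fun p q => rfl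
  have hgm : ∀ q, 0 ≤ P.gradMoment (fun i => P.polyL2 (MvPolynomial.pderiv i q)) q := fun q => by
    rw [gradMoment_apply]
    refine Finset.sum_nonneg fun i _ => ?_
    rw [moment_apply]
    refine integral_nonneg_of_ae ?_
    filter_upwards [coeFn_polyL2 (P := P) (MvPolynomial.pderiv i q)] with x hx
    rw [hx]
    exact mul_self_nonneg _
  have hinj : Function.Injective T := by
    rw [← LinearMap.ker_eq_bot, LinearMap.ker_eq_bot']
    intro p hp
    have h := LinearMap.congr_fun hp p
    rw [hTa, LinearMap.zero_apply] at h
    have h1 := hgm p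
    have h2 := mul_self_nonneg (P.bdryInt (pval p))
    exact Subtype.ext (eq_zero_of_gradMoment_self (by linarith)
      (mul_self_eq_zero.1 (by linarith)))
  have hsurj : Function.Surjective T :=
    (LinearMap.injective_iff_surjective_of_finrank_eq_finrank Subspace.dual_finrank_eq.symm).1 hinj
  obtain ⟨p, hp⟩ := hsurj ((P.gradMoment G + P.bdryInt g • P.bdryIntPoly).domRestrict W)
  have hpq : ∀ q ∈ W, P.gradMoment (fun i => P.polyL2 (MvPolynomial.pderiv i p)) q +
      P.bdryInt (pval p) * P.bdryInt (pval q) = P.gradMoment G q + P.bdryInt g * P.bdryInt (pval q) :=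
    fun q hq => LinearMap.congr_fun hp ⟨q, hq⟩
  -- Testing with `q = 1` isolates the boundary means; once they agree, the extra product cancels
  -- for every other `q`.
  have hmean : P.bdryInt (pval p) = P.bdryInt g := by
    have h := hpq (MvPolynomial.C 1) (C_mem_polyLT (Nat.succ_pos k) 1)
    simp only [gradMoment_apply, MvPolynomial.pderiv_C, map_zero, Finset.sum_const_zero,
      zero_add] at h
    refine mul_right_cancel₀ (fun h0 => ?_) h
    have h1 : pval (MvPolynomial.C 1) = fun _ => 1 := funext (pval_C 1)
    rw [h1] at h0
    exact one_ne_zero (bdryInt_const_pos h0)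
  refine ⟨p, p.2, ⟨G, hG, fun q hq => ?_⟩, g, hv, ?_⟩
  · have h := hpq q hq
    rw [hmean] at h
    rw [integral_grad_sub]
    linarith
  · rw [bdryInt_sub hv.1, hmean, sub_self]

/-- The gradient and the trace in the definition are quantified existentially, so their uniqueness
for the zero function is needed first. What remains is a polynomial with zero energy and zero
boundary mean. -/
lemma eq_zero_of_isEllipticProj_zero {k : ℕ} {p : MvPolynomial (Fin 2) ℝ}
    (h : IsEllipticProj P k 0 p) : p = 0 := by
  obtain ⟨hp, ⟨G, hG, hG'⟩, g, hg, hg'⟩ := h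
  obtain rfl := hG.eq_zero P.isOpen_region
  have h0 : P.moment 0 = 0 := by
    have := moment_lin (P := P) (-1) 0 0
    simpa using this
  have h1 := hG' p hp
  have h2 : P.gradMoment 0 p = 0 := by simp [gradMoment_apply, h0]
  rw [integral_grad_sub, h2, zero_sub, neg_eq_zero] at h1
  rw [bdryInt_sub hg.1] at hg'
  have hg0 : P.bdryInt g = 0 := Finset.sum_eq_zero fun e _ => by
    rw [setIntegral_congr_fun measurableSet_Icc fun t ht => trace_eq_zero hg e ht]
    simp
  rw [hg0, zero_sub, neg_eq_zero] at hg'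
  exact eq_zero_of_gradMoment_self h1 hg'

lemma isEllipticProj_unique {k : ℕ} {v : L2 P.region} {p q : MvPolynomial (Fin 2) ℝ}
    (hp : IsEllipticProj P k v p) (hq : IsEllipticProj P k v q) : p = q := by
  have h := hp.lin (-1) hq
  rw [show (-1 : ℝ) • v + v = 0 by module] at h
  have := eq_zero_of_isEllipticProj_zero h
  rw [neg_one_smul, neg_add_eq_zero] at this
  exact this

/-- The elliptic projection vanishes if the trace and the moments vanish. -/
lemma isEllipticProj_zero {k : ℕ} {v : L2 P.region} {g : Plane → ℝ} (hv : HasContTrace P v g)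
    (hg : ∀ e, ∀ t ∈ Icc (0 : ℝ) 1, g (P.edgePath ℝ e t) = 0)
    (hm : ∀ q ∈ polyLT (k - 1), P.moment v q = 0) : IsEllipticProj P k v 0 := by
  obtain ⟨z, hz, rfl⟩ := mem_sobolevZero_of_trace_eq_zero hv hg
  refine ⟨Submodule.zero_mem _, ⟨_, sobolevZero_hasWeakGrad P.isBounded_region hz, fun q hq => ?_⟩,
    g, hv, ?_⟩
  · rw [integral_grad_sub]
    have h2 : P.gradMoment (fun i => P.polyL2 (MvPolynomial.pderiv i 0)) q = 0 := by
      simp only [map_zero]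
      have h0 : P.moment 0 = 0 := by
        have := moment_lin (P := P) (-1) 0 0
        simpa using this
      simp [gradMoment_apply, h0]
    rw [h2, sub_zero, gradMoment_apply]
    refine Finset.sum_eq_zero fun i _ => ?_
    have h := sobolevZero_integral_mul_pd P.isBounded_region hz
      (contDiff_pval (MvPolynomial.pderiv i q)) i
    simp only [pd_pval] at h
    -- Two derivatives take `ℙ_k` to `ℙ_{k-2}`, against which the moments of `v` vanish.
    have h3 := hm _ (pderiv_mem_polyLT (pderiv_mem_polyLT hq i) i)
    rw [moment_apply, h, neg_eq_zero] at h3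
    exact h3
  · refine Finset.sum_eq_zero fun e _ => ?_
    rw [setIntegral_congr_fun (g := fun _ => (0 : ℝ)) measurableSet_Icc fun t ht => by
      simp only [hg e t ht, pval_zero, sub_zero]]
    simp

end PolygonalElement

/-! ### Edge polynomials -/

lemma integrable_poly_mul (p q : Polynomial ℝ) :
    Integrable (fun t => p.eval t * q.eval t) (volume.restrict (Icc (0 : ℝ) 1)) :=
  (p.continuous.mul q.continuous).continuousOn.integrableOn_compact isCompact_Icc

/-- The zeros at both ends give `p = t (t - 1) r`, where `r` has degree two less and may serve as
test polynomial. The weight `t (1 - t)` is positive inside the interval, so `∫ t (1 - t) r² = 0`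
forces `r = 0`. -/
lemma edgePoly_eq_zero {m : ℕ} {p : Polynomial ℝ} (hp : p ∈ Polynomial.degreeLT ℝ (m + 2))
    (h0 : p.eval 0 = 0) (h1 : p.eval 1 = 0)
    (hm : ∀ q ∈ Polynomial.degreeLT ℝ m, ∫ t in Icc (0 : ℝ) 1, p.eval t * q.eval t = 0) : p = 0 := by
  obtain ⟨s, rfl⟩ := Polynomial.X_dvd_iff.2 ((Polynomial.coeff_zero_eq_eval_zero p).trans h0)
  have hs : s.IsRoot 1 := by simpa using h1
  obtain ⟨r, rfl⟩ := Polynomial.dvd_iff_isRoot.2 hs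
  by_cases hr : r = 0
  · simp [hr]
  have hrm : r ∈ Polynomial.degreeLT ℝ m := by
    rw [Polynomial.mem_degreeLT, Polynomial.degree_mul, Polynomial.degree_mul, Polynomial.degree_X,
      Polynomial.degree_X_sub_C, Polynomial.degree_eq_natDegree hr] at hp
    rw [Polynomial.mem_degreeLT, Polynomial.degree_eq_natDegree hr]
    have : 1 + (1 + r.natDegree) < m + 2 := by exact_mod_cast hp
    exact_mod_cast (by omega : r.natDegree < m)
  have h := hm r hrm
  have hc : Continuous fun t : ℝ => t * (1 - t) * r.eval t ^ 2 := by
    have := r.continuous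
    fun_prop
  have h2 : ∫ t in Icc (0 : ℝ) 1, t * (1 - t) * r.eval t ^ 2 = 0 := by
    have e : ∫ t in Icc (0 : ℝ) 1, t * (1 - t) * r.eval t ^ 2 = -∫ t in Icc (0 : ℝ) 1,
        (Polynomial.X * ((Polynomial.X - Polynomial.C 1) * r)).eval t * r.eval t := by
      rw [← integral_neg]
      refine integral_congr_ae (Eventually.of_forall fun t => ?_)
      simp
      ring
    rw [e, h, neg_zero]
  rw [setIntegral_eq_zero_iff_of_nonneg_ae] at h2
  · have h3 := Measure.eqOn_Icc_of_ae_eq volume zero_ne_one h2 hc.continuousOn continuousOn_const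
    exfalso
    apply hr
    refine Polynomial.eq_zero_of_infinite_isRoot r
      ((Set.Ioo_infinite (zero_lt_one' ℝ)).mono fun t ht => ?_)
    have h4 := h3 (Ioo_subset_Icc_self ht)
    have h5 : t * (1 - t) ≠ 0 := (mul_pos ht.1 (by linarith [ht.2])).ne'
    simpa [h5] using h4
  · refine ae_restrict_of_forall_mem measurableSet_Icc fun t ht => ?_
    exact mul_nonneg (mul_nonneg ht.1 (by linarith [ht.2])) (sq_nonneg _)
  · exact hc.continuousOn.integrableOn_compact isCompact_Icc

lemma finrank_degreeLT (m : ℕ) : Module.finrank ℝ (Polynomial.degreeLT ℝ m) = m := by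
  rw [(Polynomial.degreeLTEquiv ℝ m).finrank_eq, Module.finrank_fin_fun]

instance finiteDimensional_degreeLT (m : ℕ) : FiniteDimensional ℝ (Polynomial.degreeLT ℝ m) :=
  (Polynomial.degreeLTEquiv ℝ m).symm.finiteDimensional

/-- Two end values and `m` moments are `m + 2` conditions, the dimension of the polynomial space, so
the injectivity just proved gives surjectivity. -/
lemma exists_edgePoly {m : ℕ} (a b : ℝ) (f : Module.Dual ℝ (Polynomial.degreeLT ℝ m)) :
    ∃ p ∈ Polynomial.degreeLT ℝ (m + 2), p.eval 0 = a ∧ p.eval 1 = b ∧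
      ∀ q : Polynomial.degreeLT ℝ m,
        ∫ t in Icc (0 : ℝ) 1, p.eval t * (q : Polynomial ℝ).eval t = f q := by
  let B : Polynomial ℝ →ₗ[ℝ] Polynomial ℝ →ₗ[ℝ] ℝ :=
    LinearMap.mk₂ ℝ (fun p q => ∫ t in Icc (0 : ℝ) 1, p.eval t * q.eval t)
      (fun p p' q => by
        rw [← integral_add (integrable_poly_mul p q) (integrable_poly_mul p' q)]
        simp [add_mul])
      (fun a p q => by
        rw [smul_eq_mul, ← integral_const_mul]
        simp [mul_assoc])
      (fun p q q' => by
        rw [← integral_add (integrable_poly_mul p q) (integrable_poly_mul p q')]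
        simp [mul_add])
      (fun a p q => by
        rw [smul_eq_mul, ← integral_const_mul]
        simp [mul_left_comm])
  let T : Polynomial.degreeLT ℝ (m + 2) →ₗ[ℝ]
      ℝ × ℝ × Module.Dual ℝ (Polynomial.degreeLT ℝ m) :=
    (((Polynomial.leval (0 : ℝ)).prod ((Polynomial.leval (1 : ℝ)).prod
      ((LinearMap.lcomp ℝ ℝ (Polynomial.degreeLT ℝ m).subtype).comp B)))).comp
        (Polynomial.degreeLT ℝ (m + 2)).subtype
  have hinj : Function.Injective T := by
    rw [← LinearMap.ker_eq_bot, LinearMap.ker_eq_bot']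
    intro p hp
    have h0 := congrArg Prod.fst hp
    have h1 := congrArg (fun x => x.2.1) hp
    have h2 := congrArg (fun x => x.2.2) hp
    exact Subtype.ext (edgePoly_eq_zero p.2 h0 h1 fun q hq => LinearMap.congr_fun h2 ⟨q, hq⟩)
  have hsurj : Function.Surjective T := by
    refine (LinearMap.injective_iff_surjective_of_finrank_eq_finrank ?_).1 hinj
    rw [Module.finrank_prod, Module.finrank_prod, Subspace.dual_finrank_eq, finrank_degreeLT,
      finrank_degreeLT, Module.finrank_self]
    ring
  obtain ⟨p, hp⟩ := hsurj (a, b, f)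
  have h0 := congrArg Prod.fst hp
  have h1 := congrArg (fun x => x.2.1) hp
  have h2 := congrArg (fun x => x.2.2) hp
  exact ⟨p, p.2, h0, h1, fun q => LinearMap.congr_fun h2 q⟩

/-! ### Lipschitz extension of piecewise polynomial boundary data -/

namespace PolygonalElement

variable {P : PolygonalElement N}

lemma finRotate_finRotate_ne (P : PolygonalElement N) (e : Fin N) :
    finRotate N (finRotate N e) ≠ e := by
  obtain ⟨n, rfl⟩ : ∃ n, N = n + 3 := ⟨N - 3, by have := P.three_le; omega⟩
  rw [finRotate_apply, finRotate_apply, add_assoc, Ne, add_eq_left, Fin.ext_iff, Fin.val_add]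
  simp [Nat.mod_eq_of_lt (show 2 < n + 2 + 1 by omega)]

/-- Near a common vertex, consecutive edges span a positive angle. -/
lemma exists_angle_bound (e : Fin N) : ∃ κ : ℝ, 0 < κ ∧ ∀ u ∈ Icc (0 : ℝ) 1, ∀ s ∈ Icc (0 : ℝ) 1,
    κ * (u + s) ≤
      dist (P.edgePath ℝ e (1 - u)) (P.edgePath ℝ (finRotate N e) s) := by
  set f := finRotate N e with hf
  set A := P.vertices f - P.vertices e with hA
  set B := P.vertices (finRotate N f) - P.vertices f with hB
  have hdist : ∀ u s : ℝ, dist (P.edgePath ℝ e (1 - u)) (P.edgePath ℝ f s) = ‖u • A + s • B‖ := by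
    intro u s
    rw [dist_comm, dist_eq_norm, edgePath_apply, edgePath_apply, ← hf, ← hA, ← hB]
    congr 1
    rw [hA]
    module
  -- A vanishing combination would be a common point of the two edges. It has to be their common
  -- vertex, as the other end points differ for `N ≥ 3`; then `u = 0` and the second edge would be
  -- degenerate.
  have hne : ∀ u ∈ Icc (0 : ℝ) 1, u • A + (1 - u) • B ≠ 0 := by
    intro u hu h0
    have h1 := hdist u (1 - u)
    rw [h0, norm_zero, dist_eq_zero] at h1
    have hu' : 1 - u ∈ Icc (0 : ℝ) 1 := ⟨by linarith [hu.2], by linarith [hu.1]⟩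
    have h2 := P.edges_inter e f (P.finRotate_ne e).symm
      ⟨⟨1 - u, hu', rfl⟩, ⟨1 - u, hu', h1.symm⟩⟩
    have h3 : AffineMap.lineMap (P.vertices e) (P.vertices f) (1 - u) = P.vertices f := by
      rcases h2.1 with h | h
      · rcases h2.2 with h' | h'
        · exact h'
        · rw [h, mem_singleton_iff] at h'
          exact absurd (P.vertices_injective h').symm (P.finRotate_finRotate_ne e)
      · exact h
    have h4 : P.edgePath ℝ e (1 - u) = P.vertices f := h3
    have hu0 : u = 0 := by
      rw [edgePath_apply, ← hf, ← hA, ← sub_eq_zero,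
        show P.vertices e + (1 - u) • A - P.vertices f = -(u • A) by rw [hA]; module,
        neg_eq_zero, smul_eq_zero] at h4
      exact h4.resolve_right (P.edge_ne_zero e)
    rw [hu0, zero_smul, zero_add, sub_zero, one_smul] at h0
    exact P.edge_ne_zero f h0
  -- By homogeneity in `(u, s)` it suffices to minimize over the compact segment `u + s = 1`.
  have hcont : Continuous fun u : ℝ => ‖u • A + (1 - u) • B‖ := by fun_prop
  obtain ⟨u₀, hu₀, hmin⟩ := isCompact_Icc.exists_isMinOn (nonempty_Icc.2 (zero_le_one' ℝ))
    hcont.continuousOn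
  refine ⟨‖u₀ • A + (1 - u₀) • B‖, norm_pos_iff.2 (hne u₀ hu₀), fun u hu s hs => ?_⟩
  rw [hdist]
  rcases eq_or_lt_of_le (add_nonneg hu.1 hs.1) with h | h
  · rw [← h, mul_zero]
    exact norm_nonneg _
  · have hm : ‖u₀ • A + (1 - u₀) • B‖ ≤ ‖(u / (u + s)) • A + (1 - u / (u + s)) • B‖ :=
      hmin (a := u / (u + s)) ⟨div_nonneg hu.1 h.le, (div_le_one h).2 (by linarith [hs.1])⟩
    have he : u • A + s • B = (u + s) • ((u / (u + s)) • A + (1 - u / (u + s)) • B) := by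
      rw [smul_add, smul_smul, smul_smul, mul_div_cancel₀ _ h.ne', mul_sub,
        mul_div_cancel₀ _ h.ne']
      simp
    rw [he, norm_smul, Real.norm_of_nonneg h.le, mul_comm]
    gcongr

lemma exists_poly_lipschitz (r : Fin N → Polynomial ℝ) : ∃ L : ℝ, 0 ≤ L ∧
    ∀ e, ∀ t ∈ Icc (0 : ℝ) 1, ∀ s ∈ Icc (0 : ℝ) 1, |(r e).eval t - (r e).eval s| ≤ L * |t - s| := by
  have h : ∀ e, ∃ L : ℝ, 0 ≤ L ∧ ∀ t ∈ Icc (0 : ℝ) 1, ∀ s ∈ Icc (0 : ℝ) 1,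
      |(r e).eval t - (r e).eval s| ≤ L * |t - s| := fun e => by
    obtain ⟨L, hL⟩ := isCompact_Icc.exists_bound_of_continuousOn (s := Icc (0 : ℝ) 1)
      (Polynomial.derivative (r e)).continuous.continuousOn
    refine ⟨L, (norm_nonneg _).trans (hL 0 (by simp)), fun t ht s hs => ?_⟩
    exact (convex_Icc (0 : ℝ) 1).norm_image_sub_le_of_norm_hasDerivWithin_le
      (fun x _ => ((r e).hasDerivAt x).hasDerivWithinAt) hL hs ht
  choose L hL0 hL using h
  refine ⟨∑ e, L e, Finset.sum_nonneg fun e _ => hL0 e, fun e t ht s hs => (hL e t ht s hs).trans ?_⟩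
  gcongr
  exact Finset.single_le_sum (fun e _ => hL0 e) (Finset.mem_univ e)

/-- The Lipschitz bound is with respect to distance in the plane and not arc length, hence the
cases: same edge, edges with a common vertex (positive angle), and disjoint edges (positive
distance). -/
lemma exists_edge_lipschitz {r : Fin N → Polynomial ℝ}
    (hr : ∀ e, (r e).eval 1 = (r (finRotate N e)).eval 0) (e f : Fin N) :
    ∃ K : ℝ, 0 ≤ K ∧ ∀ t ∈ Icc (0 : ℝ) 1, ∀ s ∈ Icc (0 : ℝ) 1,
      |(r e).eval t - (r f).eval s| ≤ K * dist (P.edgePath ℝ e t) (P.edgePath ℝ f s) := by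
  obtain ⟨L, hL0, hL⟩ := exists_poly_lipschitz r
  have i0 : (0 : ℝ) ∈ Icc (0 : ℝ) 1 := by simp
  have i1 : (1 : ℝ) ∈ Icc (0 : ℝ) 1 := by simp
  -- The comparison passes through the common vertex; the angle bound controls the sum of the two
  -- parameter distances to it by the distance of the points.
  have hadj : ∀ e, ∃ K : ℝ, 0 ≤ K ∧ ∀ t ∈ Icc (0 : ℝ) 1, ∀ s ∈ Icc (0 : ℝ) 1,
      |(r e).eval t - (r (finRotate N e)).eval s| ≤
        K * dist (P.edgePath ℝ e t) (P.edgePath ℝ (finRotate N e) s) := fun e => by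
    obtain ⟨κ, hκ, hdist⟩ := exists_angle_bound (P := P) e
    refine ⟨L / κ, by positivity, fun t ht s hs => ?_⟩
    have h1 := hdist (1 - t) ⟨by linarith [ht.2], by linarith [ht.1]⟩ s hs
    rw [sub_sub_cancel] at h1
    have h2 := hL e t ht 1 i1
    have h3 := hL (finRotate N e) 0 i0 s hs
    rw [abs_sub_comm t, abs_of_nonneg (by linarith [ht.2] : 0 ≤ 1 - t)] at h2
    rw [abs_sub_comm 0, abs_of_nonneg (by linarith [hs.1] : 0 ≤ s - 0)] at h3
    calc |(r e).eval t - (r (finRotate N e)).eval s|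
        ≤ |(r e).eval t - (r e).eval 1| + |(r (finRotate N e)).eval 0 - (r (finRotate N e)).eval s| := by
          rw [hr e]; exact abs_sub_le _ _ _
      _ ≤ L / κ * (κ * (1 - t + s)) := by
          rw [← mul_assoc, div_mul_cancel₀ _ hκ.ne']
          linarith
      _ ≤ _ := by gcongr
  by_cases hef : e = f
  · subst hef
    have hE : 0 < ‖P.vertices (finRotate N e) - P.vertices e‖ := norm_pos_iff.2 (P.edge_ne_zero e)
    refine ⟨L / ‖P.vertices (finRotate N e) - P.vertices e‖, by positivity, fun t ht s hs => ?_⟩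
    refine (hL e t ht s hs).trans_eq ?_
    rw [dist_eq_norm, edgePath_apply, edgePath_apply, add_sub_add_left_eq_sub, ← sub_smul,
      norm_smul, Real.norm_eq_abs]
    field_simp
  by_cases h1 : f = finRotate N e
  · rw [h1]; exact hadj e
  by_cases h2 : e = finRotate N f
  · obtain ⟨K, hK0, hK⟩ := hadj f
    rw [h2]
    refine ⟨K, hK0, fun t ht s hs => ?_⟩
    rw [abs_sub_comm, dist_comm]
    exact hK s hs t ht
  -- Edges that are neither equal nor consecutive are disjoint, so by compactness they have a
  -- positive distance `δ`, and a bound `M` of the difference gives the constant `M / δ`.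
  · have hne : ∀ q ∈ Icc (0 : ℝ) 1 ×ˢ Icc (0 : ℝ) 1,
        0 < dist (P.edgePath ℝ e q.1) (P.edgePath ℝ f q.2) := by
      rintro ⟨t, s⟩ ⟨ht, hs⟩
      rw [dist_pos]
      intro h
      obtain ⟨ha, hb⟩ := P.edges_inter e f hef ⟨⟨t, ht, rfl⟩, ⟨s, hs, h.symm⟩⟩
      have hinj := fun a b => @P.vertices_injective a b
      rcases ha with ha | ha <;> rcases hb with hb | hb <;> rw [mem_singleton_iff.1 ha] at hb
      · exact hef (hinj _ _ hb)
      · exact h2 (hinj _ _ (mem_singleton_iff.1 hb))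
      · exact h1 (hinj _ _ hb).symm
      · exact hef ((finRotate N).injective (hinj _ _ (mem_singleton_iff.1 hb)))
    have hcont : Continuous fun q : ℝ × ℝ => dist (P.edgePath ℝ e q.1) (P.edgePath ℝ f q.2) :=
      ((continuous_edgePath P e).comp continuous_fst).dist
        ((continuous_edgePath P f).comp continuous_snd)
    have hcomp : IsCompact (Icc (0 : ℝ) 1 ×ˢ Icc (0 : ℝ) 1) := isCompact_Icc.prod isCompact_Icc
    obtain ⟨q₀, hq₀, hmin⟩ := hcomp.exists_isMinOn ⟨(0, 0), i0, i0⟩ hcont.continuousOn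
    have hδ := hne q₀ hq₀
    set δ := dist (P.edgePath ℝ e q₀.1) (P.edgePath ℝ f q₀.2) with hδdef
    obtain ⟨M, hM⟩ := hcomp.exists_bound_of_continuousOn
      (f := fun q : ℝ × ℝ => (r e).eval q.1 - (r f).eval q.2)
      ((((r e).continuous.comp continuous_fst).sub
        ((r f).continuous.comp continuous_snd)).continuousOn)
    have hM0 : 0 ≤ M := (norm_nonneg _).trans (hM (0, 0) ⟨i0, i0⟩)
    refine ⟨M / δ, by positivity, fun t ht s hs => ?_⟩
    calc _ ≤ M := hM (t, s) ⟨ht, hs⟩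
      _ = M / δ * δ := by field_simp
      _ ≤ _ := by
        gcongr
        exact hmin (a := (t, s)) ⟨ht, hs⟩

/-- Continuous piecewise polynomial data on the boundary extend to Lipschitz functions. -/
lemma exists_lipschitz_extension {r : Fin N → Polynomial ℝ}
    (hr : ∀ e, (r e).eval 1 = (r (finRotate N e)).eval 0) :
    ∃ (K : NNReal) (g : Plane → ℝ), LipschitzWith K g ∧
      ∀ e, ∀ t ∈ Icc (0 : ℝ) 1, g (P.edgePath ℝ e t) = (r e).eval t := by
  choose K hK0 hK using exists_edge_lipschitz (P := P) hr
  set C : ℝ := ∑ e, ∑ f, K e f with hC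
  have hKC : ∀ e f, K e f ≤ C := fun e f =>
    (Finset.single_le_sum (f := fun f => K e f) (fun f _ => hK0 e f) (Finset.mem_univ f)).trans
      (Finset.single_le_sum (f := fun e => ∑ f, K e f)
        (fun e _ => Finset.sum_nonneg fun f _ => hK0 e f) (Finset.mem_univ e))
  have hC0 : 0 ≤ C := Finset.sum_nonneg fun e _ => Finset.sum_nonneg fun f _ => hK0 e f
  have hb : ∀ x : P.boundary ℝ, ∃ q : Fin N × ℝ, q.2 ∈ Icc (0 : ℝ) 1 ∧
      P.edgePath ℝ q.1 q.2 = x := fun x => by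
    obtain ⟨e, t, ht, h⟩ := mem_iUnion.1 x.2
    exact ⟨(e, t), ht, h⟩
  choose q hq hqx using hb
  classical
  -- A vertex has parameters on two edges and an arbitrary one is chosen; the next bound, at
  -- distance `0`, shows that the choice does not matter.
  let g₀ : Plane → ℝ := fun x => if h : x ∈ P.boundary ℝ then (r (q ⟨x, h⟩).1).eval (q ⟨x, h⟩).2 else 0
  have hg₀ : ∀ e, ∀ t ∈ Icc (0 : ℝ) 1, ∀ x ∈ P.boundary ℝ,
      |(r e).eval t - g₀ x| ≤ C * dist (P.edgePath ℝ e t) x := fun e t ht x hx => by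
    have h := hK e (q ⟨x, hx⟩).1 t ht _ (hq ⟨x, hx⟩)
    rw [hqx] at h
    simp only [g₀, dif_pos hx]
    exact h.trans (by gcongr; exact hKC _ _)
  have hlip : LipschitzOnWith C.toNNReal g₀ (P.boundary ℝ) := by
    refine LipschitzOnWith.of_dist_le_mul fun x hx y hy => ?_
    have h := hg₀ (q ⟨x, hx⟩).1 _ (hq ⟨x, hx⟩) y hy
    rw [hqx] at h
    rw [Real.coe_toNNReal _ hC0, Real.dist_eq]
    simpa only [g₀, dif_pos hx] using h
  obtain ⟨g, hg, hgg⟩ := hlip.extend_real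
  refine ⟨_, g, hg, fun e t ht => ?_⟩
  rw [← hgg (edgePath_mem P e ht)]
  have h := hg₀ e t ht _ (edgePath_mem P e ht)
  rw [dist_self, mul_zero] at h
  exact (sub_eq_zero.1 (abs_eq_zero.1 (le_antisymm h (abs_nonneg _)))).symm

end PolygonalElement

/-! ### Unisolvence -/

/-- A linear relation that is functional, total, injective and surjective is a linear
equivalence. -/
lemma exists_linearEquiv_of_relation {V D : Type*} [AddCommGroup V] [Module ℝ V] [AddCommGroup D]
    [Module ℝ D] {R : V → D → Prop}
    (hlin : ∀ (a : ℝ) v w d d', R v d → R w d' → R (a • v + w) (a • d + d'))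
    (htot : ∀ v, ∃ d, R v d) (hfun : ∀ d, R 0 d → d = 0) (hinj : ∀ v, R v 0 → v = 0)
    (hsurj : ∀ d, ∃ v, R v d) : ∃ e : V ≃ₗ[ℝ] D, ∀ v d, R v d ↔ e v = d := by
  -- By linearity, two values at `v` differ by a value at `0`.
  have huniq : ∀ v d d', R v d → R v d' → d = d' := fun v d d' h h' => by
    have := hlin (-1) _ _ _ _ h h'
    rw [neg_one_smul, neg_add_cancel] at this
    have := hfun _ this
    rwa [neg_one_smul, neg_add_eq_zero] at this
  choose f hf using htot
  have h00 : R 0 0 := by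
    have := hlin (-1) _ _ _ _ (hf 0) (hf 0)
    simpa using this
  let F : V →ₗ[ℝ] D :=
    { toFun := f
      map_add' := fun v w => huniq _ _ _ (hf _) (by simpa using hlin 1 _ _ _ _ (hf v) (hf w))
      map_smul' := fun a v => huniq _ _ _ (hf _) (by simpa using hlin a _ _ _ _ (hf v) h00) }
  have hF : ∀ v d, R v d ↔ F v = d := fun v d =>
    ⟨fun h => huniq _ _ _ (hf v) h, fun h => h ▸ hf v⟩
  refine ⟨LinearEquiv.ofBijective F ⟨?_, fun d => ?_⟩, hF⟩
  · rw [← LinearMap.ker_eq_bot, LinearMap.ker_eq_bot']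
    exact fun v hv => hinj v ((hF v 0).2 hv)
  · obtain ⟨v, hv⟩ := hsurj d
    exact ⟨v, (hF v d).1 hv⟩

/-! ### The degrees of freedom as a linear relation. -/

variable {P : PolygonalElement N} {nrm tng : Fin N → Plane} {k : ℕ}

lemma edgeComp_lin (d : Fin N → Plane) (a : ℝ) (g h : Fin 2 → Plane → ℝ) (e : Fin N) (t : ℝ) :
    edgeComp P d (fun j x => a * g j x + h j x) e t = a * edgeComp P d g e t + edgeComp P d h e t := by
  simp only [edgeComp, Finset.mul_sum, ← Finset.sum_add_distrib]
  exact Finset.sum_congr rfl fun j _ => by ring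

lemma continuousOn_edgeComp (d : Fin N → Plane) {g : Fin 2 → Plane → ℝ}
    (hg : ∀ j, ContinuousOn (g j) (P.boundary ℝ)) (e : Fin N) :
    ContinuousOn (edgeComp P d g e) (Icc 0 1) := by
  unfold edgeComp
  exact continuousOn_finsetSum _ fun j _ => (continuousOn_edge (hg j) e).mul continuousOn_const

lemma integrable_edgeComp_mul (d : Fin N → Plane) {g : Fin 2 → Plane → ℝ}
    (hg : ∀ j, ContinuousOn (g j) (P.boundary ℝ)) (e : Fin N) (q : Polynomial ℝ) :
    Integrable (fun t => edgeComp P d g e t * q.eval t) (volume.restrict (Icc (0 : ℝ) 1)) :=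
  ((continuousOn_edgeComp d hg e).mul q.continuous.continuousOn).integrableOn_compact isCompact_Icc

/-- Moments of a boundary field on an edge. -/
def edgeMoment (d : Fin N → Plane) {g : Fin 2 → Plane → ℝ}
    (hg : ∀ j, ContinuousOn (g j) (P.boundary ℝ)) (e : Fin N) : Polynomial ℝ →ₗ[ℝ] ℝ where
  toFun q := ∫ t in Icc (0 : ℝ) 1, edgeComp P d g e t * q.eval t
  map_add' p q := by
    rw [← integral_add (integrable_edgeComp_mul d hg e p) (integrable_edgeComp_mul d hg e q)]
    simp only [Polynomial.eval_add, mul_add]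
  map_smul' a p := by
    rw [RingHom.id_apply, smul_eq_mul, ← integral_const_mul]
    simp only [Polynomial.eval_smul, smul_eq_mul, mul_left_comm]

lemma integral_sum_mul_pval (v : Fin 2 → L2 P.region) (q : Fin 2 → MvPolynomial (Fin 2) ℝ) :
    ∫ x in P.region, ∑ j, v j x * pval (q j) x = ∑ j, P.moment (v j) (q j) :=
  integral_finsetSum _ fun j _ =>
    L2.integrable_mul P.isOpen_region P.isBounded_region (v j) (continuous_pval (q j))

lemma volume_region_pos (P : PolygonalElement N) : 0 < (volume P.region).toReal :=
  ENNReal.toReal_pos (P.isOpen_region.measure_pos _ P.isConnected_region.nonempty).ne'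
    P.isBounded_region.measure_lt_top.ne

lemma HasDofs.lin (a : ℝ) {v w : Fin 2 → L2 P.region} {d d' : DofValues N k}
    (hv : HasDofs P nrm tng k v d) (hw : HasDofs P nrm tng k w d') :
    HasDofs P nrm tng k (a • v + w) (a • d + d') := by
  obtain ⟨⟨g, hg, h1, h2, h3⟩, h4⟩ := hv
  obtain ⟨⟨g', hg', h1', h2', h3'⟩, h4'⟩ := hw
  have hmom : ∀ (n : Fin N → Plane) (e : Fin N) (q : Polynomial ℝ),
      ∫ t in Icc (0 : ℝ) 1, edgeComp P n (fun j x => a * g j x + g' j x) e t * q.eval t =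
      a * (∫ t in Icc (0 : ℝ) 1, edgeComp P n g e t * q.eval t) +
        ∫ t in Icc (0 : ℝ) 1, edgeComp P n g' e t * q.eval t := fun n e q => by
    rw [← integral_const_mul, ← integral_add
      ((integrable_edgeComp_mul n (fun j => (hg j).1) e q).const_mul a)
      (integrable_edgeComp_mul n (fun j => (hg' j).1) e q)]
    refine integral_congr_ae (Eventually.of_forall fun t => ?_)
    simp only [edgeComp_lin]
    ring
  refine ⟨⟨_, fun j => (hg j).lin a (hg' j), fun i j => ?_, fun e q => ?_, fun e q => ?_⟩,
    fun q => ?_⟩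
  · change a * d.1 i j + d'.1 i j = _
    rw [h1, h1']
  · change a * d.2.1 e q + d'.2.1 e q = _
    rw [h2, h2', hmom]
  · change a * d.2.2.1 e q + d'.2.2.1 e q = _
    rw [h3, h3', hmom]
  · change a * d.2.2.2 q + d'.2.2.2 q = _
    rw [h4, h4', integral_sum_mul_pval, integral_sum_mul_pval, integral_sum_mul_pval]
    have : ∀ j, (a • v + w) j = a • v j + w j := fun j => rfl
    simp only [this, PolygonalElement.moment_lin, LinearMap.add_apply, LinearMap.smul_apply, smul_eq_mul,
      Finset.sum_add_distrib, ← Finset.mul_sum]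
    ring

lemma HasDofs.exists_of_trace {v : Fin 2 → L2 P.region} {g : Fin 2 → Plane → ℝ}
    (hg : ∀ j, HasContTrace P (v j) (g j)) : ∃ d, HasDofs P nrm tng k v d := by
  let c : Module.Dual ℝ (VecPolyLT (k - 1)) :=
    (volume P.region).toReal⁻¹ • ∑ j, ((P.moment (v j)).domRestrict (polyLT (k - 1))).comp
      (LinearMap.proj j)
  refine ⟨⟨fun i j => g j (P.vertices i),
    fun e => (edgeMoment nrm (fun j => (hg j).1) e).domRestrict _,
    fun e => (edgeMoment tng (fun j => (hg j).1) e).domRestrict _, c⟩,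
    ⟨g, hg, fun _ _ => rfl, fun _ _ => rfl, fun _ _ => rfl⟩, fun q => ?_⟩
  rw [integral_sum_mul_pval]
  simp [c]
  ring

lemma edgeComp_congr (d : Fin N → Plane) {g h : Fin 2 → Plane → ℝ} {e : Fin N} {t : ℝ}
    (hgh : ∀ j, g j (P.edgePath ℝ e t) = h j (P.edgePath ℝ e t)) :
    edgeComp P d g e t = edgeComp P d h e t := by
  simp only [edgeComp, hgh]

lemma HasDofs.eq_zero {d : DofValues N k} (h : HasDofs P nrm tng k 0 d) : d = 0 := by
  obtain ⟨⟨g, hg, h1, h2, h3⟩, h4⟩ := h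
  have hg0 : ∀ j e, ∀ t ∈ Icc (0 : ℝ) 1, g j (P.edgePath ℝ e t) = 0 := fun j e t ht =>
    PolygonalElement.trace_eq_zero (hg j) e ht
  have hc : ∀ (n : Fin N → Plane) (e : Fin N) (q : Polynomial ℝ),
      ∫ t in Icc (0 : ℝ) 1, edgeComp P n g e t * q.eval t = 0 := fun n e q => by
    rw [setIntegral_congr_fun (g := fun _ => (0 : ℝ)) measurableSet_Icc fun t ht => by
      simp [edgeComp, hg0 _ e t ht]]
    simp
  refine Prod.ext ?_ (Prod.ext ?_ (Prod.ext ?_ ?_))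
  · funext i j
    rw [h1, ← P.edgePath_zero, hg0 j i 0 (by simp)]
    rfl
  · funext e
    refine LinearMap.ext fun q => ?_
    rw [h2, hc]
    rfl
  · funext e
    refine LinearMap.ext fun q => ?_
    rw [h3, hc]
    rfl
  · refine LinearMap.ext fun q => ?_
    rw [h4, integral_sum_mul_pval]
    have h0 : P.moment 0 = 0 := by
      have := PolygonalElement.moment_lin (P := P) (-1) 0 0
      simpa using this
    simp [h0]

/-! ### Vertex values and edge moments determine the trace. -/

lemma orthonormal_coord {n t : Plane} (hn : ‖n‖ = 1) (ht : ‖t‖ = 1) (h : inner ℝ t n = 0) :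
    n 0 * n 0 + n 1 * n 1 = 1 ∧ t 0 * t 0 + t 1 * t 1 = 1 ∧ n 0 * t 0 + n 1 * t 1 = 0 ∧
    n 0 * n 0 + t 0 * t 0 = 1 ∧ n 1 * n 1 + t 1 * t 1 = 1 ∧ n 0 * n 1 + t 0 * t 1 = 0 := by
  have hn' : n 0 * n 0 + n 1 * n 1 = 1 := by
    have := EuclideanSpace.real_norm_sq_eq n
    rw [hn, Fin.sum_univ_two] at this
    linarith
  have ht' : t 0 * t 0 + t 1 * t 1 = 1 := by
    have := EuclideanSpace.real_norm_sq_eq t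
    rw [ht, Fin.sum_univ_two] at this
    linarith
  have h' : n 0 * t 0 + n 1 * t 1 = 0 := by
    rw [PiLp.inner_apply, Fin.sum_univ_two] at h
    simpa using h
  -- For square matrices a one-sided inverse is two-sided, so orthonormal rows imply orthonormal
  -- columns.
  have hM : !![n 0, n 1; t 0, t 1] * !![n 0, t 0; n 1, t 1] = (1 : Matrix (Fin 2) (Fin 2) ℝ) := by
    ext i j
    fin_cases i <;> fin_cases j <;> simp [Matrix.mul_apply, Fin.sum_univ_two] <;> linarith
  have hM' := mul_eq_one_comm.1 hM
  have e00 := congrFun (congrFun hM' 0) 0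
  have e11 := congrFun (congrFun hM' 1) 1
  have e01 := congrFun (congrFun hM' 0) 1
  simp [Matrix.mul_apply, Fin.sum_univ_two] at e00 e11 e01
  exact ⟨hn', ht', h', by linarith, by linarith, by linarith⟩

/-- Vanishing vertex values and edge moments determine a vanishing trace. -/
lemma trace_eq_zero_of_hasDofs (hn : ∀ e, ‖nrm e‖ = 1)
    (htng : ∀ e, ‖tng e‖ = 1 ∧ inner ℝ (tng e) (nrm e) = 0) (hk : 1 ≤ k)
    {v : Fin 2 → L2 P.region} (hv : HasDofs P nrm tng k v 0) {g : Fin 2 → Plane → ℝ}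
    (hg : ∀ j, HasContTrace P (v j) (g j)) (hpoly : HasPolyEdges P nrm tng k g) (j : Fin 2)
    (e : Fin N) {t : ℝ} (ht : t ∈ Icc (0 : ℝ) 1) : g j (P.edgePath ℝ e t) = 0 := by
  obtain ⟨⟨g', hg', h1, h2, h3⟩, -⟩ := hv
  have hgg : ∀ j e, ∀ t ∈ Icc (0 : ℝ) 1, g' j (P.edgePath ℝ e t) = g j (P.edgePath ℝ e t) :=
    fun j e t ht => PolygonalElement.trace_unique (hg' j) (hg j) e ht
  have i0 : (0 : ℝ) ∈ Icc (0 : ℝ) 1 := by simp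
  have i1 : (1 : ℝ) ∈ Icc (0 : ℝ) 1 := by simp
  have hz : ∀ e j, g j (P.vertices e) = 0 := fun e j => by
    have := h1 e j
    rw [← P.edgePath_zero e, hgg j e 0 i0, P.edgePath_zero] at this
    exact this.symm
  -- The moments refer to the trace `g'` chosen in the degrees of freedom and the polynomial shape
  -- to the trace `g`; uniqueness of traces lets them be combined.
  have hvan : ∀ (d : Fin N → Plane) (m : ℕ) (q : Polynomial ℝ),
      q ∈ Polynomial.degreeLT ℝ (m + 2) → (∀ t ∈ Icc (0 : ℝ) 1, edgeComp P d g e t = q.eval t) →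
      (∀ r ∈ Polynomial.degreeLT ℝ m,
        ∫ t in Icc (0 : ℝ) 1, edgeComp P d g' e t * r.eval t = 0) → edgeComp P d g e t = 0 := by
    intro d m q hq hqe hm
    have hq0 : q = 0 := by
      refine edgePoly_eq_zero hq ?_ ?_ fun r hr => ?_
      · rw [← hqe 0 i0, edgeComp, P.edgePath_zero]
        simp [hz]
      · rw [← hqe 1 i1, edgeComp, P.edgePath_one]
        simp [hz]
      · refine (setIntegral_congr_fun measurableSet_Icc fun s hs => ?_).trans (hm r hr)
        simp only [← hqe s hs, edgeComp_congr d fun j => hgg j e s hs]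
    rw [hqe t ht, hq0, Polynomial.eval_zero]
  obtain ⟨⟨q, hq, hqe⟩, r, hr, hre⟩ := hpoly e
  have hN := hvan nrm k q hq hqe fun s hs => (h2 e ⟨s, hs⟩).symm
  -- Here `k ≥ 1` enters: with natural subtraction, `k - 1 + 2 = k + 1`. For `k = 1` there are no
  -- tangential moments and the end values suffice.
  have hT := hvan tng (k - 1) r (by rwa [show k - 1 + 2 = k + 1 by omega]) hre
    fun s hs => (h3 e ⟨s, hs⟩).symm
  obtain ⟨-, -, -, e00, e11, e01⟩ := orthonormal_coord (hn e) (htng e).1 (htng e).2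
  rw [edgeComp, Fin.sum_univ_two] at hN hT
  fin_cases j
  · simp only [Fin.zero_eta]
    linear_combination nrm e 0 * hN + tng e 0 * hT - g 0 (P.edgePath ℝ e t) * e00
      - g 1 (P.edgePath ℝ e t) * e01
  · simp only [Fin.mk_one]
    linear_combination nrm e 1 * hN + tng e 1 * hT - g 0 (P.edgePath ℝ e t) * e01
      - g 1 (P.edgePath ℝ e t) * e11

/-- Vertex values and edge moments can be prescribed. -/
lemma exists_boundary_data (hn : ∀ e, ‖nrm e‖ = 1)
    (htng : ∀ e, ‖tng e‖ = 1 ∧ inner ℝ (tng e) (nrm e) = 0) (hk : 1 ≤ k) (d : DofValues N k) :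
    ∃ (K : Fin 2 → NNReal) (g : Fin 2 → Plane → ℝ), (∀ j, LipschitzWith (K j) (g j)) ∧
      HasPolyEdges P nrm tng k g ∧ (∀ i j, d.1 i j = g j (P.vertices i)) ∧
      (∀ e q, d.2.1 e q =
        ∫ t in Icc (0 : ℝ) 1, edgeComp P nrm g e t * (q : Polynomial ℝ).eval t) ∧
      ∀ e q, d.2.2.1 e q =
        ∫ t in Icc (0 : ℝ) 1, edgeComp P tng g e t * (q : Polynomial ℝ).eval t := by
  have hex : ∀ (n : Fin N → Plane) (m : ℕ)
      (f : Fin N → Module.Dual ℝ (Polynomial.degreeLT ℝ m)) (e : Fin N),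
      ∃ p ∈ Polynomial.degreeLT ℝ (m + 2), p.eval 0 = ∑ j, d.1 e j * n e j ∧
        p.eval 1 = ∑ j, d.1 (finRotate N e) j * n e j ∧ ∀ q : Polynomial.degreeLT ℝ m,
          ∫ t in Icc (0 : ℝ) 1, p.eval t * (q : Polynomial ℝ).eval t = f e q :=
    fun n m f e => exists_edgePoly _ _ (f e)
  choose p hp hp0 hp1 hpm using hex nrm k d.2.1
  choose s hs hs0 hs1 hsm using hex tng (k - 1) d.2.2.1
  have hon := fun e => orthonormal_coord (hn e) (htng e).1 (htng e).2
  -- The Cartesian components on the edge. The frames of two consecutive edges may differ, but the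
  -- Cartesian values at their common vertex agree, which is the continuity needed for the
  -- extension.
  let r : Fin 2 → Fin N → Polynomial ℝ := fun j e => nrm e j • p e + tng e j • s e
  have hr : ∀ j e t, (r j e).eval t = nrm e j * (p e).eval t + tng e j * (s e).eval t := by
    intro j e t
    simp [r]
  have hr0 : ∀ j e, (r j e).eval 0 = d.1 e j := fun j e => by
    obtain ⟨-, -, -, e00, e11, e01⟩ := hon e
    rw [hr, hp0, hs0, Fin.sum_univ_two, Fin.sum_univ_two]
    fin_cases j
    · simp only [Fin.zero_eta]
      linear_combination d.1 e 0 * e00 + d.1 e 1 * e01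
    · simp only [Fin.mk_one]
      linear_combination d.1 e 0 * e01 + d.1 e 1 * e11
  have hr1 : ∀ j e, (r j e).eval 1 = d.1 (finRotate N e) j := fun j e => by
    obtain ⟨-, -, -, e00, e11, e01⟩ := hon e
    rw [hr, hp1, hs1, Fin.sum_univ_two, Fin.sum_univ_two]
    fin_cases j
    · simp only [Fin.zero_eta]
      linear_combination d.1 (finRotate N e) 0 * e00 + d.1 (finRotate N e) 1 * e01
    · simp only [Fin.mk_one]
      linear_combination d.1 (finRotate N e) 0 * e01 + d.1 (finRotate N e) 1 * e11
  choose K g hg hge using fun j => PolygonalElement.exists_lipschitz_extension (P := P) (r := r j)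
    fun e => by rw [hr0, hr1]
  have hcn : ∀ e, ∀ t ∈ Icc (0 : ℝ) 1, edgeComp P nrm g e t = (p e).eval t := fun e t ht => by
    obtain ⟨a, -, b, -⟩ := hon e
    rw [edgeComp, Fin.sum_univ_two, hge 0 e t ht, hge 1 e t ht, hr, hr]
    linear_combination (p e).eval t * a + (s e).eval t * b
  have hct : ∀ e, ∀ t ∈ Icc (0 : ℝ) 1, edgeComp P tng g e t = (s e).eval t := fun e t ht => by
    obtain ⟨-, a, b, -⟩ := hon e
    rw [edgeComp, Fin.sum_univ_two, hge 0 e t ht, hge 1 e t ht, hr, hr]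
    linear_combination (s e).eval t * a + (p e).eval t * b
  refine ⟨K, g, hg, fun e => ⟨⟨p e, hp e, hcn e⟩, s e, ?_, hct e⟩, fun i j => ?_, fun e q => ?_,
    fun e q => ?_⟩
  · have := hs e
    rwa [show k - 1 + 2 = k + 1 by omega] at this
  · rw [← P.edgePath_zero, hge j i 0 (by simp), hr0]
  · rw [← hpm e q]
    exact setIntegral_congr_fun measurableSet_Icc fun t ht => by simp only [hcn e t ht]
  · rw [← hsm e q]
    exact setIntegral_congr_fun measurableSet_Icc fun t ht => by simp only [hct e t ht]

lemma moment_eq_zero_of_hasDofs {v : Fin 2 → L2 P.region} (hv : HasDofs P nrm tng k v 0) (j : Fin 2)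
    {q : MvPolynomial (Fin 2) ℝ} (hq : q ∈ polyLT (k - 1)) : P.moment (v j) q = 0 := by
  have h := hv.2 (Pi.single j ⟨q, hq⟩)
  rw [integral_sum_mul_pval, Finset.sum_eq_single j] at h
  · rw [Pi.single_eq_same] at h
    exact (mul_eq_zero.1 h.symm).resolve_left (inv_ne_zero (volume_region_pos P).ne')
  · intro i _ hi
    rw [Pi.single_eq_of_ne hi]
    simp
  · simp

/-- Fields with a given trace, given degrees of freedom and a polynomial Laplacian. -/
lemma exists_regular (hn : ∀ e, ‖nrm e‖ = 1)
    (htng : ∀ e, ‖tng e‖ = 1 ∧ inner ℝ (tng e) (nrm e) = 0) (hk : 1 ≤ k) (d : DofValues N k) :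
    ∃ v, MemRegular P nrm tng k v ∧ HasDofs P nrm tng k v d := by
  obtain ⟨K, g, hg, hpoly, h1, h2, h3⟩ := exists_boundary_data (P := P) hn htng hk d
  -- The cell functional is split into its two components and multiplied by `|P|` to undo the
  -- normalization of the cell moments.
  choose v p hp hv hvl hvm using fun j => PolygonalElement.exists_laplacian_moment (P := P) (hg j) (k - 1)
    ((volume P.region).toReal • d.2.2.2.comp (LinearMap.single ℝ (fun _ => polyLT (k - 1)) j))
  refine ⟨v, ⟨fun j => ?_, ⟨g, hv, hpoly⟩, fun j => ⟨p j, hp j, hvl j⟩⟩, ⟨g, hv, h1, h2, h3⟩,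
    fun q => ?_⟩
  · obtain ⟨-, G, hG, -⟩ := hv j
    exact ⟨G, hG⟩
  · rw [integral_sum_mul_pval]
    simp only [hvm, LinearMap.smul_apply, LinearMap.comp_apply, smul_eq_mul, ← Finset.mul_sum]
    rw [← mul_assoc, inv_mul_cancel₀ (volume_region_pos P).ne', one_mul, ← map_sum]
    congr 1
    exact (LinearMap.sum_single_apply (fun _ => polyLT (k - 1)) q).symm

/-- Injectivity: vanishing degrees of freedom leave a field with zero trace whose components are
orthogonal to `ℙ_{k-2}`, the space that contains their Laplacians. -/
lemma isUnisolvent_regularSpace (hn : ∀ e, ‖nrm e‖ = 1)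
    (htng : ∀ e, ‖tng e‖ = 1 ∧ inner ℝ (tng e) (nrm e) = 0) (hk : 1 ≤ k) :
    IsUnisolvent P nrm tng k (regularSpace P nrm tng k) := by
  refine exists_linearEquiv_of_relation
    (R := fun (v : regularSpace P nrm tng k) d => HasDofs P nrm tng k v d)
    (fun a v w d d' hv hw => hv.lin a hw) (fun v => ?_) (fun d hd => hd.eq_zero) (fun v hv => ?_)
    fun d => ?_
  · obtain ⟨-, ⟨g, hg, -⟩, -⟩ := v.2
    exact HasDofs.exists_of_trace hg
  · obtain ⟨-, ⟨g, hg, hpoly⟩, hl⟩ := v.2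
    refine Subtype.ext (funext fun j => ?_)
    obtain ⟨p, hp, hpl⟩ := hl j
    exact PolygonalElement.eq_zero_of_moment_eq_zero (hg j)
      (fun e t ht => trace_eq_zero_of_hasDofs hn htng hk hv hg hpoly j e ht) hpl hp
      fun q hq => moment_eq_zero_of_hasDofs hv j hq
  · obtain ⟨v, hv, hd⟩ := exists_regular (P := P) hn htng hk d
    exact ⟨⟨v, hv⟩, hd⟩

/-! ### The enhanced space. -/

lemma integral_sub_mul_pval (v : Fin 2 → L2 P.region) (p q : Fin 2 → MvPolynomial (Fin 2) ℝ) :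
    ∫ x in P.region, ∑ j, (v j x - pval (p j) x) * pval (q j) x =
      ∑ j, (P.moment (v j) (q j) - P.moment (P.polyL2 (p j)) (q j)) := by
  have hint : ∀ (w : L2 P.region) (q : MvPolynomial (Fin 2) ℝ),
      Integrable (fun x => w x * pval q x) (volume.restrict P.region) := fun w q =>
    L2.integrable_mul P.isOpen_region P.isBounded_region w (continuous_pval q)
  have hd : ∀ j : Fin 2, Integrable (fun x => v j x * pval (q j) x -
      P.polyL2 (p j) x * pval (q j) x) (volume.restrict P.region) := fun j =>
    (hint (v j) _).sub (hint _ _)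
  simp only [PolygonalElement.moment_apply]
  rw [Finset.sum_congr rfl fun j _ => (integral_sub (hint (v j) _) (hint _ _)).symm,
    ← integral_finsetSum _ fun j _ => hd j]
  refine integral_congr_ae ?_
  filter_upwards [ae_all_iff.2 fun j => PolygonalElement.coeFn_polyL2 (P := P) (p j)] with x hx
  refine Finset.sum_congr rfl fun j _ => ?_
  rw [hx j]
  ring

/-- The Laplacian ranges over `ℙ_k`, so moments against all of `ℙ_k` are needed. Those against
`ℙ_{k-2}` are degrees of freedom, and those against `Q` are dictated by the enhancement condition
through the elliptic projection, which itself depends only on the degrees of freedom. -/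
lemma isUnisolvent_enhancedSpace (hn : ∀ e, ‖nrm e‖ = 1)
    (htng : ∀ e, ‖tng e‖ = 1 ∧ inner ℝ (tng e) (nrm e) = 0) (hk : 1 ≤ k)
    {Q : Submodule ℝ (MvPolynomial (Fin 2) ℝ)} (hQ : IsHighDegreePart k Q) :
    IsUnisolvent P nrm tng k (enhancedSpace P nrm tng k Q) := by
  obtain ⟨hdisj, hsup⟩ := hQ
  refine exists_linearEquiv_of_relation
    (R := fun (v : enhancedSpace P nrm tng k Q) d => HasDofs P nrm tng k v d)
    (fun a v w d d' hv hw => hv.lin a hw) (fun v => ?_) (fun d hd => hd.eq_zero) (fun v hv => ?_)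
    fun d => ?_
  · obtain ⟨-, ⟨g, hg, -⟩, -⟩ := v.2
    exact HasDofs.exists_of_trace hg
  · obtain ⟨-, ⟨g, hg, hpoly⟩, hl, π, hπ, hQ⟩ := v.2
    refine Subtype.ext (funext fun j => ?_)
    have hg0 : ∀ j e, ∀ t ∈ Icc (0 : ℝ) 1, g j (P.edgePath ℝ e t) = 0 := fun j e t ht =>
      trace_eq_zero_of_hasDofs hn htng hk hv hg hpoly j e ht
    have hm : ∀ j, ∀ q ∈ polyLT (k - 1), P.moment ((v : Fin 2 → L2 P.region) j) q = 0 :=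
      fun j q hq => moment_eq_zero_of_hasDofs hv j hq
    have hπ0 : ∀ j, π j = 0 := fun j =>
      PolygonalElement.isEllipticProj_unique (hπ j)
        (PolygonalElement.isEllipticProj_zero (hg j) (hg0 j) (hm j))
    -- As the projection is zero, the enhancement condition says that `v` is orthogonal to `Q`, one
    -- component at a time.
    have hmQ : ∀ q ∈ Q, P.moment ((v : Fin 2 → L2 P.region) j) q = 0 := fun q hq => by
      have h := hQ (Pi.single j q) fun i => by
        by_cases hi : i = j
        · subst hi; rwa [Pi.single_eq_same]
        · rw [Pi.single_eq_of_ne hi]; exact Submodule.zero_mem _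
      rw [integral_sub_mul_pval, Finset.sum_eq_single j] at h
      · have h0 : P.moment 0 = 0 := by
          have := PolygonalElement.moment_lin (P := P) (-1) 0 0
          simpa using this
        rwa [Pi.single_eq_same, hπ0 j, map_zero, h0, LinearMap.zero_apply, sub_zero] at h
      · intro i _ hi
        rw [Pi.single_eq_of_ne hi, map_zero, map_zero, sub_zero]
      · simp
    obtain ⟨p, hp, hpl⟩ := hl j
    refine PolygonalElement.eq_zero_of_moment_eq_zero (hg j) (hg0 j) hpl hp fun q hq => ?_
    rw [← hsup] at hq
    obtain ⟨q1, hq1, q2, hq2, rfl⟩ := Submodule.mem_sup.1 hq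
    rw [map_add, hmQ q1 hq1, hm j q2 hq2, add_zero]
  · obtain ⟨v, ⟨hv1, ⟨g, hg, hpoly⟩, hl⟩, hd⟩ := exists_regular (P := P) hn htng hk d
    choose π hπ using fun j => PolygonalElement.exists_isEllipticProj (hg j) k
    -- `Q` is enlarged to a complement of `ℙ_{k-2}` among all polynomials. The projection `E` then
    -- kills `ℙ_{k-2}` and fixes `Q`, so one functional prescribes both kinds of moments of the
    -- correction `z`.
    obtain ⟨Q', hQQ', hcompl⟩ := hdisj.exists_isCompl
    let E := Submodule.projection Q' (polyLT (k - 1)) hcompl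
    choose z p hp hz hzl hzm using fun j => PolygonalElement.exists_laplacian_moment (P := P)
      PolygonalElement.lipschitzWith_zero_fun (k + 1)
      (((P.moment (P.polyL2 (π j)) - P.moment (v j)).comp E).domRestrict (polyLT (k + 1)))
    have hle : polyLT (k - 1) ≤ polyLT (k + 1) := polyLT_mono (by omega)
    have hQle : Q ≤ polyLT (k + 1) := hsup ▸ le_sup_left
    have hz0 : ∀ j, ∀ q ∈ polyLT (k - 1), P.moment (z j) q = 0 := fun j q hq => by
      have h : E q = 0 := by
        simp only [E]
        rw [Submodule.projection_apply_eq_zero_iff]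
        exact hq
      have := hzm j ⟨q, hle hq⟩
      simpa [h] using this
    have hzQ : ∀ j, ∀ q ∈ Q, P.moment (z j) q = P.moment (P.polyL2 (π j)) q - P.moment (v j) q :=
      fun j q hq => by
        have h : E q = q := Submodule.projection_apply_of_mem_left hcompl (hQQ' hq)
        have := hzm j ⟨q, hQle hq⟩
        simpa [h] using this
    have hπz : ∀ j, IsEllipticProj P k (z j) 0 := fun j =>
      PolygonalElement.isEllipticProj_zero (hz j) (fun _ _ _ => rfl) (hz0 j)
    have htr : ∀ j, HasContTrace P (((1 : ℝ) • v + z) j) (g j) := fun j => by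
      have := (hg j).lin 1 (hz j)
      simpa using this
    have hmom : ∀ j q, P.moment (((1 : ℝ) • v + z) j) q = P.moment (v j) q + P.moment (z j) q :=
      fun j q => by
        have : ((1 : ℝ) • v + z) j = (1 : ℝ) • v j + z j := rfl
        rw [this, PolygonalElement.moment_lin, one_smul, LinearMap.add_apply]
    -- The correction has zero trace, zero moments against `ℙ_{k-2}` and zero projection: `v + z`
    -- keeps the degrees of freedom and the projection `π` of `v`, and its moments against `Q`
    -- become those of `π`.
    refine ⟨⟨(1 : ℝ) • v + z, fun j => ?_, ⟨g, htr, hpoly⟩, fun j => ?_, π, fun j => ?_,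
      fun q hq => ?_⟩, ?_⟩
    · obtain ⟨-, G, hG, -⟩ := htr j
      exact ⟨G, hG⟩
    · obtain ⟨r, hr, hrl⟩ := hl j
      exact ⟨_, Submodule.add_mem _ (Submodule.smul_mem _ 1 (hle hr)) (hp j),
        hrl.lin P.isOpen_region P.isBounded_region 1 (hzl j)⟩
    · have := (hπ j).lin 1 (hπz j)
      simpa using this
    · rw [integral_sub_mul_pval]
      refine Finset.sum_eq_zero fun j _ => ?_
      rw [hmom, hzQ j (q j) (hq j)]
      ring
    · obtain ⟨⟨g', hg', h1, h2, h3⟩, h4⟩ := hd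
      refine ⟨⟨g', fun j => ?_, h1, h2, h3⟩, fun q => ?_⟩
      · have := (hg' j).lin 1 (hz j)
        simpa using this
      · rw [h4, integral_sum_mul_pval, integral_sum_mul_pval]
        congr 1
        refine Finset.sum_congr rfl fun j _ => ?_
        rw [hmom, hz0 j _ (q j).2, add_zero]

end

theorem mainTheorem6 {N : ℕ} (P : PolygonalElement N) (nrm tng : Fin N → Plane)
    (hnrm : ∀ e, ‖nrm e‖ = 1 ∧
      inner ℝ (nrm e) (P.vertices (finRotate N e) - P.vertices e) = 0)
    (htng : ∀ e, ‖tng e‖ = 1 ∧ inner ℝ (tng e) (nrm e) = 0)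
    (k : ℕ) (hk : 1 ≤ k) :
    IsUnisolvent P nrm tng k (regularSpace P nrm tng k) ∧
    ∀ Q : Submodule ℝ (MvPolynomial (Fin 2) ℝ), IsHighDegreePart k Q →
      IsUnisolvent P nrm tng k (enhancedSpace P nrm tng k Q) :=
  ⟨isUnisolvent_regularSpace (fun e => (hnrm e).1) htng hk,
    fun _ hQ => isUnisolvent_enhancedSpace (fun e => (hnrm e).1) htng hk hQ⟩
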